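/- Let $k\ge 1$ and $\tau\ge 0$ be integers. Write $\varepsilon=(\varepsilon_0,\dots,\varepsilon_{k-1})\in(\mathbb C^k,0)$ and $P_\varepsilon(x)=x^{k+1}+\sum_{j=0}^{k-1}\varepsilon_jx^j$. Denote by $\mathbb C\{\mathbf z\}$ the algebra of germs at $0$ of holomorphic functions of $\mathbf z$, and by $\mathbb C\{\varepsilon\}^\times$ the group of $c\in\mathbb C\{\varepsilon\}$ with $c_0\neq 0$. Consider data $\mathfrak n=(\mu,u,R,Q)$, where * $\mu\in\mathbb C\{\varepsilon\}$ satisfies $\mu_0+(k+1)\tau\notin\mathbb R_{\le 0}$; * $u\in\mathbb C\{\varepsilon\}[x]$ is polynomial in $x$ of degree at most $k$ and $u_0(0)\neq 0$; * $R$ and $Q$ are germs in $(\varepsilon,x,y)$ of the form $v\sum_{j=1}^k f_{\varepsilon,j}(v)\,x^j$, where $v=P_\varepsilon(x)^\tau y$ and $f_j\in\mathbb C\{\varepsilon,v\}$. The normal form with normal invariant $\mathfrak n$ and orbital normal invariant $\mathfrak o=(\mu,R)$ is the family of germs of vector fields on $(\mathbb C^2,0)$ $$\mathcal Z=\frac{u}{1+uQ}\left(P_\varepsilon(x)\frac{\partial}{\partial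 x}+y\left(1+\mu_\varepsilon x^k+R_\varepsilon(x,y)\right)\frac{\partial}{\partial y}\right).$$ For $c\in\mathbb C\{\varepsilon\}^\times$ and a germ $f$ (scalar or vector valued) in $(\varepsilon,x,y)$ put $(c^*f)_\varepsilon(x,y)=f_\varepsilon(x,c_\varepsilon y)$, and extend this action component-wise to tuples (it is trivial on $\mu$ and $u$). A conjugacy between two such families $\mathcal Z$ and $\widetilde{\mathcal Z}$ is a holomorphic germ $\Psi:(\varepsilon,x,y)\mapsto\Psi_\varepsilon(x,y)\in\mathbb C^2$ at $0$, with $\Psi_0(0,0)=(0,0)$ and with derivative of $\Psi_0$ at $(0,0)$ invertible, such that $D\Psi_\varepsilon(\widetilde{\mathcal Z}_\varepsilon)=\mathcal Z_\varepsilon\circ\Psi_\varepsilon$ near $0$. An orbital equivalence between $\mathcal Z$ and $\widetilde{\mathcal Z}$ is a conjugacy between $U\mathcal Z$ and $\widetilde{\mathcal Z}$ for some $U\in\mathbb C\{\varepsilon,x,y\}$ with $U_0(0,0)\neq 0$. We say that $\Psi$ is fibered if the first component of $\Psi_\varepsilon(x,y)$ is $x$. For $F\in\mathbb C\{\varepsilon,x,y\}$,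 $\Phi_{\mathcal Z}^F$ is the germ $(\varepsilon,x,y)\mapsto\Phi^{F_\varepsilon(x,y)}_{\mathcal Z_\varepsilon}(x,y)$, where $\Phi^t_{\mathcal Z_\varepsilon}$ is the local flow of $\mathcal Z_\varepsilon$ at time $t\in\mathbb C$. **Uniqueness Theorem.** Let $\mathcal Z$ and $\widetilde{\mathcal Z}$ be two normal forms with the same $\tau$, with normal invariants $\mathfrak n,\widetilde{\mathfrak n}$ and orbital normal invariants $\mathfrak o,\widetilde{\mathfrak o}$. 1. There is a conjugacy between $\mathcal Z$ and $\widetilde{\mathcal Z}$ if and only if $c^*\mathfrak n=\widetilde{\mathfrak n}$ for some $c\in\mathbb C\{\varepsilon\}^\times$. For every conjugacy $\Psi$ there exist $c\in\mathbb C\{\varepsilon\}^\times$ with $c^*\mathfrak n=\widetilde{\mathfrak n}$ and a unique $t\in\mathbb C\{\varepsilon\}$ such that $\Psi=c^*\Phi_{\mathcal Z}^t$ ($t$ does not depend on the choice of $c$). Moreover $\Psi$ is fibered if and only if $t=0$, if and only if $\Psi$ is the linear map $(x,y)\mapsto(x,c_\varepsilon y)$. 2. There is an orbital equivalence between $\mathcal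 Z$ and $\widetilde{\mathcal Z}$ if and only if $c^*\mathfrak o=\widetilde{\mathfrak o}$ for some $c\in\mathbb C\{\varepsilon\}^\times$. For every orbital equivalence $\Psi$ there exist $c\in\mathbb C\{\varepsilon\}^\times$ with $c^*\mathfrak o=\widetilde{\mathfrak o}$ and a unique $F\in\mathbb C\{\varepsilon,x,y\}$ such that $\Psi=c^*\Phi_{\mathcal Z}^F$ ($F$ does not depend on the choice of $c$). Moreover $\Psi$ is fibered if and only if $F=0$, if and only if $\Psi$ is the linear map $(x,y)\mapsto(x,c_\varepsilon y)$. -/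

import Mathlib

open Filter Topology

noncomputable section

namespace SaddleNode

/-- The space `ℂ^k` of parameters `ε = (ε₀, …, ε_{k-1})`. -/
abbrev Param (k : ℕ) : Type := Fin k → ℂ

/-- The space `ℂ^k × ℂ²` of the variables `(ε, x, y)`. Elements of `ℂ{ε, x, y}` are represented by
functions on it that are analytic at `0`, and equality of germs is `=ᶠ[𝓝 0]`. -/
abbrev Space (k : ℕ) : Type := Param k × ℂ × ℂ

/-- `P_ε(x) = x^{k+1} + ε_{k-1} x^{k-1} + ⋯ + ε₁ x + ε₀`. -/
def P {k : ℕ} (ε : Param k) (x : ℂ) : ℂ :=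
  x ^ (k + 1) + ∑ j : Fin k, ε j * x ^ (j : ℕ)

/-- The variable `v = P_ε(x)^τ y`. -/
def twist {k : ℕ} (τ : ℕ) (q : Space k) : ℂ :=
  P q.1 q.2.1 ^ τ * q.2.2

/-- `c ∈ ℂ{ε}ˣ`. -/
def IsUnitGerm {k : ℕ} (c : Param k → ℂ) : Prop :=
  AnalyticAt ℂ c 0 ∧ c 0 ≠ 0

/-- `u ∈ ℂ{ε}[x]_{≤ k}` is polynomial in `x` of degree at most `k`, with `u₀(0) ≠ 0`. -/
def IsPolyUnit {k : ℕ} (u : Param k × ℂ → ℂ) : Prop :=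
  (∃ a : Fin (k + 1) → Param k → ℂ, (∀ j, AnalyticAt ℂ (a j) 0) ∧
    u =ᶠ[𝓝 0] fun p => ∑ j, a j p.1 * p.2 ^ (j : ℕ)) ∧
  u 0 ≠ 0

/-- `f ∈ Section_k{P^τ y}`: the germ `f` is
`(ε, x, y) ↦ v ∑_{j=1}^k f_j(ε, v) x^j` with `v = P_ε(x)^τ y` and `f_j ∈ ℂ{ε, v}`. -/
def IsSection {k : ℕ} (τ : ℕ) (f : Space k → ℂ) : Prop :=
  ∃ g : Fin k → Param k × ℂ → ℂ, (∀ j, AnalyticAt ℂ (g j) 0) ∧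
    f =ᶠ[𝓝 0] fun q => twist τ q * ∑ j, g j (q.1, twist τ q) * q.2.1 ^ ((j : ℕ) + 1)

/-- A tuple `(μ, u, R, Q)` of functions of `ε`, `(ε, x)`, `(ε, x, y)` and `(ε, x, y)`. -/
structure Invariant (k : ℕ) where
  μ : Param k → ℂ
  u : Param k × ℂ → ℂ
  R : Space k → ℂ
  Q : Space k → ℂ

/-- `(μ, u, R, Q)` defines a normal form for the twist exponent `τ`. The set `Complex.slitPlane` is
the complement of `ℝ_{≤ 0}`. -/
structure Invariant.IsNormal {k : ℕ} (n : Invariant k) (τ : ℕ) : Prop where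
  analytic_μ : AnalyticAt ℂ n.μ 0
  slit : n.μ 0 + ((k : ℂ) + 1) * (τ : ℂ) ∈ Complex.slitPlane
  poly_u : IsPolyUnit n.u
  section_R : IsSection τ n.R
  section_Q : IsSection τ n.Q

/-- The orbital normal form `𝒳 = P ∂/∂x + y (1 + μ x^k) ∂/∂y + R y ∂/∂y`; a family of vector fields
is given by its two components. -/
def Invariant.orbitalForm {k : ℕ} (n : Invariant k) (q : Space k) : ℂ × ℂ :=
  (P q.1 q.2.1, q.2.2 * (1 + n.μ q.1 * q.2.1 ^ k) + n.R q * q.2.2)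

/-- The normal form `𝒵 = u / (1 + u Q) 𝒳`. -/
def Invariant.form {k : ℕ} (n : Invariant k) (q : Space k) : ℂ × ℂ :=
  (n.u (q.1, q.2.1) / (1 + n.u (q.1, q.2.1) * n.Q q)) • n.orbitalForm q

/-- The action `c^* f : (ε, x, y) ↦ f_ε(x, c_ε y)`. -/
def rescale {k : ℕ} {E : Type*} (c : Param k → ℂ) (f : Space k → E) : Space k → E :=
  fun q => f (q.1, q.2.1, c q.1 * q.2.2)

/-- `c^* (μ, R) = (μ', R')`, as germs. -/
def OrbitalInvariantsMatch {k : ℕ} (c : Param k → ℂ) (n n' : Invariant k) : Prop :=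
  n.μ =ᶠ[𝓝 0] n'.μ ∧ rescale c n.R =ᶠ[𝓝 0] n'.R

/-- `c^* (μ, u, R, Q) = (μ', u', R', Q')`, as germs. -/
def InvariantsMatch {k : ℕ} (c : Param k → ℂ) (n n' : Invariant k) : Prop :=
  n.μ =ᶠ[𝓝 0] n'.μ ∧ n.u =ᶠ[𝓝 0] n'.u ∧
    rescale c n.R =ᶠ[𝓝 0] n'.R ∧ rescale c n.Q =ᶠ[𝓝 0] n'.Q

/-- `Ψ` is a family `(ε, x, y) ↦ Ψ_ε(x, y)`, holomorphic near `0`, such that `Ψ₀` is a local change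
of coordinates at the origin of `ℂ²`. The associated change of coordinates
`(ε, x, y) ↦ (ε, Ψ_ε(x, y))` fixes the parameter. -/
def IsCoordChange {k : ℕ} (Ψ : Space k → ℂ × ℂ) : Prop :=
  AnalyticAt ℂ Ψ 0 ∧ Ψ 0 = 0 ∧
    Function.Bijective (fderiv ℂ (fun p : ℂ × ℂ => Ψ (0, p)) 0)

/-- `Ψ^* Z = Z'`, that is `DΨ_ε (Z'_ε) = Z_ε ∘ Ψ_ε`, as an identity of germs in `(ε, x, y)`. -/
def IsConjugacy {k : ℕ} (Z Z' : Space k → ℂ × ℂ) (Ψ : Space k → ℂ × ℂ) : Prop :=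
  IsCoordChange Ψ ∧
    ∀ᶠ q : Space k in 𝓝 0, fderiv ℂ (fun p : ℂ × ℂ => Ψ (q.1, p)) q.2 (Z' q) = Z (q.1, Ψ q)

/-- `Ψ` is an orbital equivalence between `Z` and `Z'`: it conjugates `U Z` and `Z'` for some
holomorphic germ `U` with `U(0) ≠ 0`. -/
def IsOrbitalEquivalence {k : ℕ} (Z Z' : Space k → ℂ × ℂ) (Ψ : Space k → ℂ × ℂ) : Prop :=
  ∃ U : Space k → ℂ, AnalyticAt ℂ U 0 ∧ U 0 ≠ 0 ∧ IsConjugacy (fun q => U q • Z q) Z' Ψ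

/-- `Φ` is the local flow `(t, (ε, x, y)) ↦ Φ_Z^t(x, y)` of the family `Z` with `Z₀(0, 0) = 0`:
a holomorphic germ along `ℂ × {0}` with `∂Φ/∂t = Z ∘ Φ` and `Φ^0 = id`. -/
def IsLocalFlow {k : ℕ} (Z : Space k → ℂ × ℂ) (Φ : ℂ → Space k → ℂ × ℂ) : Prop :=
  (∀ᶠ q : Space k in 𝓝 0, Φ 0 q = q.2) ∧
  ∀ t₀ : ℂ, AnalyticAt ℂ (fun p : ℂ × Space k => Φ p.1 p.2) (t₀, 0) ∧
    ∀ᶠ p : ℂ × Space k in 𝓝 (t₀, 0),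
      HasDerivAt (fun s => Φ s p.2) (Z (p.2.1, Φ p.1 p.2)) p.1

/-- `Ψ = c^* Φ_Z^F`, as germs, where `Φ_Z^F : (ε, x, y) ↦ Φ_{Z_ε}^{F_ε(x, y)}(x, y)`. -/
def IsRescaledFlow {k : ℕ} (Z : Space k → ℂ × ℂ) (c : Param k → ℂ) (F : Space k → ℂ)
    (Ψ : Space k → ℂ × ℂ) : Prop :=
  ∃ Φ : ℂ → Space k → ℂ × ℂ, IsLocalFlow Z Φ ∧ Ψ =ᶠ[𝓝 0] rescale c (fun q => Φ (F q) q)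

/-- `Ψ` is fibered in the `x`-variable: `Ψ_ε(x, y) = (x, ψ_ε(x, y))`. -/
def IsFibered {k : ℕ} (Ψ : Space k → ℂ × ℂ) : Prop :=
  ∀ᶠ q : Space k in 𝓝 0, (Ψ q).1 = q.2.1

end SaddleNode

end

/-! Write `X` and `X'` for the two orbital forms, so that each normal form is `factor` times its
orbital form. Rescaling `y` by a matching `c` plainly transports one family to the other, so the
content lies in the rigidity of an arbitrary equivalence `Ψ`.

Reduction to a fibered map. The lines `x = x₀` with `P_ε(x₀) = 0` are invariant and `X` is vertical
on them. Comparing linear parts gives `∂Ψ₁/∂x = 1` at the origin, and this forces `Ψ₁ = x + P A`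
(`IsOrbitalConjugacy.exists_fst_eq`). The flow of the normal form also moves `x` by a multiple `P
K`, where `K` grows with time at the nonzero rate `factor 0` at the origin
(`IsParamFlow.exists_displacement`). The implicit function theorem therefore yields a time that
restores `x` (`exists_straightening`), and `Ψ` is a fibered map `(x, η)` followed by a flow. The
same displacement formula shows that a flow preserving `x` has time zero
(`IsParamFlow.time_eq_zero`), whence the uniqueness of the time and the criteria for being fibered.

Fibered maps are linear. The germ `η` vanishes on `y = 0`, so `η = y W`. On `y = 0` the equation for
`W` reads `P ∂ₓW = (μ - μ') xᵏ W`; uniqueness of division by `P` gives `μ = μ'` and `W(ε, x, 0) =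
c(ε)`. The difference `W - c` then solves a linear equation along `X'` whose right-hand side is `c`
times the section `c^* R - R'`.

Rigidity of the linear equation. The lowest coefficient in `y`, of degree `m ≥ 1`, satisfies `P f' +
m (1 + μ xᵏ) f = ∑ P^(τ m) x^(j+1) a_j`, and the lowest term in the parameter reduces this to `ε =
0`. There the Taylor coefficients of `f` vanish up to degree `L = (k+1) τ m`, and beyond `L` they
obey `m b_(i+k) = -(m μ + i) b_i`. The condition on `μ₀ + (k+1) τ` keeps these factors nonzero, so
any nonzero coefficient starts a factorially growing sequence, against convergence. Hence `f = 0`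
and every `a_j = 0` (`eq_zero_of_saddleNode_equation`, `eq_zero_of_cohomological`).

Time. For a conjugacy the time `G` satisfies `X' G = 1/factor' - 1/(c^* factor)`, which is `1/u' -
1/u + Q' - c^* Q`. On `y = 0` division by `P` gives `u = u'`, and the same rigidity result gives `Q'
= c^* Q` and shows that `G` depends on `ε` alone. -/

namespace SaddleNode

open scoped unitInterval

attribute [fun_prop] analyticAt_fst analyticAt_snd

/-! ### Analyticity of projections and directional derivatives -/

section Projections

variable {E F : Type*} [NormedAddCommGroup E] [NormedSpace ℂ E] [NormedAddCommGroup F]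
  [NormedSpace ℂ F] {a : E}

@[fun_prop]
theorem analyticAt_eval {ι : Type*} [Fintype ι] (i : ι) (a : ι → ℂ) :
    AnalyticAt ℂ (fun q : ι → ℂ => q i) a :=
  (ContinuousLinearMap.proj (R := ℂ) (φ := fun _ : ι => ℂ) i).analyticAt _

@[fun_prop]
theorem analyticAt_fderiv_apply [CompleteSpace F] {f : E → F} (hf : AnalyticAt ℂ f a) {v : E → E}
    (hv : AnalyticAt ℂ v a) : AnalyticAt ℂ (fun q => fderiv ℂ f q (v q)) a :=
  ((ContinuousLinearMap.id ℂ (E →L[ℂ] F)).analyticAt_bilinear _).fun_comp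
    (f := fun q => (fderiv ℂ f q, v q)) (hf.fderiv.prod hv)

end Projections

/-! ### Superposition operators on spaces of continuous maps -/

section Superposition

variable {K E F : Type*} [TopologicalSpace K] [CompactSpace K]
  [NormedAddCommGroup E] [NormedSpace ℂ E] [NormedAddCommGroup F] [NormedSpace ℂ F]

/-- The superposition operator of a continuous multilinear map on spaces of continuous functions. -/
noncomputable def superpositionMultilinear (K : Type*) [TopologicalSpace K] [CompactSpace K]
    {E F : Type*} [NormedAddCommGroup E] [NormedSpace ℂ E] [NormedAddCommGroup F] [NormedSpace ℂ F]
    {n : ℕ} (p : E [×n]→L[ℂ] F) : C(K, E) [×n]→L[ℂ] C(K, F) :=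
  MultilinearMap.mkContinuous
    { toFun := fun γ => ⟨fun s => p fun i => γ i s, by fun_prop⟩
      map_update_add' := by
        intro _ γ i a b
        ext s
        have h (c : C(K, E)) : (fun j => Function.update γ i c j s)
            = Function.update (fun j => γ j s) i (c s) := by
          ext j; by_cases hj : j = i
          · subst hj; simp
          · simp [hj]
        simp [h]
      map_update_smul' := by
        intro _ γ i r a
        ext s
        have h (c : C(K, E)) : (fun j => Function.update γ i c j s)
            = Function.update (fun j => γ j s) i (c s) := by
          ext j; by_cases hj : j = i
          · subst hj; simp
          · simp [hj]
        simp [h] } ‖p‖ (by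
      intro γ
      refine (ContinuousMap.norm_le _ (by positivity)).2 fun s => ?_
      refine (p.le_opNorm _).trans ?_
      gcongr
      exact (γ _).norm_coe_le_norm s)

theorem norm_superpositionMultilinear_le {n : ℕ} (p : E [×n]→L[ℂ] F) :
    ‖superpositionMultilinear K p‖ ≤ ‖p‖ :=
  MultilinearMap.mkContinuous_norm_le _ (norm_nonneg _) _

/-- The superposition operator `γ ↦ f ∘ γ` of an analytic germ is analytic at constant functions. -/
theorem analyticAt_superposition [CompleteSpace F] {f : E → F} {a : E} (hf : AnalyticAt ℂ f a) :
    ∃ N : C(K, E) → C(K, F), AnalyticAt ℂ N (ContinuousMap.const K a) ∧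
      ∀ᶠ γ in 𝓝 (ContinuousMap.const K a), ∀ s, N γ s = f (γ s) := by
  obtain ⟨p, r, hp⟩ := hf
  -- The Taylor series of `f` is applied pointwise. The operator norms do not increase, so neither
  -- does the radius of convergence shrink.
  let q : FormalMultilinearSeries ℂ C(K, E) C(K, F) := fun n => superpositionMultilinear K (p n)
  have hq : p.radius ≤ q.radius := by
    refine ENNReal.le_of_forall_nnreal_lt fun ρ hρ => ?_
    obtain ⟨B, -, hB⟩ := p.norm_mul_pow_le_of_lt_radius hρ
    refine q.le_radius_of_bound B fun n => (le_trans ?_ (hB n))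
    gcongr
    exact norm_superpositionMultilinear_le _
  have hr : 0 < q.radius := hp.r_pos.trans_le (hp.r_le.trans hq)
  have hq' := q.hasFPowerSeriesOnBall hr
  refine ⟨fun γ => q.sum (γ - ContinuousMap.const K a), ?_, ?_⟩
  · have h0 : AnalyticAt ℂ q.sum (ContinuousMap.const K a - ContinuousMap.const K a) := by
      rw [sub_self]; exact hq'.analyticAt
    exact AnalyticAt.fun_comp (f := fun γ => γ - ContinuousMap.const K a) h0
      (analyticAt_id.sub analyticAt_const)
  · have hpos : 0 < r := hp.r_pos
    filter_upwards [Metric.eball_mem_nhds (ContinuousMap.const K a) hpos] with γ hγ s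
    set η := γ - ContinuousMap.const K a with hη
    have hηn : (‖η‖₊ : ENNReal) < r := by
      rw [Metric.mem_eball, edist_eq_enorm_sub] at hγ; exact hγ
    have hsum : HasSum (fun n => q n fun _ => η) (q.sum η) := by
      refine q.hasSum ?_
      rw [mem_eball_zero_iff]
      exact hηn.trans_le (hp.r_le.trans hq)
    have h1 := (ContinuousMap.evalCLM ℂ s).hasSum hsum
    have h2 : HasSum (fun n => p n fun _ => η s) (f (a + η s)) := by
      refine hp.hasSum ?_
      rw [mem_eball_zero_iff]
      refine lt_of_le_of_lt ?_ hηn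
      rw [enorm_eq_nnnorm]
      exact_mod_cast η.norm_coe_le_norm s
    have h3 := h1.unique h2
    simpa [hη] using h3

end Superposition

/-! ### Integration of paths as a continuous linear operator -/

section Primitive

variable {F : Type*} [NormedAddCommGroup F] [NormedSpace ℂ F] [CompleteSpace F]

/-- The primitive `s ↦ ∫_0^s γ` of a path. -/
noncomputable def primitive (F : Type*) [NormedAddCommGroup F] [NormedSpace ℂ F] [CompleteSpace F] :
    C(I, F) →L[ℂ] C(I, F) :=
  LinearMap.mkContinuous
    { toFun := fun γ => ⟨fun s => ∫ ξ in (0 : ℝ)..s, Set.IccExtend zero_le_one γ ξ, by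
        have h : Continuous (Set.IccExtend (zero_le_one (α := ℝ)) γ) := γ.continuous.Icc_extend'
        exact (intervalIntegral.continuous_primitive
          (fun a b => h.intervalIntegrable a b) 0).comp continuous_subtype_val⟩
      map_add' := by
        intro γ η
        ext s
        have h (γ : C(I, F)) : Continuous (Set.IccExtend (zero_le_one (α := ℝ)) γ) :=
          γ.continuous.Icc_extend'
        have := intervalIntegral.integral_add (μ := MeasureTheory.volume)
          ((h γ).intervalIntegrable 0 s) ((h η).intervalIntegrable 0 s)
        simpa [Set.IccExtend] using this
      map_smul' := by
        intro r γ
        ext s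
        simp [Set.IccExtend] } 1 (by
      intro γ
      rw [one_mul]
      refine (ContinuousMap.norm_le _ (by positivity)).2 fun s => ?_
      have := intervalIntegral.norm_integral_le_of_norm_le_const (a := 0) (b := (s : ℝ)) (C := ‖γ‖)
        (f := Set.IccExtend (zero_le_one (α := ℝ)) γ) (fun x _ => γ.norm_coe_le_norm _)
      refine this.trans ?_
      have hs : |(s : ℝ) - 0| ≤ 1 := by
        rw [sub_zero, abs_of_nonneg s.2.1]; exact s.2.2
      exact mul_le_of_le_one_right (norm_nonneg _) hs)

theorem primitive_apply (γ : C(I, F)) (s : I) :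
    primitive F γ s = ∫ ξ in (0 : ℝ)..s, Set.IccExtend zero_le_one γ ξ := rfl

end Primitive

/-- `c` is a coordinate in the direction `e`: it is analytic and `c (q + s e) = c q + s`. -/
structure IsCoord {E : Type*} [NormedAddCommGroup E] [NormedSpace ℂ E] (c : E → ℂ) (e : E) :
    Prop where
  analytic : ∀ q, AnalyticAt ℂ c q
  add_smul : ∀ q (s : ℂ), c (q + s • e) = c q + s

/-! ### Division by a coordinate and comparison of leading terms -/

section Division

variable {E F : Type*} [NormedAddCommGroup E] [NormedSpace ℂ E]
  [NormedAddCommGroup F] [NormedSpace ℂ F]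
  {c : E → ℂ} {e a : E}

/-- The projection onto `{c = 0}` in the direction `e`. -/
def slice (c : E → ℂ) (e : E) (q : E) : E := q - c q • e

theorem IsCoord.slice_eq_self (_hc : IsCoord c e) (ha : c a = 0) : slice c e a = a := by
  simp [slice, ha]

theorem IsCoord.coord_slice (hc : IsCoord c e) (q : E) : c (slice c e q) = 0 := by
  have := hc.add_smul q (-c q)
  simpa [slice, sub_eq_add_neg] using this

theorem IsCoord.slice_add_smul (hc : IsCoord c e) (q : E) (s : ℂ) :
    slice c e (q + s • e) = slice c e q := by
  simp only [slice, hc.add_smul]; module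

theorem IsCoord.slice_slice (hc : IsCoord c e) (q : E) :
    slice c e (slice c e q) = slice c e q := hc.slice_eq_self (hc.coord_slice q)

theorem IsCoord.analyticAt_slice (hc : IsCoord c e) (q : E) : AnalyticAt ℂ (slice c e) q :=
  analyticAt_id.sub ((hc.analytic q).smul analyticAt_const)

theorem IsCoord.tendsto_slice (hc : IsCoord c e) (ha : c a = 0) :
    Tendsto (slice c e) (𝓝 a) (𝓝 a) := by
  have := (hc.analyticAt_slice a).continuousAt.tendsto
  rwa [hc.slice_eq_self ha] at this

/-- Hadamard's lemma: an analytic germ that vanishes on `{c = 0}` is divisible by `c`. -/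
theorem IsCoord.exists_eq_smul [CompleteSpace F] (hc : IsCoord c e) (ha : c a = 0)
    {f : E → F} (hf : AnalyticAt ℂ f a) (h0 : ∀ᶠ q in 𝓝 a, f (slice c e q) = 0) :
    ∃ g : E → F, AnalyticAt ℂ g a ∧ f =ᶠ[𝓝 a] fun q => c q • g q := by
  -- The quotient is the integral over `[0, 1]` of the derivative of `f` along `e`, taken on the
  -- segment `path q` from `slice c e q` to `q`. Analyticity in `q` is obtained by factoring the
  -- integral through `C(I, E)`: an analytic path, an analytic superposition operator, then a
  -- continuous linear map.
  obtain ⟨N, hN, hN'⟩ := analyticAt_superposition (K := I)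
    ((ContinuousLinearMap.apply ℂ F e).analyticAt _ |>.fun_comp hf.fderiv)
  let ι : C(I, E) := ⟨fun s => ((s : ℝ) : ℂ) • e, by fun_prop⟩
  let path : E → C(I, E) := fun q => ContinuousMap.const I (slice c e q) + c q • ι
  have hpath_apply (q : E) (s : I) : path q s = slice c e q + (c q * (s : ℝ)) • e := by
    simp [path, ι, mul_smul]
  have hconst : AnalyticAt ℂ (fun x : E => ContinuousMap.const I x) a := by
    let L : E →L[ℂ] C(I, E) := LinearMap.mkContinuous
      { toFun := fun x => ContinuousMap.const I x
        map_add' := fun _ _ => rfl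
        map_smul' := fun _ _ => rfl } 1 (fun x => by
          rw [one_mul]
          exact (ContinuousMap.norm_le _ (norm_nonneg _)).2 fun s => le_rfl)
    exact L.analyticAt a
  have hpa : path a = ContinuousMap.const I a := by
    ext s; rw [hpath_apply]; simp [slice, ha]
  have hpath : AnalyticAt ℂ path a := by
    refine AnalyticAt.add ?_ ((hc.analytic a).smul analyticAt_const)
    have h := hc.analyticAt_slice a
    rw [← hc.slice_eq_self ha] at hconst
    exact hconst.fun_comp h
  refine ⟨fun q => primitive F (N (path q)) 1, ?_, ?_⟩
  · have h1 : AnalyticAt ℂ (fun q => N (path q)) a := by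
      rw [← hpa] at hN; exact hN.fun_comp hpath
    exact (((ContinuousMap.evalCLM ℂ (1 : I)).comp (primitive F)).analyticAt _).fun_comp h1
  · have hfe : ∀ᶠ q in 𝓝 a, AnalyticAt ℂ f q := hf.eventually_analyticAt
    have h2 : ∀ᶠ γ in 𝓝 (ContinuousMap.const I a), ∀ s : I, AnalyticAt ℂ f (γ s) := by
      obtain ⟨r, hr, hr'⟩ := Metric.eventually_nhds_iff.1 hfe
      filter_upwards [Metric.ball_mem_nhds _ hr] with γ hγ s
      exact hr' ((ContinuousMap.dist_lt_iff hr).1 hγ s)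
    have hcont : Tendsto path (𝓝 a) (𝓝 (ContinuousMap.const I a)) := by
      rw [← hpa]; exact hpath.continuousAt
    filter_upwards [hcont.eventually hN', hcont.eventually h2, h0] with q h3 h4 h5
    rw [primitive_apply, ← intervalIntegral.integral_smul]
    have key : ∀ ξ ∈ Set.uIcc (0 : ℝ) 1, HasDerivAt
        (fun ξ : ℝ => f (slice c e q + (c q * (ξ : ℂ)) • e))
        (c q • Set.IccExtend (zero_le_one (α := ℝ)) (N (path q)) ξ) ξ := by
      intro ξ hξ
      rw [Set.uIcc_of_le zero_le_one] at hξ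
      rw [Set.IccExtend_of_mem _ _ hξ, h3 ⟨ξ, hξ⟩]
      have hd : HasDerivAt (fun ξ : ℝ => slice c e q + (c q * (ξ : ℂ)) • e) (c q • e) ξ := by
        have : HasDerivAt (fun ξ : ℝ => (c q * (ξ : ℂ)) • e) ((c q * 1) • e) ξ :=
          (((hasDerivAt_id ξ).ofReal_comp).const_mul (c q)).smul_const e
        simpa using this.const_add (slice c e q)
      have hfd := (h4 ⟨ξ, hξ⟩).differentiableAt.hasFDerivAt
      rw [hpath_apply] at hfd ⊢
      have := (hfd.restrictScalars ℝ).comp_hasDerivAt ξ hd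
      simpa [Function.comp_def] using this
    have hint : IntervalIntegrable (fun ξ => c q • Set.IccExtend (zero_le_one (α := ℝ))
        (N (path q)) ξ) MeasureTheory.volume 0 1 :=
      ((N (path q)).continuous.Icc_extend'.const_smul (c q)).intervalIntegrable 0 1
    have := intervalIntegral.integral_eq_sub_of_hasDerivAt key hint
    rw [show ((1 : I) : ℝ) = 1 from rfl, this]
    simp [h5]
    simp [slice]

/-- Moving from a zero of `c` by `s • e` with `s ≠ 0` leaves the zero set, so the set `c ≠ 0` is
dense. -/
theorem IsCoord.neBot_nhdsWithin (hc : IsCoord c e) (q : E) : (𝓝[{p | c p ≠ 0}] q).NeBot := by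
  by_cases hq : c q ≠ 0
  · exact mem_closure_iff_nhdsWithin_neBot.1 (subset_closure hq)
  push Not at hq
  have h : Tendsto (fun s : ℂ => q + s • e) (𝓝[≠] 0) (𝓝[{p | c p ≠ 0}] q) := by
    refine tendsto_nhdsWithin_iff.2 ⟨?_, ?_⟩
    · have : Continuous fun s : ℂ => q + s • e := by fun_prop
      simpa using (this.tendsto 0).mono_left nhdsWithin_le_nhds
    · filter_upwards [self_mem_nhdsWithin] with s hs
      simpa [hc.add_smul, hq] using hs
  exact h.neBot

/-- Relations obtained by cancelling a power of `c` are known only where `c ≠ 0`; density and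
continuity carry them across the zero set. -/
theorem IsCoord.eventually_le (hc : IsCoord c e) {u v : E → ℝ}
    (hu : ∀ᶠ q in 𝓝 a, ContinuousAt u q) (hv : ∀ᶠ q in 𝓝 a, ContinuousAt v q)
    (h : ∀ᶠ q in 𝓝 a, c q ≠ 0 → u q ≤ v q) : ∀ᶠ q in 𝓝 a, u q ≤ v q := by
  filter_upwards [hu, hv, eventually_eventually_nhds.2 h] with q h1 h2 h3
  have := hc.neBot_nhdsWithin q
  have hle : 𝓝[{p | c p ≠ 0}] q ≤ 𝓝 q := nhdsWithin_le_nhds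
  refine le_of_tendsto_of_tendsto (h1.tendsto.mono_left hle) (h2.tendsto.mono_left hle) ?_
  filter_upwards [h3.filter_mono nhdsWithin_le_nhds, self_mem_nhdsWithin] with p hp hp'
  exact hp hp'

theorem eventually_continuousAt_of_analyticAt [CompleteSpace F] {f : E → F}
    (hf : AnalyticAt ℂ f a) : ∀ᶠ q in 𝓝 a, ContinuousAt f q :=
  hf.eventually_analyticAt.mono fun _ h => h.continuousAt

/-- A germ that vanishes where `c ≠ 0` vanishes. -/
theorem IsCoord.eventually_eq_zero [CompleteSpace F] (hc : IsCoord c e) {f : E → F}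
    (hf : AnalyticAt ℂ f a) (h : ∀ᶠ q in 𝓝 a, c q ≠ 0 → f q = 0) : ∀ᶠ q in 𝓝 a, f q = 0 := by
  have := hc.eventually_le (a := a) (u := fun q => ‖f q‖) (v := fun _ => 0)
    ((eventually_continuousAt_of_analyticAt hf).mono fun _ h => h.norm)
    (Eventually.of_forall fun _ => continuousAt_const)
    (h.mono fun q hq hcq => by simp [hq hcq])
  exact this.mono fun q hq => norm_le_zero_iff.1 hq

theorem IsCoord.eventually_eq [CompleteSpace F] (hc : IsCoord c e) {f g : E → F}
    (hf : AnalyticAt ℂ f a) (hg : AnalyticAt ℂ g a)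
    (h : ∀ᶠ q in 𝓝 a, c q ≠ 0 → f q = g q) : ∀ᶠ q in 𝓝 a, f q = g q := by
  have := hc.eventually_eq_zero (hf.sub hg) (h.mono fun q hq hcq => by simp [hq hcq])
  exact this.mono fun q hq => sub_eq_zero.1 hq

/-- A germ that vanishes along every line through the base point vanishes. -/
theorem eventually_eq_zero_of_lines [CompleteSpace F] {f : E → F} (hf : AnalyticAt ℂ f a)
    (h : ∀ᶠ q in 𝓝 a, ∀ᶠ s in 𝓝 (0 : ℂ), f (a + s • (q - a)) = 0) : ∀ᶠ q in 𝓝 a, f q = 0 := by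
  obtain ⟨r, hr, hr'⟩ := Metric.eventually_nhds_iff_ball.1 hf.eventually_analyticAt
  filter_upwards [h, Metric.ball_mem_nhds a (half_pos hr)] with q hq hqr
  have hline : AnalyticOnNhd ℂ (fun s : ℂ => f (a + s • (q - a))) (Metric.ball 0 2) := by
    intro s hs
    have hmem : a + s • (q - a) ∈ Metric.ball a r := by
      rw [mem_ball_iff_norm, add_sub_cancel_left, norm_smul]
      rw [mem_ball_iff_norm] at hqr
      rw [mem_ball_zero_iff] at hs
      nlinarith [norm_nonneg s, norm_nonneg (q - a)]
    exact (hr' _ hmem).fun_comp (f := fun s : ℂ => a + s • (q - a)) (by fun_prop)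
  have := hline.eqOn_zero_of_preconnected_of_eventuallyEq_zero
    (convex_ball (0 : ℂ) 2).isPreconnected (Metric.mem_ball_self two_pos) hq
  have h1 := this (x := 1) (by simp)
  simpa using h1

/-- A germ that is divisible by every power of `c` vanishes. -/
theorem IsCoord.eventually_eq_zero_of_forall_pow [CompleteSpace F] (hc : IsCoord c e)
    (ha : c a = 0) {f : E → F} (hf : AnalyticAt ℂ f a)
    (h : ∀ n : ℕ, ∃ g : E → F, AnalyticAt ℂ g a ∧ f =ᶠ[𝓝 a] fun q => c q ^ n • g q) :
    ∀ᶠ q in 𝓝 a, f q = 0 := by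
  -- On a line through `a` the restriction of `c` vanishes at the base point, so divisibility of `f`
  -- by `c ^ n` makes the order of vanishing at least `n`. For all `n` at once this means infinite
  -- order.
  refine eventually_eq_zero_of_lines hf (Eventually.of_forall fun q => ?_)
  have hl : AnalyticAt ℂ (fun s : ℂ => a + s • (q - a)) 0 := by fun_prop
  have hl0 : (fun s : ℂ => a + s • (q - a)) 0 = a := by simp
  have hlt : Tendsto (fun s : ℂ => a + s • (q - a)) (𝓝 0) (𝓝 a) := by
    have := hl.continuousAt.tendsto; simpa using this
  rw [← analyticOrderAt_eq_top, ENat.eq_top_iff_forall_ge]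
  intro n
  obtain ⟨g, hg, hfg⟩ := h n
  have hga : AnalyticAt ℂ (fun s : ℂ => g (a + s • (q - a))) 0 := by
    exact hg.fun_comp_of_eq hl hl0
  have hca : AnalyticAt ℂ (fun s : ℂ => c (a + s • (q - a))) 0 := by
    exact (hc.analytic _).fun_comp hl
  have h1 : (fun s : ℂ => f (a + s • (q - a))) =ᶠ[𝓝 0]
      ((fun s : ℂ => c (a + s • (q - a))) ^ n) • fun s : ℂ => g (a + s • (q - a)) :=
    hlt.eventually hfg
  rw [analyticOrderAt_congr h1, analyticOrderAt_smul (hca.pow n) hga, analyticOrderAt_pow hca]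
  have h2 : 1 ≤ analyticOrderAt (fun s : ℂ => c (a + s • (q - a))) 0 := by
    rw [Order.one_le_iff_ne_zero, hca.analyticOrderAt_ne_zero]; simpa using ha
  calc (n : ℕ∞) = n • 1 := by simp
    _ ≤ n • analyticOrderAt (fun s : ℂ => c (a + s • (q - a))) 0 := by gcongr
    _ ≤ _ := le_self_add

/-- The induction principle behind all comparisons of leading terms. -/
theorem IsCoord.eventually_eq_zero_of_step [CompleteSpace F] (hc : IsCoord c e)
    (ha : c a = 0) {f : E → F} (hf : AnalyticAt ℂ f a)
    (h : ∀ (n : ℕ) (g : E → F), AnalyticAt ℂ g a → (f =ᶠ[𝓝 a] fun q => c q ^ n • g q) →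
      ∀ᶠ q in 𝓝 a, g (slice c e q) = 0) :
    ∀ᶠ q in 𝓝 a, f q = 0 := by
  refine hc.eventually_eq_zero_of_forall_pow ha hf fun n => ?_
  induction n with
  | zero => exact ⟨f, hf, by simp⟩
  | succ n ih =>
    obtain ⟨g, hg, hfg⟩ := ih
    obtain ⟨g', hg', hgg'⟩ := hc.exists_eq_smul ha hg (h n g hg hfg)
    refine ⟨g', hg', ?_⟩
    filter_upwards [hfg, hgg'] with q h1 h2
    rw [h1, h2, smul_smul, pow_succ]

theorem IsCoord.fderiv_apply (hc : IsCoord c e) (q : E) : fderiv ℂ c q e = 1 := by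
  have h1 := (hc.analytic q).differentiableAt.hasFDerivAt
  have h2 : HasDerivAt (fun s : ℂ => q + s • e) e 0 := by
    simpa using ((hasDerivAt_id (0 : ℂ)).smul_const e).const_add q
  have h1' : HasFDerivAt c (fderiv ℂ c q) (q + (0 : ℂ) • e) := by simpa using h1
  have h3 := h1'.comp_hasDerivAt (0 : ℂ) h2
  have h4 : HasDerivAt (c ∘ fun s : ℂ => q + s • e) 1 0 := by
    have : (c ∘ fun s : ℂ => q + s • e) = fun s => c q + s := by
      funext s; simp [hc.add_smul]
    rw [this]; exact (hasDerivAt_id (0 : ℂ)).const_add _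
  exact h3.unique h4

/-- Leibniz rule for `c ^ n • g`. -/
theorem fderiv_pow_smul_apply {q : E} {c : E → ℂ} (hc : DifferentiableAt ℂ c q) {g : E → F}
    (hg : DifferentiableAt ℂ g q) (n : ℕ) (v : E) :
    fderiv ℂ (fun q => c q ^ n • g q) q v
      = c q ^ n • fderiv ℂ g q v + ((n : ℂ) * c q ^ (n - 1) * fderiv ℂ c q v) • g q := by
  have h : HasFDerivAt (fun q => c q ^ n • g q) _ q :=
    (hc.hasFDerivAt.pow n).smul hg.hasFDerivAt
  rw [h.fderiv]
  simp [mul_assoc]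

/-- Uniqueness for Fuchsian differential inequalities. -/
theorem IsCoord.eventually_eq_zero_of_fuchs [CompleteSpace F] (hc : IsCoord c e)
    (ha : c a = 0) {f : E → F} (hf : AnalyticAt ℂ f a)
    (h0 : ∀ᶠ q in 𝓝 a, f (slice c e q) = 0)
    (h : ∀ᶠ q in 𝓝 a, ‖c q • fderiv ℂ f q e‖ ≤ 1 / 2 * ‖f q‖) :
    ∀ᶠ q in 𝓝 a, f q = 0 := by
  -- If `f = c ^ n • g` with `n ≥ 1`, the inequality restricts on `c = 0` to `n ‖g‖ ≤ ‖g‖ / 2`, so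
  -- `g` vanishes there. The case `n = 0` is the hypothesis `h0`.
  refine hc.eventually_eq_zero_of_step ha hf fun n g hg hfg => ?_
  rcases Nat.eq_zero_or_pos n with rfl | hn
  · filter_upwards [h0, (hc.tendsto_slice ha).eventually hfg] with q h1 h2
    simpa [h2] using h1
  have hdg : AnalyticAt ℂ (fun q => c q • fderiv ℂ g q e + (n : ℂ) • g q) a := by
    have := (hc.analytic a)
    have h2 : AnalyticAt ℂ (fun q => fderiv ℂ g q e) a :=
      ((ContinuousLinearMap.apply ℂ F e).analyticAt _).fun_comp hg.fderiv
    fun_prop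
  have h3 : ∀ᶠ q in 𝓝 a, ‖c q • fderiv ℂ g q e + (n : ℂ) • g q‖ ≤ 1 / 2 * ‖g q‖ := by
    refine hc.eventually_le
      ((eventually_continuousAt_of_analyticAt hdg).mono fun _ h => h.norm)
      ((eventually_continuousAt_of_analyticAt hg).mono fun _ h => h.norm.const_mul _) ?_
    filter_upwards [eventually_eventually_nhds.2 hfg, h, hg.eventually_analyticAt] with q h1 h2 h4 hcq
    have h1' : f =ᶠ[𝓝 q] fun q => c q ^ n • g q := h1
    rw [h1'.fderiv_eq, h1'.eq_of_nhds, fderiv_pow_smul_apply (hc.analytic q).differentiableAt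
      h4.differentiableAt, hc.fderiv_apply] at h2
    have h5 : c q • (c q ^ n • fderiv ℂ g q e + ((n : ℂ) * c q ^ (n - 1) * 1) • g q)
        = c q ^ n • (c q • fderiv ℂ g q e + (n : ℂ) • g q) := by
      obtain ⟨m, rfl⟩ : ∃ m, n = m + 1 := ⟨n - 1, by omega⟩
      simp only [Nat.add_sub_cancel]
      module
    rw [h5, norm_smul, norm_smul] at h2
    have h6 : 0 < ‖c q ^ n‖ := norm_pos_iff.2 (pow_ne_zero _ hcq)
    nlinarith
  filter_upwards [(hc.tendsto_slice ha).eventually h3] with q hq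
  rw [hc.coord_slice, zero_smul, zero_add, norm_smul] at hq
  have h1 : (1 : ℝ) ≤ ‖(n : ℂ)‖ := by
    rw [Complex.norm_natCast]; exact_mod_cast hn
  have h2 : ‖g (slice c e q)‖ ≤ 0 := by nlinarith [norm_nonneg (g (slice c e q))]
  exact norm_le_zero_iff.1 h2

/-- Invariance in the direction `e` of germs with vanishing derivative. -/
theorem IsCoord.eventually_eq_slice [CompleteSpace F] (hc : IsCoord c e)
    (ha : c a = 0) {f : E → F} (hf : AnalyticAt ℂ f a)
    (h : ∀ᶠ q in 𝓝 a, fderiv ℂ f q e = 0) : ∀ᶠ q in 𝓝 a, f q = f (slice c e q) := by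
  have hs : AnalyticAt ℂ (fun q => f (slice c e q)) a := by
    rw [← hc.slice_eq_self ha] at hf
    exact hf.fun_comp (hc.analyticAt_slice a)
  have := hc.eventually_eq_zero_of_fuchs ha (hf.sub hs) (by simp [hc.slice_slice]) (by
    filter_upwards [h, hf.eventually_analyticAt, hs.eventually_analyticAt] with q h1 h2 h3
    rw [fderiv_sub h2.differentiableAt h3.differentiableAt, sub_apply, h1]
    have h4 : HasDerivAt (fun s : ℂ => q + s • e) e 0 := by
      simpa using ((hasDerivAt_id (0 : ℂ)).smul_const e).const_add q
    have h3' := h3.differentiableAt.hasFDerivAt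
    have h5 := HasFDerivAt.comp_hasDerivAt (0 : ℂ) (f := fun s : ℂ => q + s • e)
      (l := fun q => f (slice c e q)) (by simpa using h3') h4
    have h6 : HasDerivAt ((fun q => f (slice c e q)) ∘ fun s : ℂ => q + s • e) 0 0 := by
      have : ((fun q => f (slice c e q)) ∘ fun s : ℂ => q + s • e)
          = fun _ => f (slice c e q) := by
        funext s; simp [hc.slice_add_smul]
      rw [this]; exact hasDerivAt_const _ _
    rw [h5.unique h6]
    simp)
  exact this.mono fun q hq => sub_eq_zero.1 hq

end Division

/-- Identity theorem along a connected set of times. -/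
theorem eventually_eq_zero_of_isPreconnected {T E F : Type*} [NormedAddCommGroup T]
    [NormedSpace ℂ T] [NormedAddCommGroup E] [NormedSpace ℂ E] [NormedAddCommGroup F]
    [NormedSpace ℂ F] [CompleteSpace F] {f : T × E → F} {a : E} {S : Set T}
    (hS : IsPreconnected S) (hf : ∀ t ∈ S, AnalyticAt ℂ f (t, a)) {t₀ : T} (ht₀ : t₀ ∈ S)
    (h0 : ∀ᶠ p in 𝓝 (t₀, a), f p = 0) : ∀ t ∈ S, ∀ᶠ p in 𝓝 (t, a), f p = 0 := by
  -- The set of times at which the germ vanishes is open, and by the identity theorem on a ball it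
  -- is closed relative to `S`.
  let u : Set T := {t | ∀ᶠ p in 𝓝 (t, a), f p = 0}
  have hu : IsOpen u := by
    have hcont : Continuous fun t : T => (t, a) := by fun_prop
    exact (isOpen_setOfPred_eventually_nhds (p := fun p => f p = 0)).preimage hcont
  refine hS.subset_of_closure_inter_subset hu ⟨t₀, ht₀, h0⟩ ?_
  rintro t ⟨htu, htS⟩
  obtain ⟨r, hr, hr'⟩ := Metric.eventually_nhds_iff_ball.1 (hf t htS).eventually_analyticAt
  obtain ⟨t', ht', htt'⟩ := Metric.mem_closure_iff.1 htu r hr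
  have hmem : (t', a) ∈ Metric.ball (t, a) r := by
    rw [Metric.mem_ball, Prod.dist_eq]
    simpa [dist_comm t' t, hr] using htt'
  have := AnalyticOnNhd.eqOn_zero_of_preconnected_of_eventuallyEq_zero (f := f) (fun x hx => hr' x hx)
    (convex_ball (t, a) r).isPreconnected hmem ht'
  filter_upwards [Metric.ball_mem_nhds (t, a) hr] with p hp
  exact this hp

open scoped unitInterval

/-! ### Germs of analytic flows -/

section Flow

variable {E : Type*} [NormedAddCommGroup E] [NormedSpace ℂ E]
  {F : Type*} [NormedAddCommGroup F] [NormedSpace ℂ F]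

theorem isCoord_fst : IsCoord (fun p : ℂ × E => p.1) (1, 0) where
  analytic _ := analyticAt_fst
  add_smul q s := by simp

theorem slice_fst (p : ℂ × E) : slice (fun p : ℂ × E => p.1) (1, 0) p = (0, p.2) := by
  ext <;> simp [slice]

theorem hasDerivAt_fst_of_analyticAt {f : ℂ × E → F} {p : ℂ × E} (hf : DifferentiableAt ℂ f p) :
    HasDerivAt (fun s => f (s, p.2)) (fderiv ℂ f p (1, 0)) p.1 := by
  have h1 : HasDerivAt (fun s : ℂ => (s, p.2)) (1, 0) p.1 :=
    (hasDerivAt_id _).prodMk (hasDerivAt_const _ _)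
  exact HasFDerivAt.comp_hasDerivAt (f := fun s : ℂ => (s, p.2)) p.1 hf.hasFDerivAt h1

/-- Uniqueness of germs of solutions of an autonomous analytic differential equation. -/
theorem eventually_eq_of_ode [CompleteSpace F] {V : F → F} (hV : AnalyticAt ℂ V 0)
    {A B : ℂ × E → F} (hA : AnalyticAt ℂ A 0) (hB : AnalyticAt ℂ B 0) (hA0 : A 0 = 0)
    (hB0 : B 0 = 0) (h0 : ∀ᶠ q : E in 𝓝 0, A (0, q) = B (0, q))
    (hA' : ∀ᶠ p in 𝓝 (0 : ℂ × E), fderiv ℂ A p (1, 0) = V (A p))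
    (hB' : ∀ᶠ p in 𝓝 (0 : ℂ × E), fderiv ℂ B p (1, 0) = V (B p)) :
    ∀ᶠ p in 𝓝 (0 : ℂ × E), A p = B p := by
  obtain ⟨K, s, hs, hK⟩ := hV.hasStrictFDerivAt.exists_lipschitzOnWith
  have hAt : Tendsto A (𝓝 0) (𝓝 0) := by simpa [hA0] using hA.continuousAt.tendsto
  have hBt : Tendsto B (𝓝 0) (𝓝 0) := by simpa [hB0] using hB.continuousAt.tendsto
  have hsmall : ∀ᶠ p in 𝓝 (0 : ℂ × E), ‖p.1‖ * K < 1 / 2 := by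
    have : ContinuousAt (fun p : ℂ × E => ‖p.1‖ * K) 0 := by fun_prop
    exact this.eventually_lt continuousAt_const (by simp)
  -- With `K` a Lipschitz constant of `V`, the difference satisfies `‖t ∂ₜ(A - B)‖ ≤ ‖t‖ K ‖A - B‖`.
  -- This is a Fuchsian inequality as soon as `‖t‖ K < 1/2`.
  have := isCoord_fst.eventually_eq_zero_of_fuchs (a := (0 : ℂ × E)) rfl (hA.sub hB) (by
      have ht : Tendsto (fun p : ℂ × E => p.2) (𝓝 0) (𝓝 0) := continuous_snd.tendsto 0
      filter_upwards [ht.eventually h0] with p hp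
      simp [slice_fst, hp]) (by
      filter_upwards [hA', hB', hA.eventually_analyticAt, hB.eventually_analyticAt,
        hAt.eventually hs, hBt.eventually hs, hsmall] with p h1 h2 h3 h4 h5 h6 h7
      rw [fderiv_sub h3.differentiableAt h4.differentiableAt, sub_apply, h1, h2, norm_smul]
      have h8 := hK.norm_sub_le h5 h6
      calc ‖p.1‖ * ‖V (A p) - V (B p)‖ ≤ ‖p.1‖ * (K * ‖A p - B p‖) := by gcongr
        _ = ‖p.1‖ * K * ‖A p - B p‖ := by ring
        _ ≤ 1 / 2 * ‖A p - B p‖ := by gcongr)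
  exact this.mono fun p hp => sub_eq_zero.1 hp

/-- The germ at the origin of the flow of an analytic vector field. -/
theorem exists_flow_germ [CompleteSpace E] {V : E → E} (hV : AnalyticAt ℂ V 0) :
    ∃ φ : ℂ × E → E, AnalyticAt ℂ φ 0 ∧ (∀ᶠ q in 𝓝 0, φ (0, q) = q) ∧
      ∀ᶠ p in 𝓝 (0 : ℂ × E), fderiv ℂ φ p (1, 0) = V (φ p) := by
  obtain ⟨N, hN, hN'⟩ := analyticAt_superposition (K := I) hV
  let L : E →L[ℂ] C(I, E) := LinearMap.mkContinuous
    { toFun := fun x => ContinuousMap.const I x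
      map_add' := fun _ _ => rfl
      map_smul' := fun _ _ => rfl } 1 (fun x => by
        rw [one_mul]
        exact (ContinuousMap.norm_le _ (norm_nonneg _)).2 fun s => le_rfl)
  have hc0 : ContinuousMap.const I (0 : E) = 0 := rfl
  rw [hc0] at hN hN'
  -- Zeros of `H` are the solutions `γ` of `γ(s) = x + t ∫₀ˢ V(γ)`, that is, the trajectories with
  -- time rescaled to `[0, 1]`. Since `H (0, γ) = γ`, the partial derivative in `γ` at the origin is
  -- the identity and the implicit function theorem applies.
  let H : (ℂ × E) × C(I, E) → C(I, E) := fun v => v.2 - L v.1.2 - v.1.1 • primitive E (N v.2)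
  have hH : AnalyticAt ℂ H 0 := by
    have h1 : AnalyticAt ℂ (fun v : (ℂ × E) × C(I, E) => N v.2) 0 :=
      hN.fun_comp_of_eq analyticAt_snd rfl
    have h2 : AnalyticAt ℂ (fun v : (ℂ × E) × C(I, E) => primitive E (N v.2)) 0 :=
      ((primitive E).analyticAt _).fun_comp h1
    have h3 : AnalyticAt ℂ (fun v : (ℂ × E) × C(I, E) => L v.1.2) 0 :=
      (L.analyticAt _).fun_comp (f := fun v : (ℂ × E) × C(I, E) => v.1.2)
        (analyticAt_snd.fun_comp analyticAt_fst)
    have h4 : AnalyticAt ℂ (fun v : (ℂ × E) × C(I, E) => v.1.1) 0 :=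
      analyticAt_fst.fun_comp analyticAt_fst
    exact (analyticAt_snd.sub h3).sub (h4.smul h2)
  have hH0 : H 0 = 0 := by simp [H]
  have hinv : (fderiv ℂ H 0 ∘L .inr ℂ (ℂ × E) C(I, E)).IsInvertible := by
    have h1 : HasFDerivAt (H ∘ ContinuousLinearMap.inr ℂ (ℂ × E) C(I, E))
        (fderiv ℂ H 0 ∘L .inr ℂ (ℂ × E) C(I, E)) 0 := by
      refine HasFDerivAt.comp 0 ?_ (ContinuousLinearMap.hasFDerivAt _)
      exact hH.differentiableAt.hasFDerivAt
    have h2 : H ∘ ContinuousLinearMap.inr ℂ (ℂ × E) C(I, E) = id := by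
      funext γ; simp [H]
    rw [h2] at h1
    rw [h1.unique (hasFDerivAt_id _)]
    exact ⟨ContinuousLinearEquiv.refl ℂ _, rfl⟩
  have hHc := hH.contDiffAt (n := ⊤)
  have hne : (⊤ : WithTop ℕ∞) ≠ 0 := by simp
  set ψ := hHc.implicitFunction hne hinv with hψ
  have hψ0 : ψ 0 = 0 := hHc.implicitFunction_apply_self hne hinv
  have hψa : AnalyticAt ℂ ψ 0 := (hHc.contDiffAt_implicitFunction hne hinv).analyticAt
  have hψH : ∀ᶠ p in 𝓝 0, H (p, ψ p) = 0 := by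
    have := hHc.eventually_apply_implicitFunction hne hinv
    rw [hH0] at this; exact this
  have hψu : ∀ᶠ v in 𝓝 0, H v = 0 ↔ ψ v.1 = v.2 := by
    have := hHc.eventually_apply_eq_iff_implicitFunction hne hinv
    rw [hH0] at this; exact this
  have hψt : Tendsto ψ (𝓝 0) (𝓝 0) := by simpa [hψ0] using hψa.continuousAt.tendsto
  have hφa : AnalyticAt ℂ (fun p => ψ p 1) 0 :=
    ((ContinuousMap.evalCLM ℂ (1 : I)).analyticAt _).fun_comp hψa
  refine ⟨fun p => ψ p 1, hφa, ?_, ?_⟩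
  · have ht : Tendsto (fun q : E => ((0 : ℂ), q)) (𝓝 0) (𝓝 0) := by
      have : Continuous fun q : E => ((0 : ℂ), q) := by fun_prop
      exact this.tendsto 0
    filter_upwards [ht.eventually hψH] with q hq
    have h1 : ψ (0, q) - L q - (0 : ℂ) • primitive E (N (ψ (0, q))) = 0 := hq
    rw [zero_smul, sub_zero, sub_eq_zero] at h1
    rw [h1]; rfl
  -- the integral equation and its invariance under rescaling of time
  let resc (s : I) (γ : C(I, E)) : C(I, E) := γ.comp ⟨fun z => s * z, by fun_prop⟩
  have hresc (s : I) (γ : C(I, E)) : ‖resc s γ‖ ≤ ‖γ‖ :=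
    (ContinuousMap.norm_le _ (norm_nonneg _)).2 fun z => γ.norm_coe_le_norm _
  have heq : ∀ᶠ p in 𝓝 (0 : ℂ × E), (∀ z, N (ψ p) z = V (ψ p z)) ∧ ∀ s : I,
      ψ p s = p.2 + p.1 • ∫ z in (0 : ℝ)..s, Set.IccExtend zero_le_one (N (ψ p)) z := by
    filter_upwards [hψH, hψt.eventually hN'] with p h1 h2
    refine ⟨h2, fun s => ?_⟩
    have h3 := congrArg (fun γ : C(I, E) => γ s) h1
    have h4 : ψ p s - p.2 - p.1 • primitive E (N (ψ p)) s = 0 := h3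
    rw [primitive_apply] at h4
    rw [sub_sub, sub_eq_zero] at h4
    exact h4
  -- Reparametrizing the path for time `t` by the factor `s` gives a small solution of the equation
  -- for time `s t`. Local uniqueness in the implicit function theorem identifies it with `ψ (s t,
  -- x)`.
  have hscale : ∀ᶠ p in 𝓝 (0 : ℂ × E), ∀ s : I, ψ ((s : ℂ) * p.1, p.2) 1 = ψ p s := by
    obtain ⟨r, hr, hr1⟩ := Metric.eventually_nhds_iff_ball.1 (hψu.and
      ((continuous_snd.tendsto (0 : (ℂ × E) × C(I, E))).eventually hN'))
    have hnear : ∀ᶠ p in 𝓝 (0 : ℂ × E), ‖p‖ < r ∧ ‖ψ p‖ < r := by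
      have h1 : ContinuousAt (fun p : ℂ × E => ‖p‖) 0 := by fun_prop
      have h2 : ContinuousAt (fun p : ℂ × E => ‖ψ p‖) 0 := hψa.continuousAt.norm
      exact (h1.eventually_lt continuousAt_const (by simpa)).and
        (h2.eventually_lt continuousAt_const (by simpa [hψ0]))
    filter_upwards [hnear, heq] with p hp ⟨hp1, hp2⟩ s
    have hs : ‖((s : ℝ) : ℂ)‖ ≤ 1 := by
      rw [Complex.norm_real, Real.norm_of_nonneg s.2.1]; exact s.2.2
    have hmem : ((((s : ℝ) : ℂ) * p.1, p.2), resc s (ψ p)) ∈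
        Metric.ball (0 : (ℂ × E) × C(I, E)) r := by
      rw [mem_ball_zero_iff]
      have h1 : ‖p.1‖ < r := (norm_fst_le p).trans_lt hp.1
      have h2 : ‖p.2‖ < r := (norm_snd_le p).trans_lt hp.1
      have h3 : ‖resc s (ψ p)‖ < r := (hresc s _).trans_lt hp.2
      have h4 : ‖((s : ℝ) : ℂ) * p.1‖ < r := by
        rw [norm_mul]
        exact (mul_le_of_le_one_left (norm_nonneg _) hs).trans_lt h1
      simp only [Prod.norm_def, sup_lt_iff]
      exact ⟨⟨h4, h2⟩, h3⟩
    obtain ⟨h5, h6⟩ := hr1 _ hmem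
    have h7 : ψ (((s : ℝ) : ℂ) * p.1, p.2) = resc s (ψ p) := by
      refine h5.1 ?_
      ext z
      change resc s (ψ p) z - p.2
        - (((s : ℝ) : ℂ) * p.1) • primitive E (N (resc s (ψ p))) z = 0
      have h8 : resc s (ψ p) z = ψ p (s * z) := rfl
      have h9 : (∫ w in (0 : ℝ)..z, Set.IccExtend zero_le_one (N (resc s (ψ p))) w)
          = ∫ w in (0 : ℝ)..z, Set.IccExtend zero_le_one (N (ψ p)) (s * w) := by
        refine intervalIntegral.integral_congr fun w hw => ?_
        rw [Set.uIcc_of_le z.2.1] at hw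
        have hw' : w ∈ Set.Icc (0 : ℝ) 1 := ⟨hw.1, hw.2.trans z.2.2⟩
        have hsw : (s : ℝ) * w ∈ Set.Icc (0 : ℝ) 1 :=
          ⟨mul_nonneg s.2.1 hw'.1, mul_le_one₀ s.2.2 hw'.1 hw'.2⟩
        rw [Set.IccExtend_of_mem _ _ hw', Set.IccExtend_of_mem _ _ hsw, hp1]
        exact h6 ⟨w, hw'⟩
      have h10 := intervalIntegral.smul_integral_comp_mul_left (a := 0) (b := (z : ℝ))
        (Set.IccExtend (zero_le_one (α := ℝ)) (N (ψ p))) (s : ℝ)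
      rw [primitive_apply, h9, h8, hp2, mul_comm (((s : ℝ) : ℂ)), mul_smul, Complex.coe_smul, h10]
      simp
    rw [h7]
    simp [resc]
  have hder : AnalyticAt ℂ (fun p => fderiv ℂ (fun p => ψ p 1) p ((1, 0) : ℂ × E)) 0 :=
    ((ContinuousLinearMap.apply ℂ E ((1, 0) : ℂ × E)).analyticAt _).fun_comp hφa.fderiv
  have hVφ : AnalyticAt ℂ (fun p => V (ψ p 1)) 0 :=
    hV.fun_comp_of_eq hφa (by rw [hψ0]; rfl)
  -- It suffices to compare where `t ≠ 0`. There the derivative at `s = 1` of `s ↦ ψ (s t, x) 1` is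
  -- `t ∂ₜφ` by the chain rule and `t V(φ)` by the integral equation, and `t` cancels.
  refine isCoord_fst.eventually_eq hder hVφ ?_
  filter_upwards [hscale, heq, hφa.eventually_analyticAt] with p h1 ⟨h2, h3⟩ h4 hp
  have hd1 : HasDerivAt (fun s : ℝ => ψ ((s : ℂ) * p.1, p.2) 1)
      (p.1 • fderiv ℂ (fun p => ψ p 1) p ((1, 0) : ℂ × E)) 1 := by
    have h5 := hasDerivAt_fst_of_analyticAt h4.differentiableAt
    have h6 : HasDerivAt (fun s : ℝ => (s : ℂ) * p.1) p.1 1 := by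
      simpa using ((hasDerivAt_id (1 : ℝ)).ofReal_comp).mul_const p.1
    exact HasDerivAt.scomp_of_eq (1 : ℝ) h5 h6 (by simp)
  have hcont : Continuous (Set.IccExtend (zero_le_one (α := ℝ)) (N (ψ p))) :=
    (N (ψ p)).continuous.Icc_extend'
  have hd2 : HasDerivAt (fun s : ℝ => p.2 + p.1 • ∫ z in (0 : ℝ)..s,
      Set.IccExtend zero_le_one (N (ψ p)) z) (p.1 • V (ψ p 1)) 1 := by
    have h5 := hcont.integral_hasStrictDerivAt 0 1
    have h6 : Set.IccExtend (zero_le_one (α := ℝ)) (N (ψ p)) 1 = V (ψ p 1) := by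
      rw [Set.IccExtend_of_mem _ _ (by simp)]; exact h2 1
    rw [h6] at h5
    exact (h5.hasDerivAt.const_smul p.1).const_add p.2
  -- The rescaling identity holds only for `s ∈ [0, 1]`, so the two derivatives at the endpoint `1`
  -- are compared within that interval.
  have hd3 : HasDerivWithinAt (fun s : ℝ => ψ ((s : ℂ) * p.1, p.2) 1) (p.1 • V (ψ p 1))
      (Set.Icc 0 1) 1 := by
    refine hd2.hasDerivWithinAt.congr (fun s hs => ?_) ?_
    · rw [← h3 ⟨s, hs⟩, ← h1 ⟨s, hs⟩]
    · have := h3 1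
      rw [← h1 1] at this
      exact this
  have huniq : UniqueDiffWithinAt ℝ (Set.Icc (0 : ℝ) 1) 1 :=
    uniqueDiffOn_Icc zero_lt_one 1 (by simp)
  have := huniq.eq_deriv _ hd1.hasDerivWithinAt hd3
  exact smul_right_injective E hp this

/-- `Φ` is the flow of `V` for times in `S`, as a germ along `S × {0}`. -/
structure IsFlowOn (V : E → E) (Φ : ℂ × E → E) (S : Set ℂ) : Prop where
  analytic : ∀ t ∈ S, AnalyticAt ℂ Φ (t, 0)
  init : ∀ᶠ q in 𝓝 0, Φ (0, q) = q
  ode : ∀ t ∈ S, ∀ᶠ p in 𝓝 (t, 0), fderiv ℂ Φ p (1, 0) = V (Φ p)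

namespace IsFlowOn

variable {V : E → E} {Φ Φ' : ℂ × E → E} {S : Set ℂ}

theorem init_zero (h : IsFlowOn V Φ S) : Φ 0 = 0 := h.init.self_of_nhds

theorem mono (h : IsFlowOn V Φ S) {S' : Set ℂ} (hS : S' ⊆ S) : IsFlowOn V Φ S' :=
  ⟨fun t ht => h.analytic t (hS ht), h.init, fun t ht => h.ode t (hS ht)⟩

variable [CompleteSpace E]

/-- The constant `0` solves the same equation. Local uniqueness near time `0` is propagated along
`S` by the identity theorem. -/
theorem apply_zero (h : IsFlowOn V Φ S) (hV : AnalyticAt ℂ V 0) (hV0 : V 0 = 0)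
    (hS : IsPreconnected S) (h0 : (0 : ℂ) ∈ S) : ∀ t ∈ S, Φ (t, 0) = 0 := by
  have hA : ∀ t ∈ S, AnalyticAt ℂ (fun p : ℂ × ℂ => Φ (p.1, 0)) (t, 0) := fun t ht =>
    (h.analytic t ht).fun_comp_of_eq (f := fun p : ℂ × ℂ => (p.1, (0 : E))) (by fun_prop) rfl
  have h1 := eventually_eq_of_ode (E := ℂ) hV (A := fun p => Φ (p.1, 0)) (B := fun _ => 0)
    (hA 0 h0) analyticAt_const h.init_zero rfl
    (Eventually.of_forall fun _ => h.init_zero) (by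
      have ht : Tendsto (fun p : ℂ × ℂ => (p.1, (0 : E))) (𝓝 0) (𝓝 (0, 0)) := by
        have : Continuous fun p : ℂ × ℂ => (p.1, (0 : E)) := by fun_prop
        exact this.tendsto 0
      filter_upwards [ht.eventually (h.ode 0 h0),
        ht.eventually (h.analytic 0 h0).eventually_analyticAt] with p hp hp'
      have hd : HasFDerivAt (fun p : ℂ × ℂ => (p.1, (0 : E)))
          ((ContinuousLinearMap.fst ℂ ℂ ℂ).prod 0) p := hasFDerivAt_fst.prodMk (hasFDerivAt_const _ _)
      have := HasFDerivAt.comp p (g := Φ) (f := fun p : ℂ × ℂ => (p.1, (0 : E)))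
        hp'.differentiableAt.hasFDerivAt hd
      have h3 : fderiv ℂ (fun p : ℂ × ℂ => Φ (p.1, 0)) p (1, 0) = fderiv ℂ Φ (p.1, 0) (1, 0) := by
        rw [show (fun p : ℂ × ℂ => Φ (p.1, 0)) = Φ ∘ fun p => (p.1, 0) from rfl, this.fderiv]
        simp
      rw [h3, hp]) (by simp [hV0])
  have h2 := eventually_eq_zero_of_isPreconnected hS hA h0 h1
  exact fun t ht => (h2 t ht).self_of_nhds

theorem eventually_eq (h : IsFlowOn V Φ S) (h' : IsFlowOn V Φ' S) (hV : AnalyticAt ℂ V 0)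
    (hS : IsPreconnected S) (h0 : (0 : ℂ) ∈ S) : ∀ t ∈ S, Φ =ᶠ[𝓝 (t, 0)] Φ' := by
  have h1 := eventually_eq_of_ode hV (h.analytic 0 h0) (h'.analytic 0 h0) h.init_zero h'.init_zero
    (by filter_upwards [h.init, h'.init] with q h1 h2; rw [h1, h2]) (h.ode 0 h0) (h'.ode 0 h0)
  have h2 := eventually_eq_zero_of_isPreconnected hS
    (fun t ht => (h.analytic t ht).sub (h'.analytic t ht)) h0
    (h1.mono fun p hp => sub_eq_zero.2 hp)
  exact fun t ht => (h2 t ht).mono fun p hp => sub_eq_zero.1 hp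

/-- Both sides, as functions of the outer time, solve the equation of `V` with the same initial
value. The inner time and the point serve as parameters. -/
theorem comp_germ (h : IsFlowOn V Φ S) (hV : AnalyticAt ℂ V 0) (h0 : (0 : ℂ) ∈ S) :
    ∀ᶠ p in 𝓝 (0 : (ℂ × ℂ) × E), Φ (p.1.1, Φ (p.1.2, p.2)) = Φ (p.1.1 + p.1.2, p.2) := by
  have ha := h.analytic 0 h0
  have hz := h.init_zero
  have hta : Tendsto (fun r : ℂ × (ℂ × E) => (r.1, Φ r.2)) (𝓝 0) (𝓝 0) := by
    have : ContinuousAt (fun r : ℂ × (ℂ × E) => (r.1, Φ r.2)) 0 := by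
      have : ContinuousAt (fun r : ℂ × (ℂ × E) => Φ r.2) 0 :=
        ContinuousAt.comp_of_eq ha.continuousAt continuousAt_snd rfl
      exact continuousAt_fst.prodMk this
    simpa [ContinuousAt, hz, Prod.mk_zero_zero] using this
  have htb : Tendsto (fun r : ℂ × (ℂ × E) => (r.1 + r.2.1, r.2.2)) (𝓝 0) (𝓝 0) := by
    have : Continuous fun r : ℂ × (ℂ × E) => (r.1 + r.2.1, r.2.2) := by fun_prop
    simpa [Prod.mk_zero_zero] using this.tendsto 0
  have hΦ2 : AnalyticAt ℂ (fun r : ℂ × (ℂ × E) => Φ r.2) 0 :=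
    ha.fun_comp_of_eq analyticAt_snd rfl
  have h1 := eventually_eq_of_ode (E := ℂ × E) hV
    (A := fun r => Φ (r.1, Φ r.2)) (B := fun r => Φ (r.1 + r.2.1, r.2.2))
    (ha.fun_comp_of_eq (f := fun r : ℂ × (ℂ × E) => (r.1, Φ r.2)) (analyticAt_fst.prod hΦ2)
      (by simp [hz]))
    (ha.fun_comp_of_eq (f := fun r : ℂ × (ℂ × E) => (r.1 + r.2.1, r.2.2)) (by fun_prop) (by simp))
    (by
      change Φ (0, Φ 0) = 0
      rw [hz]; exact hz) (by simpa [Prod.mk_zero_zero] using hz)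
    (by
      have ht : Tendsto Φ (𝓝 0) (𝓝 0) := by
        have := ha.continuousAt.tendsto
        rwa [show ((0 : ℂ), (0 : E)) = 0 from rfl, hz] at this
      filter_upwards [ht.eventually h.init] with r hr
      simp [hr])
    (by
      filter_upwards [hta.eventually (h.ode 0 h0), hta.eventually ha.eventually_analyticAt,
        hΦ2.eventually_analyticAt] with r h1 h2 h3
      have hd : HasFDerivAt (fun r : ℂ × (ℂ × E) => (r.1, Φ r.2)) _ r :=
        hasFDerivAt_fst.prodMk h3.differentiableAt.hasFDerivAt
      have h4 := HasFDerivAt.comp r (g := Φ) h2.differentiableAt.hasFDerivAt hd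
      have h5 : fderiv ℂ (fun r : ℂ × (ℂ × E) => Φ r.2) r (1, 0) = 0 := by
        have h6 := h3.differentiableAt.hasFDerivAt
        have h7 := hasDerivAt_fst_of_analyticAt h3.differentiableAt
        exact h7.unique (hasDerivAt_const r.1 (Φ r.2))
      have h8 : fderiv ℂ (fun r : ℂ × (ℂ × E) => Φ (r.1, Φ r.2)) r (1, 0)
          = fderiv ℂ Φ (r.1, Φ r.2) (1, 0) := by
        rw [show (fun r : ℂ × (ℂ × E) => Φ (r.1, Φ r.2)) = Φ ∘ fun r => (r.1, Φ r.2) from rfl,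
          h4.fderiv]
        simp [h5]
      rw [h8, h1])
    (by
      filter_upwards [htb.eventually (h.ode 0 h0), htb.eventually ha.eventually_analyticAt]
        with r h1 h2
      have hd : HasFDerivAt (fun r : ℂ × (ℂ × E) => (r.1 + r.2.1, r.2.2))
          ((ContinuousLinearMap.fst ℂ ℂ (ℂ × E) + (ContinuousLinearMap.fst ℂ ℂ E).comp
            (ContinuousLinearMap.snd ℂ ℂ (ℂ × E))).prod ((ContinuousLinearMap.snd ℂ ℂ E).comp
            (ContinuousLinearMap.snd ℂ ℂ (ℂ × E)))) r :=
        (hasFDerivAt_fst.add (hasFDerivAt_fst.comp r hasFDerivAt_snd)).prodMk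
          (hasFDerivAt_snd.comp r hasFDerivAt_snd)
      have h4 := HasFDerivAt.comp r (g := Φ) h2.differentiableAt.hasFDerivAt hd
      have h8 : fderiv ℂ (fun r : ℂ × (ℂ × E) => Φ (r.1 + r.2.1, r.2.2)) r (1, 0)
          = fderiv ℂ Φ (r.1 + r.2.1, r.2.2) (1, 0) := by
        rw [show (fun r : ℂ × (ℂ × E) => Φ (r.1 + r.2.1, r.2.2))
          = Φ ∘ fun r => (r.1 + r.2.1, r.2.2) from rfl, h4.fderiv]
        simp
      rw [h8, h1])
  have ht : Tendsto (fun p : (ℂ × ℂ) × E => (p.1.1, (p.1.2, p.2))) (𝓝 0) (𝓝 0) := by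
    have : Continuous fun p : (ℂ × ℂ) × E => (p.1.1, (p.1.2, p.2)) := by fun_prop
    exact this.tendsto 0
  exact ht.eventually h1

end IsFlowOn

end Flow

/-! ### Flows for all complex times -/

section GlobalFlow

variable {E : Type*} [NormedAddCommGroup E] [NormedSpace ℂ E] [CompleteSpace E]
  {V : E → E} {Φ Φ' : ℂ × E → E}

theorem isPreconnected_ball (r : ℝ) : IsPreconnected (Metric.ball (0 : ℂ) r) :=
  (convex_ball (0 : ℂ) r).isPreconnected

/-- The `n`-fold iterate of the flow at time `t / n`. -/
noncomputable def iterateFlow (Φ : ℂ × E → E) (n : ℕ) (p : ℂ × E) : E :=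
  (fun q => Φ (p.1 / n, q))^[n] p.2

/-- Near time `0` the local group law makes the `n`-fold iterate at time `t / n` equal to `Φ`
itself, so the iterate solves the equation there. Analyticity extends the equation to the ball of
radius `n r`; the iterates are defined along it because `V` vanishes at the origin, which the flow
therefore fixes. -/
theorem IsFlowOn.iterate {r : ℝ} (hr : 0 < r) (h : IsFlowOn V Φ (Metric.ball 0 r))
    (hV : AnalyticAt ℂ V 0) (hV0 : V 0 = 0) {n : ℕ} (hn : n ≠ 0) :
    IsFlowOn V (iterateFlow Φ n) (Metric.ball 0 (n * r)) := by
  have h0 : (0 : ℂ) ∈ Metric.ball (0 : ℂ) r := Metric.mem_ball_self hr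
  have hnpos : (0 : ℝ) < n := by exact_mod_cast Nat.pos_of_ne_zero hn
  have hzero := h.apply_zero hV hV0 (isPreconnected_ball r) h0
  have hdiv (t : ℂ) (ht : t ∈ Metric.ball (0 : ℂ) (n * r)) : t / n ∈ Metric.ball (0 : ℂ) r := by
    rw [mem_ball_zero_iff] at ht ⊢
    rw [norm_div, Complex.norm_natCast, div_lt_iff₀ hnpos, mul_comm]; exact ht
  have hiter (j : ℕ) (t : ℂ) (ht : t ∈ Metric.ball (0 : ℂ) (n * r)) :
      AnalyticAt ℂ (fun p : ℂ × E => (fun q => Φ (p.1 / n, q))^[j] p.2) (t, 0) ∧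
        (fun q => Φ (t / n, q))^[j] 0 = 0 := by
    induction j with
    | zero => exact ⟨by simpa using analyticAt_snd, rfl⟩
    | succ j ih =>
      have h2 : (fun q => Φ (t / n, q))^[j + 1] 0 = 0 := by
        rw [Function.iterate_succ_apply', ih.2, hzero _ (hdiv t ht)]
      refine ⟨?_, h2⟩
      simp only [Function.iterate_succ_apply']
      refine (h.analytic _ (hdiv t ht)).fun_comp_of_eq
        (f := fun p : ℂ × E => (p.1 / n, (fun q => Φ (p.1 / n, q))^[j] p.2)) ?_ (by simp [ih.2])
      exact AnalyticAt.prod (by fun_prop) ih.1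
  have hloc (j : ℕ) : ∀ᶠ p in 𝓝 (0 : ℂ × E),
      (fun q => Φ (p.1 / n, q))^[j] p.2 = Φ (j * (p.1 / n), p.2) := by
    induction j with
    | zero =>
      filter_upwards [(continuous_snd.tendsto (0 : ℂ × E)).eventually h.init] with p hp
      simpa using hp.symm
    | succ j ih =>
      have ht : Tendsto (fun p : ℂ × E => ((p.1 / n, j * (p.1 / n)), p.2)) (𝓝 0) (𝓝 0) := by
        have : Continuous fun p : ℂ × E => ((p.1 / n, j * (p.1 / n)), p.2) := by fun_prop
        simpa [Prod.mk_zero_zero] using this.tendsto 0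
      filter_upwards [ih, ht.eventually (h.comp_germ hV h0)] with p h1 h2
      rw [Function.iterate_succ_apply', h1, h2]
      congr 2
      push_cast; ring
  have hloc' : iterateFlow Φ n =ᶠ[𝓝 (0 : ℂ × E)] Φ := by
    filter_upwards [hloc n] with p hp
    rw [iterateFlow, hp, mul_div_cancel₀ _ (by exact_mod_cast hn)]
  have h0' : (0 : ℂ) ∈ Metric.ball (0 : ℂ) (n * r) := Metric.mem_ball_self (by positivity)
  refine ⟨fun t ht => (hiter n t ht).1, ?_, ?_⟩
  · have ht : Tendsto (fun q : E => ((0 : ℂ), q)) (𝓝 0) (𝓝 0) := by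
      have : Continuous fun q : E => ((0 : ℂ), q) := by fun_prop
      exact this.tendsto 0
    filter_upwards [ht.eventually hloc', h.init] with q h1 h2
    rw [h1, h2]
  · have ha (t : ℂ) (ht : t ∈ Metric.ball (0 : ℂ) (n * r)) : AnalyticAt ℂ
        (fun p => fderiv ℂ (iterateFlow Φ n) p (1, 0) - V (iterateFlow Φ n p)) (t, 0) := by
      have h1 : AnalyticAt ℂ (iterateFlow Φ n) (t, 0) := (hiter n t ht).1
      have h2 : AnalyticAt ℂ (fun p => V (iterateFlow Φ n p)) (t, 0) :=
        hV.fun_comp_of_eq h1 (hiter n t ht).2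
      exact (analyticAt_fderiv_apply h1 analyticAt_const).sub h2
    have hz : ∀ᶠ p in 𝓝 ((0 : ℂ), (0 : E)),
        fderiv ℂ (iterateFlow Φ n) p (1, 0) - V (iterateFlow Φ n p) = 0 := by
      filter_upwards [eventually_eventually_nhds.2 hloc', h.ode 0 h0] with p h1 h2
      have h1' : iterateFlow Φ n =ᶠ[𝓝 p] Φ := h1
      rw [h1'.fderiv_eq, h1'.eq_of_nhds, h2, sub_self]
    intro t ht
    exact (eventually_eq_zero_of_isPreconnected (isPreconnected_ball _) ha h0' hz t ht).mono
      fun p hp => sub_eq_zero.1 hp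

/-- An analytic vector field that vanishes at the origin has an analytic flow along `ℂ × {0}`. -/
theorem exists_isFlowOn_univ (hV : AnalyticAt ℂ V 0) (hV0 : V 0 = 0) :
    ∃ Φ : ℂ × E → E, IsFlowOn V Φ Set.univ := by
  obtain ⟨φ, hφ, hφ0, hφ'⟩ := exists_flow_germ hV
  have hcont : Tendsto (fun t : ℂ => (t, (0 : E))) (𝓝 0) (𝓝 0) := by
    have : Continuous fun t : ℂ => (t, (0 : E)) := by fun_prop
    exact this.tendsto 0
  obtain ⟨r, hr, hr'⟩ := Metric.eventually_nhds_iff_ball.1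
    ((hcont.eventually hφ.eventually_analyticAt).and
      (hcont.eventually (eventually_eventually_nhds.2 hφ')))
  have h : IsFlowOn V φ (Metric.ball 0 r) := ⟨fun t ht => (hr' t ht).1, hφ0, fun t ht => (hr' t ht).2⟩
  have hn (n : ℕ) (hn : n ≠ 0) := h.iterate hr hV hV0 hn
  -- The summand `1` makes `‖t‖ < N t * r` strict. Below, `M = N t₀ + 1` bounds `N t` for all `t`
  -- within `r` of `t₀`, so near `t₀` the varying iterate coincides with the single iterate of index
  -- `M`.
  let N : ℂ → ℕ := fun t => ⌈‖t‖ / r⌉₊ + 1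
  have key (t₀ : ℂ) : ∃ M : ℕ, M ≠ 0 ∧ ‖t₀‖ < M * r ∧
      (fun p : ℂ × E => iterateFlow φ (N p.1) p) =ᶠ[𝓝 (t₀, 0)] iterateFlow φ M := by
    let M := N t₀ + 1
    have hM : ‖t₀‖ < M * r := by
      have h1 : ‖t₀‖ / r ≤ ⌈‖t₀‖ / r⌉₊ := Nat.le_ceil _
      rw [div_le_iff₀ hr] at h1
      have h2 : (M : ℝ) = ⌈‖t₀‖ / r⌉₊ + 2 := by simp only [M, N]; push_cast; ring
      rw [h2]; nlinarith
    refine ⟨M, by simp [M], hM, ?_⟩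
    have h1 : ∀ᶠ p in 𝓝 (t₀, (0 : E)), ∀ m ∈ Finset.range (M + 1), m ≠ 0 → ‖t₀‖ < m * r →
        iterateFlow φ m p = iterateFlow φ M p := by
      rw [eventually_all_finset]
      intro m hm
      by_cases hm0 : m = 0
      · simp [hm0]
      by_cases hmr : ‖t₀‖ < m * r
      · have hmM : (m : ℝ) ≤ M := by
          exact_mod_cast Nat.lt_succ_iff.1 (Finset.mem_range.1 hm)
        have hsub : Metric.ball (0 : ℂ) (m * r) ⊆ Metric.ball 0 (M * r) :=
          Metric.ball_subset_ball (by gcongr)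
        have := (hn m hm0).eventually_eq ((hn M (by simp [M])).mono hsub) hV
          (isPreconnected_ball _)
          (Metric.mem_ball_self (mul_pos (by exact_mod_cast Nat.pos_of_ne_zero hm0) hr))
          t₀ (by simpa using hmr)
        exact this.mono fun p hp _ _ => hp
      · simp [hmr]
    have h2 : ∀ᶠ p in 𝓝 (t₀, (0 : E)), dist p.1 t₀ < r := by
      have : Continuous fun p : ℂ × E => dist p.1 t₀ := by fun_prop
      exact this.continuousAt.eventually_lt continuousAt_const (by simpa using hr)
    filter_upwards [h1, h2] with p h3 h4
    rw [dist_eq_norm] at h4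
    refine h3 (N p.1) ?_ (by simp [N]) ?_
    · rw [Finset.mem_range, Nat.lt_succ_iff]
      have h5 : ‖p.1‖ / r ≤ (⌈‖t₀‖ / r⌉₊ + 1 : ℕ) := by
        rw [div_le_iff₀ hr]
        have h6 : ‖t₀‖ / r ≤ ⌈‖t₀‖ / r⌉₊ := Nat.le_ceil _
        rw [div_le_iff₀ hr] at h6
        have h7 : ‖p.1‖ ≤ ‖p.1 - t₀‖ + ‖t₀‖ := by simpa using norm_add_le (p.1 - t₀) t₀
        push_cast
        linarith
      have h8 := Nat.ceil_le.2 h5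
      simp only [M, N]
      omega
    · have h6 : ‖p.1‖ / r ≤ ⌈‖p.1‖ / r⌉₊ := Nat.le_ceil _
      rw [div_le_iff₀ hr] at h6
      have h7 : ‖t₀‖ ≤ ‖p.1 - t₀‖ + ‖p.1‖ := by
        have := norm_sub_le p.1 (p.1 - t₀); rw [sub_sub_cancel] at this; linarith
      simp only [N]
      push_cast
      linarith
  refine ⟨fun p => iterateFlow φ (N p.1) p, ?_, ?_, ?_⟩
  · intro t _
    obtain ⟨M, hM0, hM, hE⟩ := key t
    exact ((hn M hM0).analytic t (by simpa using hM)).congr hE.symm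
  · obtain ⟨M, hM0, -, hE⟩ := key 0
    have ht : Tendsto (fun q : E => ((0 : ℂ), q)) (𝓝 0) (𝓝 (0, 0)) := by
      have : Continuous fun q : E => ((0 : ℂ), q) := by fun_prop
      exact this.tendsto 0
    filter_upwards [ht.eventually hE, (hn M hM0).init] with q h1 h2
    rw [h1, h2]
  · intro t _
    obtain ⟨M, hM0, hM, hE⟩ := key t
    filter_upwards [eventually_eventually_nhds.2 hE, (hn M hM0).ode t (by simpa using hM)]
      with p h1 h2
    have h1' : (fun p : ℂ × E => iterateFlow φ (N p.1) p) =ᶠ[𝓝 p] iterateFlow φ M := h1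
    rw [h1'.fderiv_eq, h2, h1'.eq_of_nhds]

namespace IsFlowOn

theorem time_zero (h : IsFlowOn V Φ Set.univ) (hV : AnalyticAt ℂ V 0) (hV0 : V 0 = 0)
    (t : ℂ) : Φ (t, 0) = 0 :=
  h.apply_zero hV hV0 isPreconnected_univ (Set.mem_univ _) t (Set.mem_univ _)

/-- The group law near the pair of times `(0, 0)` extends by the identity theorem over the connected
space of pairs of times. -/
theorem comp (h : IsFlowOn V Φ Set.univ) (hV : AnalyticAt ℂ V 0) (hV0 : V 0 = 0)
    (s t : ℂ) :
    ∀ᶠ p in 𝓝 ((s, t), (0 : E)), Φ (p.1.1, Φ (p.1.2, p.2)) = Φ (p.1.1 + p.1.2, p.2) := by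
  have hz := h.time_zero hV hV0
  have h1 := h.comp_germ hV (Set.mem_univ _)
  have hA (r : ℂ × ℂ) : AnalyticAt ℂ
      (fun p : (ℂ × ℂ) × E => Φ (p.1.1, Φ (p.1.2, p.2)) - Φ (p.1.1 + p.1.2, p.2)) (r, 0) := by
    have h2 : AnalyticAt ℂ (fun p : (ℂ × ℂ) × E => Φ (p.1.2, p.2)) (r, 0) :=
      (h.analytic r.2 (Set.mem_univ _)).fun_comp_of_eq
        (f := fun p : (ℂ × ℂ) × E => (p.1.2, p.2)) (by fun_prop) rfl
    have h3 : AnalyticAt ℂ (fun p : (ℂ × ℂ) × E => Φ (p.1.1, Φ (p.1.2, p.2))) (r, 0) :=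
      (h.analytic r.1 (Set.mem_univ _)).fun_comp_of_eq
        (f := fun p : (ℂ × ℂ) × E => (p.1.1, Φ (p.1.2, p.2))) (AnalyticAt.prod (by fun_prop) h2)
        (by simp [hz])
    have h4 : AnalyticAt ℂ (fun p : (ℂ × ℂ) × E => Φ (p.1.1 + p.1.2, p.2)) (r, 0) :=
      (h.analytic (r.1 + r.2) (Set.mem_univ _)).fun_comp_of_eq
        (f := fun p : (ℂ × ℂ) × E => (p.1.1 + p.1.2, p.2)) (by fun_prop) rfl
    exact h3.sub h4
  have := eventually_eq_zero_of_isPreconnected (S := Set.univ) (t₀ := (0 : ℂ × ℂ))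
    isPreconnected_univ (fun r _ => hA r) (Set.mem_univ _)
    (h1.mono fun p hp => sub_eq_zero.2 hp) (s, t) (Set.mem_univ _)
  exact this.mono fun p hp => sub_eq_zero.1 hp

/-- The flow preserves its vector field. -/
theorem fderiv_apply_field (h : IsFlowOn V Φ Set.univ) (hV : AnalyticAt ℂ V 0) (hV0 : V 0 = 0)
    (t : ℂ) :
    ∀ᶠ p in 𝓝 (t, (0 : E)), fderiv ℂ Φ p (0, V p.2) = V (Φ p) := by
  have hz := h.time_zero hV hV0
  have h1 := h.comp hV hV0 t 0
  have ht : Tendsto (fun p : ℂ × E => ((p.1, (0 : ℂ)), p.2)) (𝓝 (t, 0)) (𝓝 ((t, 0), 0)) := by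
    have : Continuous fun p : ℂ × E => ((p.1, (0 : ℂ)), p.2) := by fun_prop
    exact this.tendsto (t, 0)
  have ht' : Tendsto (fun p : ℂ × E => ((0 : ℂ), p.2)) (𝓝 (t, 0)) (𝓝 (0, 0)) := by
    have : Continuous fun p : ℂ × E => ((0 : ℂ), p.2) := by fun_prop
    exact this.tendsto (t, 0)
  have hs : Tendsto (fun p : ℂ × E => p.2) (𝓝 (t, 0)) (𝓝 0) := continuous_snd.tendsto (t, 0)
  have hu (z : ℂ) := Set.mem_univ z
  filter_upwards [ht.eventually (eventually_eventually_nhds.2 h1), ht'.eventually (h.ode 0 (hu _)),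
    ht'.eventually (h.analytic 0 (hu _)).eventually_analyticAt, hs.eventually h.init,
    (h.analytic t (hu _)).eventually_analyticAt, h.ode t (hu _)] with p h2 h3 h4 h5 h6 h7
  -- The identity `Φ(t, Φ(s, q)) = Φ(t + s, q)` is differentiated at `s = 0` on both sides.
  have hd1 : HasDerivAt (fun s : ℂ => (p.1, Φ (s, p.2))) ((0 : ℂ), V p.2) 0 := by
    have := hasDerivAt_fst_of_analyticAt h4.differentiableAt
    rw [h3, h5] at this
    exact (hasDerivAt_const _ _).prodMk this
  have hd2 : HasDerivAt (fun s : ℂ => Φ (p.1, Φ (s, p.2))) (fderiv ℂ Φ p (0, V p.2)) 0 := by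
    refine HasFDerivAt.comp_hasDerivAt (l := Φ) (f := fun s : ℂ => (p.1, Φ (s, p.2))) 0 ?_ hd1
    rw [h5]
    exact h6.differentiableAt.hasFDerivAt
  have hd3 : HasDerivAt (fun s : ℂ => Φ (p.1 + s, p.2)) (V (Φ p)) 0 := by
    have := hasDerivAt_fst_of_analyticAt h6.differentiableAt
    rw [h7] at this
    exact HasDerivAt.comp_const_add p.1 0 (by simpa using this)
  have hline : Tendsto (fun s : ℂ => ((p.1, s), p.2)) (𝓝 0) (𝓝 ((p.1, 0), p.2)) := by
    have : Continuous fun s : ℂ => ((p.1, s), p.2) := by fun_prop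
    exact this.tendsto 0
  have heq : (fun s : ℂ => Φ (p.1, Φ (s, p.2))) =ᶠ[𝓝 0] fun s => Φ (p.1 + s, p.2) :=
    hline.eventually h2
  exact hd2.unique (hd3.congr_of_eventuallyEq heq)

end IsFlowOn

end GlobalFlow

/-! ### Power series along the weak separatrix -/

section PowerSeries

open PowerSeries

/-- The function `f` is the sum of the power series `b` near `0`. -/
def HasPowerSeries (f : ℂ → ℂ) (b : PowerSeries ℂ) : Prop :=
  ∀ᶠ z in 𝓝 (0 : ℂ), HasSum (fun i => z ^ i * coeff i b) (f z)

namespace HasPowerSeries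

variable {f g : ℂ → ℂ} {b d : PowerSeries ℂ}

theorem of_analyticAt (hf : AnalyticAt ℂ f 0) :
    HasPowerSeries f (.mk fun i => iteratedDeriv i f 0 / (i.factorial : ℂ)) := by
  have := hasFPowerSeriesAt_iff.1 hf.hasFPowerSeriesAt
  filter_upwards [this] with z hz
  simpa [FormalMultilinearSeries.coeff_ofScalars] using hz

theorem add (hf : HasPowerSeries f b) (hg : HasPowerSeries g d) :
    HasPowerSeries (fun z => f z + g z) (b + d) := by
  filter_upwards [hf, hg] with z h1 h2
  simpa [mul_add] using h1.add h2

theorem const_mul (c : ℂ) (hf : HasPowerSeries f b) :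
    HasPowerSeries (fun z => c * f z) (C c * b) := by
  filter_upwards [hf] with z h1
  simpa [mul_left_comm] using h1.mul_left c

theorem X_mul (hf : HasPowerSeries f b) : HasPowerSeries (fun z => z * f z) (X * b) := by
  filter_upwards [hf] with z h1
  refine (hasSum_nat_add_iff' 1).1 ?_
  simpa [coeff_succ_X_mul, pow_succ', mul_assoc] using h1.mul_left z

theorem X_pow_mul (hf : HasPowerSeries f b) (n : ℕ) :
    HasPowerSeries (fun z => z ^ n * f z) (X ^ n * b) := by
  induction n with
  | zero => simpa using hf
  | succ n ih => simpa [pow_succ', mul_assoc] using ih.X_mul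

theorem const (c : ℂ) : HasPowerSeries (fun _ => c) (C c) := by
  refine Eventually.of_forall fun z => ?_
  have := hasSum_single (f := fun i => z ^ i * coeff i (C c)) 0 (by
    intro i hi; simp [coeff_C, hi])
  simpa using this

theorem sum {ι : Type*} (s : Finset ι) {f : ι → ℂ → ℂ} {b : ι → PowerSeries ℂ}
    (h : ∀ i ∈ s, HasPowerSeries (f i) (b i)) :
    HasPowerSeries (fun z => ∑ i ∈ s, f i z) (∑ i ∈ s, b i) := by
  have h' : ∀ᶠ z in 𝓝 (0 : ℂ), ∀ i ∈ s, HasSum (fun j => z ^ j * coeff j (b i)) (f i z) :=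
    (eventually_all_finset s).2 h
  filter_upwards [h'] with z hz
  simpa [map_sum, Finset.mul_sum] using hasSum_sum hz

theorem unique (hf : HasPowerSeries f b) (hg : HasPowerSeries g d) (hfg : f =ᶠ[𝓝 0] g) :
    b = d := by
  have h1 : HasFPowerSeriesAt f (.ofScalars ℂ fun i => coeff i b) 0 := by
    refine hasFPowerSeriesAt_iff.2 (hf.mono fun z hz => ?_)
    simpa [FormalMultilinearSeries.coeff_ofScalars] using hz
  have h2 : HasFPowerSeriesAt g (.ofScalars ℂ fun i => coeff i d) 0 := by
    refine hasFPowerSeriesAt_iff.2 (hg.mono fun z hz => ?_)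
    simpa [FormalMultilinearSeries.coeff_ofScalars] using hz
  have h3 := h1.eq_formalMultilinearSeries_of_eventually h2 hfg
  ext i
  have := congrArg (fun p : FormalMultilinearSeries ℂ ℂ ℂ => p.coeff i) h3
  simpa [FormalMultilinearSeries.coeff_ofScalars] using this

theorem eventually_eq_zero (hf : HasPowerSeries f 0) : ∀ᶠ z in 𝓝 0, f z = 0 := by
  filter_upwards [hf] with z hz
  simpa using hz.unique (by simp [hasSum_zero])

theorem deriv (ha : AnalyticAt ℂ f 0) (hf : HasPowerSeries f b) :
    HasPowerSeries (deriv f) (d⁄dX ℂ b) := by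
  have h1 := hf.unique (of_analyticAt ha) (EventuallyEq.refl _ _)
  have h2 := of_analyticAt ha.deriv
  convert h2 using 1
  ext i
  rw [coeff_derivative, h1, coeff_mk, coeff_mk, ← iteratedDeriv_succ', Nat.factorial_succ]
  have : ((i : ℂ) + 1) ≠ 0 := by exact_mod_cast Nat.succ_ne_zero i
  have h3 : (i.factorial : ℂ) ≠ 0 := by exact_mod_cast i.factorial_ne_zero
  push_cast
  field_simp

end HasPowerSeries

/-- The linearised equation along the weak separatrix of a saddle-node has no nonzero convergent
solution: the coefficients of a solution satisfy a two-term recursion with unbounded factors. -/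
theorem eq_zero_of_saddleNode_equation {k m τ : ℕ} (hk : 1 ≤ k) (hm : 1 ≤ m) {μ : ℂ}
    (hμ : μ + ((k : ℂ) + 1) * (τ : ℂ) ∈ Complex.slitPlane) {f : ℂ → ℂ} (hf : AnalyticAt ℂ f 0)
    (a : Fin k → ℂ)
    (h : ∀ᶠ x in 𝓝 (0 : ℂ), x ^ (k + 1) * deriv f x + m * (1 + μ * x ^ k) * f x
      = ∑ j : Fin k, (x ^ (k + 1)) ^ (τ * m) * x ^ ((j : ℕ) + 1) * a j) :
    (∀ᶠ x in 𝓝 0, f x = 0) ∧ ∀ j, a j = 0 := by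
  obtain ⟨b, hb⟩ : ∃ b, HasPowerSeries f b := ⟨_, .of_analyticAt hf⟩
  -- The right-hand side has terms only in the `k` degrees `L + 1, …, L + k`; below and above this
  -- window the recursion is homogeneous.
  set L := (k + 1) * (τ * m) with hL
  have hm0 : (m : ℂ) ≠ 0 := by exact_mod_cast (by omega : m ≠ 0)
  have e1 := (((hb.deriv hf).X_pow_mul (k + 1)).add
    ((hb.const_mul m).add ((hb.X_pow_mul k).const_mul (m * μ))))
  have e2 := HasPowerSeries.sum Finset.univ (fun (j : Fin k) _ =>
    (HasPowerSeries.const (a j)).X_pow_mul (L + ((j : ℕ) + 1)))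
  have e3 := e1.unique e2 (by
    filter_upwards [h] with x hx
    rw [show x ^ (k + 1) * _root_.deriv f x + (m * f x + m * μ * (x ^ k * f x))
      = x ^ (k + 1) * _root_.deriv f x + m * (1 + μ * x ^ k) * f x by ring, hx]
    refine Finset.sum_congr rfl fun j _ => ?_
    rw [pow_add x L ((j : ℕ) + 1), hL, pow_mul x (k + 1)])
  have hD (i : ℕ) : coeff i (∑ j : Fin k, (X : PowerSeries ℂ) ^ (L + ((j : ℕ) + 1)) * C (a j))
      = ∑ j : Fin k, if i = L + ((j : ℕ) + 1) then a j else 0 := by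
    simp only [map_sum, coeff_X_pow_mul', coeff_C]
    refine Finset.sum_congr rfl fun j _ => ?_
    by_cases h1 : i = L + ((j : ℕ) + 1)
    · simp [h1]
    · rw [if_neg h1]
      split_ifs with h2 h3
      · omega
      · rfl
      · rfl
  set D : ℕ → ℂ := fun i => ∑ j : Fin k, if i = L + ((j : ℕ) + 1) then a j else 0 with hDdef
  have hDa (j : Fin k) : D (L + ((j : ℕ) + 1)) = a j := by
    simp only [hDdef]
    rw [Finset.sum_eq_single j]
    · simp
    · intro i _ hij
      rw [if_neg]; intro h; exact hij (Fin.ext (by omega))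
    · simp
  have hD0 (i : ℕ) (hi : i ≤ L ∨ L + k < i) : D i = 0 := by
    refine Finset.sum_eq_zero fun j _ => if_neg ?_
    have := j.2
    omega
  have rec1 (i : ℕ) (hi : i < k) : m * coeff i b = D i := by
    have := congrArg (coeff i) e3
    rw [hD] at this
    simp only [map_add, coeff_C_mul, coeff_X_pow_mul', show ¬ k + 1 ≤ i by omega,
      show ¬ k ≤ i by omega, if_false, mul_zero, add_zero, zero_add] at this
    exact this
  have rec2 (i : ℕ) : m * coeff (i + k) b + (m * μ + i) * coeff i b = D (i + k) := by
    have := congrArg (coeff (i + k)) e3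
    rw [hD] at this
    change _ = D (i + k) at this
    rw [← this]
    rcases Nat.eq_zero_or_pos i with rfl | hi
    · simp only [map_add, coeff_C_mul, coeff_X_pow_mul', zero_add, show ¬ k + 1 ≤ k by omega,
        le_refl, if_true, if_false, Nat.sub_self, Nat.cast_zero, add_zero]
    · obtain ⟨l, rfl⟩ : ∃ l, i = l + 1 := ⟨i - 1, by omega⟩
      simp only [map_add, coeff_C_mul, coeff_X_pow_mul', coeff_derivative,
        show k + 1 ≤ l + 1 + k by omega, show k ≤ l + 1 + k by omega, if_true,
        show l + 1 + k - (k + 1) = l by omega, show l + 1 + k - k = l + 1 by omega]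
      push_cast
      ring
  -- Up to degree `L` nothing forces the recursion, which starts from `m b_i = 0` for `i < k`.
  have hsmall (i : ℕ) (hi : i ≤ L) : coeff i b = 0 := by
    induction i using Nat.strong_induction_on with
    | _ i ih =>
      by_cases hik : i < k
      · have := rec1 i hik
        rw [hD0 i (Or.inl hi)] at this
        exact (mul_eq_zero.1 this).resolve_left hm0
      · obtain ⟨l, rfl⟩ : ∃ l, i = l + k := ⟨i - k, by omega⟩
        have := rec2 l
        rw [hD0 _ (Or.inl hi), ih l (by omega) (by omega), mul_zero, add_zero] at this
        exact (mul_eq_zero.1 this).resolve_left hm0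
  have hstep (i : ℕ) (hi : L < i) : m * coeff (i + k) b = - (m * μ + i) * coeff i b := by
    have := rec2 i
    rw [hD0 _ (Or.inr (by omega))] at this
    linear_combination this
  -- the coefficients cannot start to be nonzero beyond `L`
  have hfac (i : ℕ) (hi : L < i) : (m * μ + i : ℂ) ≠ 0 := by
    intro h0
    obtain ⟨l, rfl⟩ : ∃ l, i = L + l := ⟨i - L, by omega⟩
    -- A zero of `m μ + i` at `i = L + l` would put `μ + (k + 1) τ` at the point `-l / m` of the
    -- excluded half-line.
    have h1 : μ + ((k : ℂ) + 1) * τ = ((-(l / m : ℝ) : ℝ) : ℂ) := by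
      push_cast
      field_simp
      rw [hL] at h0
      push_cast at h0
      linear_combination h0
    rw [h1, Complex.ofReal_mem_slitPlane] at hμ
    have : (0 : ℝ) ≤ l / m := by positivity
    linarith
  have hconv : ∃ ρ : ℝ, 0 < ρ ∧ Tendsto (fun i => ρ ^ i * ‖coeff i b‖) atTop (𝓝 0) := by
    obtain ⟨ρ, hρ, hρ'⟩ := Metric.eventually_nhds_iff_ball.1 hb
    have hmem : ((ρ / 2 : ℝ) : ℂ) ∈ Metric.ball (0 : ℂ) ρ := by
      rw [mem_ball_zero_iff, Complex.norm_real, Real.norm_of_nonneg (by positivity)]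
      linarith
    refine ⟨ρ / 2, by positivity, ?_⟩
    have := (hρ' _ hmem).summable.tendsto_atTop_zero.norm
    simpa [abs_of_pos hρ] using this
  obtain ⟨ρ, hρ, hlim⟩ := hconv
  have hbig : ∀ i, L < i → coeff i b = 0 := by
    intro i hi
    by_contra hne
    have hne' (l : ℕ) : coeff (i + l * k) b ≠ 0 := by
      induction l with
      | zero => simpa using hne
      | succ l ih =>
        have h1 := hstep (i + l * k) (by omega)
        rw [show i + l * k + k = i + (l + 1) * k by ring] at h1
        intro h0
        rw [h0, mul_zero] at h1
        rcases mul_eq_zero.1 h1.symm with h2 | h2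
        · exact hfac (i + l * k) (by omega) (neg_eq_zero.1 h2)
        · exact ih h2
    -- Once `|m μ + i| ρᵏ ≥ m`, the weighted coefficients `ρ^i |b_i|` no longer decrease along the
    -- progression of step `k`. Being nonzero, they cannot tend to `0`.
    have hgrow : ∀ᶠ l : ℕ in atTop, (m : ℝ) ≤ ρ ^ k * ‖(m * μ + (i + l * k : ℕ) : ℂ)‖ := by
      have h1 : Tendsto (fun l : ℕ => ((i + l * k : ℕ) : ℝ)) atTop atTop :=
        tendsto_natCast_atTop_atTop.comp (tendsto_atTop_mono
          (fun l => (Nat.le_mul_of_pos_right l hk).trans (Nat.le_add_left _ _)) tendsto_id)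
      filter_upwards [h1.eventually_ge_atTop (m / ρ ^ k + ‖(m * μ : ℂ)‖)] with l hl
      have h2 : ‖((i + l * k : ℕ) : ℂ)‖ ≤ ‖(m * μ + (i + l * k : ℕ) : ℂ)‖ + ‖(m * μ : ℂ)‖ := by
        have := norm_sub_le (m * μ + (i + l * k : ℕ) : ℂ) (m * μ)
        rwa [add_sub_cancel_left] at this
      rw [Complex.norm_natCast] at h2
      have h3 : (m : ℝ) / ρ ^ k ≤ ‖(m * μ + (i + l * k : ℕ) : ℂ)‖ := by linarith
      rw [div_le_iff₀ (by positivity)] at h3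
      linarith
    obtain ⟨l₀, hl₀⟩ := eventually_atTop.1 hgrow
    let w : ℕ → ℝ := fun l => ρ ^ (i + l * k) * ‖coeff (i + l * k) b‖
    have hw (l : ℕ) (hl : l₀ ≤ l) : w l ≤ w (l + 1) := by
      have h1 := congrArg norm (hstep (i + l * k) (by omega))
      rw [norm_mul, norm_mul, norm_neg, Complex.norm_natCast,
        show i + l * k + k = i + (l + 1) * k by ring] at h1
      have h2 := hl₀ l hl
      have hmpos : (0 : ℝ) < m := by exact_mod_cast hm
      have h3 : (m : ℝ) * w l ≤ m * w (l + 1) := by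
        calc (m : ℝ) * w l ≤ (ρ ^ k * ‖(m * μ + (i + l * k : ℕ) : ℂ)‖) * w l := by
              gcongr
          _ = ρ ^ (i + (l + 1) * k) *
              (‖(m * μ + (i + l * k : ℕ) : ℂ)‖ * ‖coeff (i + l * k) b‖) := by
              simp only [w]; ring
          _ = ρ ^ (i + (l + 1) * k) * (m * ‖coeff (i + (l + 1) * k) b‖) := by rw [h1]
          _ = m * w (l + 1) := by simp only [w]; ring
      exact le_of_mul_le_mul_left h3 hmpos
    have hw' (l : ℕ) (hl : l₀ ≤ l) : w l₀ ≤ w l := by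
      induction l, hl using Nat.le_induction with
      | base => exact le_rfl
      | succ l hl ih => exact ih.trans (hw l hl)
    have hpos : 0 < w l₀ := mul_pos (by positivity) (norm_pos_iff.2 (hne' l₀))
    have hwlim : Tendsto w atTop (𝓝 0) :=
      hlim.comp (tendsto_atTop_mono
        (fun l => (Nat.le_mul_of_pos_right l hk).trans (Nat.le_add_left _ _)) tendsto_id)
    exact absurd (ge_of_tendsto hwlim (eventually_atTop.2 ⟨l₀, hw'⟩)) (not_le.2 hpos)
  have hb0 : b = 0 := by
    ext i
    rcases le_or_gt i L with hi | hi
    · simpa using hsmall i hi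
    · simpa using hbig i hi
  subst hb0
  refine ⟨hb.eventually_eq_zero, fun j => ?_⟩
  rw [← hDa]
  rcases lt_or_ge (L + ((j : ℕ) + 1)) k with hjk | hjk
  · simpa using (rec1 _ hjk).symm
  · obtain ⟨l, hl⟩ : ∃ l, L + ((j : ℕ) + 1) = l + k := ⟨L + ((j : ℕ) + 1) - k, by omega⟩
    rw [hl]
    simpa using (rec2 l).symm

/-- A polynomial of degree at most `k` that is divisible by `x ^ (k + 1)` vanishes. -/
theorem eq_zero_of_pow_mul_eq_polynomial {k : ℕ} {f : ℂ → ℂ} (hf : AnalyticAt ℂ f 0)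
    (a : Fin (k + 1) → ℂ)
    (h : ∀ᶠ x in 𝓝 (0 : ℂ), x ^ (k + 1) * f x = ∑ j : Fin (k + 1), x ^ (j : ℕ) * a j) :
    (∀ᶠ x in 𝓝 0, f x = 0) ∧ ∀ j, a j = 0 := by
  have hb := HasPowerSeries.of_analyticAt hf
  set b : PowerSeries ℂ := .mk fun i => iteratedDeriv i f 0 / (i.factorial : ℂ)
  have e := (hb.X_pow_mul (k + 1)).unique (HasPowerSeries.sum Finset.univ
    (fun (j : Fin (k + 1)) _ => (HasPowerSeries.const (a j)).X_pow_mul (j : ℕ))) h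
  have ha (j : Fin (k + 1)) : a j = 0 := by
    have := congrArg (coeff (j : ℕ)) e
    -- The left-hand side has no coefficient in degree at most `k`, whereas the right-hand side has
    -- no other ones.
    rw [coeff_X_pow_mul', if_neg (by omega), map_sum, Finset.sum_eq_single j] at this
    · simpa [coeff_X_pow_mul'] using this.symm
    · intro i _ hij
      rw [coeff_X_pow_mul']
      split_ifs with h1
      · rw [coeff_C, if_neg]
        intro h2
        exact hij (Fin.ext (by omega))
      · rfl
    · simp
  refine ⟨?_, ha⟩
  have hb0 : b = 0 := by
    have : (X : PowerSeries ℂ) ^ (k + 1) * b = 0 := by simpa [ha] using e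
    exact (mul_eq_zero.1 this).resolve_left (pow_ne_zero _ X_ne_zero)
  rw [hb0] at hb
  exact hb.eventually_eq_zero

end PowerSeries

/-! ### Uniqueness for linear equations in `x`, without and with parameters -/

theorem isCoord_id : IsCoord (fun x : ℂ => x) 1 where
  analytic _ := analyticAt_id
  add_smul q s := by simp

/-- Uniqueness of the formal centre manifold. -/
theorem eq_zero_of_pow_mul_deriv_eq {k : ℕ} (hk : 1 ≤ k) {f h : ℂ → ℂ} (hf : AnalyticAt ℂ f 0)
    (hh : AnalyticAt ℂ h 0) (hh0 : h 0 ≠ 0)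
    (heq : ∀ᶠ x in 𝓝 (0 : ℂ), x ^ (k + 1) * deriv f x = h x * f x) :
    ∀ᶠ x in 𝓝 0, f x = 0 := by
  refine isCoord_id.eventually_eq_zero_of_step rfl hf fun n g hg hfg => ?_
  -- After cancellation of `x ^ n`, the left-hand side still carries the factor `x ^ k` with `k ≥
  -- 1`. At `x = 0` this leaves `h 0 * g 0 = 0`.
  have key : ∀ᶠ x in 𝓝 (0 : ℂ), x ^ k * (x * deriv g x + n * g x) = h x * g x := by
    have hd := hg.deriv
    refine isCoord_id.eventually_eq (by fun_prop) (by fun_prop) ?_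
    filter_upwards [heq, eventually_eventually_nhds.2 hfg, hg.eventually_analyticAt] with x h1 h2 h3 hx
    have h2' : f =ᶠ[𝓝 x] fun x => x ^ n * g x := h2
    have hd : deriv f x = n * x ^ (n - 1) * g x + x ^ n * deriv g x := by
      rw [h2'.deriv_eq]
      exact ((hasDerivAt_pow n x).mul h3.differentiableAt.hasDerivAt).deriv
    rw [hd, h2'.eq_of_nhds] at h1
    have hx' : x ^ n ≠ 0 := pow_ne_zero _ hx
    refine mul_left_cancel₀ hx' ?_
    rcases Nat.eq_zero_or_pos n with rfl | hn
    · simp only [pow_zero, one_mul, CharP.cast_eq_zero, zero_mul, zero_add, add_zero] at h1 ⊢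
      rw [← h1]; ring
    · obtain ⟨l, rfl⟩ : ∃ l, n = l + 1 := ⟨n - 1, by omega⟩
      rw [Nat.add_sub_cancel] at h1
      linear_combination h1
  have h0 := key.self_of_nhds
  rw [zero_pow (by omega), zero_mul] at h0
  have hg0 : g 0 = 0 := (mul_eq_zero.1 h0.symm).resolve_left hh0
  simp [slice, hg0]

theorem tendsto_of_analyticAt {E F : Type*} [NormedAddCommGroup E] [NormedSpace ℂ E]
    [NormedAddCommGroup F] [NormedSpace ℂ F] {f : E → F} {a : E} {b : F} (hf : AnalyticAt ℂ f a)
    (h : f a = b) : Tendsto f (𝓝 a) (𝓝 b) := h ▸ hf.continuousAt.tendsto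

/-- Uniqueness for linear equations with parameters, reduced to the parameter `ε = 0`. -/
theorem eventually_eq_zero_of_linear {k : ℕ} {ι : Type*} [Fintype ι] {A B : Param k × ℂ → ℂ}
    {c : ι → Param k × ℂ → ℂ} (hA : AnalyticAt ℂ A 0) (hB : AnalyticAt ℂ B 0)
    (hc : ∀ j, AnalyticAt ℂ (c j) 0) {f : Param k × ℂ → ℂ} (hf : AnalyticAt ℂ f 0)
    {a : ι → Param k → ℂ} (ha : ∀ j, AnalyticAt ℂ (a j) 0)
    (h : ∀ᶠ p in 𝓝 (0 : Param k × ℂ), A p * fderiv ℂ f p (0, 1) + B p * f p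
      = ∑ j, c j p * a j p.1)
    (hinj : ∀ (g : ℂ → ℂ) (b : ι → ℂ), AnalyticAt ℂ g 0 →
      (∀ᶠ x in 𝓝 (0 : ℂ), A (0, x) * deriv g x + B (0, x) * g x = ∑ j, c j (0, x) * b j) →
      (∀ᶠ x in 𝓝 0, g x = 0) ∧ ∀ j, b j = 0) :
    (∀ᶠ p in 𝓝 0, f p = 0) ∧ ∀ j, ∀ᶠ ε in 𝓝 0, a j ε = 0 := by
  -- On a line `ε = s e` the pair formed by `f` and all the `a j` is factored by a common power of
  -- `s`. Its leading coefficient solves the equation at `ε = 0`, so `hinj` makes it vanish.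
  have key (e : Param k) : ∀ᶠ p in 𝓝 (0 : ℂ × ℂ), f (p.1 • e, p.2) = 0 ∧
      ∀ j, a j (p.1 • e) = 0 := by
    have hL : ∀ p, AnalyticAt ℂ (fun p : ℂ × ℂ => (p.1 • e, p.2)) p := fun p => by fun_prop
    have hLt : Tendsto (fun p : ℂ × ℂ => (p.1 • e, p.2)) (𝓝 0) (𝓝 0) :=
      tendsto_of_analyticAt (hL 0) (by simp)
    have hf' : AnalyticAt ℂ (fun p : ℂ × ℂ => f (p.1 • e, p.2)) 0 :=
      hf.fun_comp_of_eq (hL 0) (by simp)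
    have ha' (j : ι) : AnalyticAt ℂ (fun p : ℂ × ℂ => a j (p.1 • e)) 0 :=
      (ha j).fun_comp_of_eq (f := fun p : ℂ × ℂ => p.1 • e) (by fun_prop) (by simp)
    have hA' : AnalyticAt ℂ (fun p : ℂ × ℂ => A (p.1 • e, p.2)) 0 :=
      hA.fun_comp_of_eq (hL 0) (by simp)
    have hB' : AnalyticAt ℂ (fun p : ℂ × ℂ => B (p.1 • e, p.2)) 0 :=
      hB.fun_comp_of_eq (hL 0) (by simp)
    have hc' (j : ι) : AnalyticAt ℂ (fun p : ℂ × ℂ => c j (p.1 • e, p.2)) 0 :=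
      (hc j).fun_comp_of_eq (hL 0) (by simp)
    have := isCoord_fst.eventually_eq_zero_of_step (a := (0 : ℂ × ℂ)) (F := ℂ × (ι → ℂ))
      (f := fun p => (f (p.1 • e, p.2), fun j => a j (p.1 • e))) rfl
      (hf'.prod (AnalyticAt.pi ha')) (fun n g hg hfg => ?_)
    · filter_upwards [this] with p hp
      exact ⟨congrArg Prod.fst hp, fun j => congrFun (congrArg Prod.snd hp) j⟩
    -- the coefficients at parameter `0`
    have hs : Tendsto (fun p : ℂ × ℂ => (p.1, (0 : ℂ))) (𝓝 0) (𝓝 0) :=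
      tendsto_of_analyticAt (by fun_prop) (by simp)
    have hg1 : AnalyticAt ℂ (fun p => (g p).1) 0 := by fun_prop
    have hg2 (j : ι) : AnalyticAt ℂ (fun p => (g p).2 j) 0 :=
      (analyticAt_eval j _).fun_comp (f := fun p => (g p).2) (by fun_prop)
    have hg3 (j : ι) : AnalyticAt ℂ (fun p : ℂ × ℂ => (g (p.1, 0)).2 j) 0 :=
      (hg2 j).fun_comp_of_eq (f := fun p : ℂ × ℂ => (p.1, (0 : ℂ))) (by fun_prop) (by simp)
    have hEq : ∀ᶠ p in 𝓝 (0 : ℂ × ℂ), A (p.1 • e, p.2) * fderiv ℂ (fun p => (g p).1) p (0, 1)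
        + B (p.1 • e, p.2) * (g p).1 = ∑ j, c j (p.1 • e, p.2) * (g (p.1, 0)).2 j := by
      have hd : AnalyticAt ℂ (fun p => fderiv ℂ (fun p => (g p).1) p (0, 1)) 0 :=
        analyticAt_fderiv_apply hg1 analyticAt_const
      refine isCoord_fst.eventually_eq ((hA'.mul hd).add (hB'.mul hg1))
        (Finset.analyticAt_fun_sum _ fun j _ => (hc' j).mul (hg3 j)) ?_
      filter_upwards [hLt.eventually h, eventually_eventually_nhds.2 hfg, hs.eventually hfg,
        hLt.eventually hf.eventually_analyticAt, hg1.eventually_analyticAt] with p h1 h2 h3 h4 h5 hp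
      have hp' : p.1 ^ n ≠ 0 := pow_ne_zero _ hp
      have h2' : (fun p : ℂ × ℂ => f (p.1 • e, p.2)) =ᶠ[𝓝 p] fun p => p.1 ^ n • (g p).1 :=
        h2.mono fun q hq => congrArg Prod.fst hq
      have h6 : fderiv ℂ (fun p : ℂ × ℂ => f (p.1 • e, p.2)) p (0, 1)
          = fderiv ℂ f (p.1 • e, p.2) (0, 1) := by
        have hd1 : HasFDerivAt (fun p : ℂ × ℂ => (p.1 • e, p.2))
            (((ContinuousLinearMap.fst ℂ ℂ ℂ).smulRight e).prod (ContinuousLinearMap.snd ℂ ℂ ℂ)) p :=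
          (hasFDerivAt_fst.smul_const e).prodMk hasFDerivAt_snd
        have := HasFDerivAt.comp p (g := f) h4.differentiableAt.hasFDerivAt hd1
        rw [show (fun p : ℂ × ℂ => f (p.1 • e, p.2)) = f ∘ fun p => (p.1 • e, p.2) from rfl,
          this.fderiv]
        simp
      have h7 : fderiv ℂ (fun p : ℂ × ℂ => f (p.1 • e, p.2)) p (0, 1)
          = p.1 ^ n * fderiv ℂ (fun p => (g p).1) p (0, 1) := by
        rw [h2'.fderiv_eq, fderiv_pow_smul_apply differentiableAt_fst h5.differentiableAt]
        simp [fderiv_fst]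
      have h8 : f (p.1 • e, p.2) = p.1 ^ n * (g p).1 := h2'.eq_of_nhds
      have h9 (j : ι) : a j (p.1 • e) = p.1 ^ n * (g (p.1, 0)).2 j :=
        congrFun (congrArg Prod.snd h3) j
      refine mul_left_cancel₀ hp' ?_
      simp only [h8, h9, ← h6, h7] at h1
      calc _ = _ := by ring
        _ = _ := h1
        _ = _ := by rw [Finset.mul_sum]; exact Finset.sum_congr rfl fun j _ => by ring
    have hx : Tendsto (fun x : ℂ => ((0 : ℂ), x)) (𝓝 0) (𝓝 0) :=
      tendsto_of_analyticAt (by fun_prop) (by simp)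
    have hgx : AnalyticAt ℂ (fun x : ℂ => (g (0, x)).1) 0 :=
      hg1.fun_comp_of_eq (f := fun x : ℂ => ((0 : ℂ), x)) (by fun_prop) (by simp)
    obtain ⟨h10, h11⟩ := hinj (fun x => (g (0, x)).1) (fun j => (g (0, 0)).2 j) hgx (by
      filter_upwards [hx.eventually hEq, hx.eventually hg1.eventually_analyticAt] with x h1 h2
      have h3 : deriv (fun x => (g (0, x)).1) x = fderiv ℂ (fun p => (g p).1) (0, x) (0, 1) := by
        have hd : HasDerivAt (fun x : ℂ => ((0 : ℂ), x)) (0, 1) x :=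
          (hasDerivAt_const _ _).prodMk (hasDerivAt_id _)
        exact (HasFDerivAt.comp_hasDerivAt (l := fun p => (g p).1) x
          h2.differentiableAt.hasFDerivAt hd).deriv
      rw [h3]
      simpa using h1)
    -- The germs `a j` do not involve `x`, hence neither does their quotient by `s ^ n`. At `s = 0`
    -- it is therefore a constant, as `hinj` requires.
    have hsame : ∀ᶠ p in 𝓝 (0 : ℂ × ℂ), ∀ j, (g p).2 j = (g (p.1, 0)).2 j := by
      rw [eventually_all]
      refine fun j => isCoord_fst.eventually_eq (hg2 j) (hg3 j) ?_
      filter_upwards [hfg, hs.eventually hfg] with p h1 h2 hp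
      have h3 : a j (p.1 • e) = p.1 ^ n * (g p).2 j := congrFun (congrArg Prod.snd h1) j
      have h4 : a j (p.1 • e) = p.1 ^ n * (g (p.1, 0)).2 j := congrFun (congrArg Prod.snd h2) j
      exact mul_left_cancel₀ (pow_ne_zero n hp) (h3.symm.trans h4)
    filter_upwards [(continuous_snd.tendsto (0 : ℂ × ℂ)).eventually h10,
      (isCoord_fst.tendsto_slice rfl).eventually hsame] with p h1 h2
    rw [slice_fst] at h2 ⊢
    ext j
    · exact h1
    · rw [h2]; exact h11 j
  constructor
  · refine eventually_eq_zero_of_lines hf (Eventually.of_forall fun p => ?_)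
    have ht : Tendsto (fun s : ℂ => (s, s * p.2)) (𝓝 0) (𝓝 0) :=
      tendsto_of_analyticAt (by fun_prop) (by simp)
    filter_upwards [ht.eventually (key p.1)] with s hs
    have : (0 : Param k × ℂ) + s • (p - 0) = (s • p.1, s * p.2) := by simp [Prod.smul_def]
    rw [this]; exact hs.1
  · intro j
    refine eventually_eq_zero_of_lines (ha j) (Eventually.of_forall fun ε => ?_)
    have ht : Tendsto (fun s : ℂ => (s, (0 : ℂ))) (𝓝 0) (𝓝 0) :=
      tendsto_of_analyticAt (by fun_prop) (by simp)
    filter_upwards [ht.eventually (key ε)] with s hs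
    simpa using hs.2 j

/-! ### The cohomological equation with values in a section -/

section Space

variable {k : ℕ}

theorem analyticAt_P (p : Param k × ℂ) : AnalyticAt ℂ (fun p : Param k × ℂ => P p.1 p.2) p := by
  unfold P; fun_prop

theorem analyticAt_P_comp {E : Type*} [NormedAddCommGroup E] [NormedSpace ℂ E] {ε : E → Param k}
    {x : E → ℂ} {a : E} (hε : AnalyticAt ℂ ε a) (hx : AnalyticAt ℂ x a) :
    AnalyticAt ℂ (fun q => P (ε q) (x q)) a :=
  (analyticAt_P _).fun_comp (f := fun q => (ε q, x q)) (hε.prod hx)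

attribute [fun_prop] analyticAt_P_comp

theorem P_zero_left (x : ℂ) : P (0 : Param k) x = x ^ (k + 1) := by simp [P]

theorem P_zero_zero : P (0 : Param k) 0 = 0 := by simp [P]

/-- The direction of `ε₀`. -/
def e₀ (hk : 1 ≤ k) : Param k := Pi.single ⟨0, hk⟩ 1

theorem P_add_smul (hk : 1 ≤ k) (ε : Param k) (s x : ℂ) : P (ε + s • e₀ hk) x = P ε x + s := by
  have : ∑ j : Fin k, s * (e₀ hk j) * x ^ (j : ℕ) = s := by
    rw [Finset.sum_eq_single ⟨0, hk⟩]
    · simp [e₀]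
    · intro j _ hj; simp [e₀, hj]
    · simp
  simp only [P, Pi.add_apply, Pi.smul_apply, smul_eq_mul, add_mul, Finset.sum_add_distrib, this]
  ring

theorem isCoord_y : IsCoord (fun q : Space k => q.2.2) (0, 0, 1) where
  analytic q := by fun_prop
  add_smul q s := by simp

/-- The parameter `ε₀` enters `P` additively with coefficient `1`, so `P` itself is a coordinate
transverse to `∂/∂ε₀`. Division by `P` is then Hadamard's lemma, whatever the multiplicities of the
roots of `P_ε` in `x`. -/
theorem isCoord_P (hk : 1 ≤ k) : IsCoord (fun q : Space k => P q.1 q.2.1) (e₀ hk, 0, 0) where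
  analytic q := by fun_prop
  add_smul q s := by simp [P_add_smul]

theorem slice_y (q : Space k) : slice (fun q : Space k => q.2.2) (0, 0, 1) q = (q.1, q.2.1, 0) := by
  ext <;> simp [slice]

theorem analyticAt_twist (τ : ℕ) (q : Space k) : AnalyticAt ℂ (twist τ) q := by
  unfold twist; fun_prop

theorem twist_zero (τ : ℕ) : twist τ (0 : Space k) = 0 := by simp [twist]

theorem fderiv_space_apply (f : Space k → ℂ) (q : Space k) (a b : ℂ) :
    fderiv ℂ f q (0, a, b) = a * fderiv ℂ f q (0, 1, 0) + b * fderiv ℂ f q (0, 0, 1) := by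
  have : ((0, a, b) : Space k) = a • (0, 1, 0) + b • (0, 0, 1) := by simp
  rw [this, map_add, map_smul, map_smul]; rfl

theorem fderiv_restrict {f : Space k → ℂ} {p : Param k × ℂ}
    (hf : DifferentiableAt ℂ f (p.1, p.2, 0)) :
    fderiv ℂ (fun p : Param k × ℂ => f (p.1, p.2, 0)) p (0, 1)
      = fderiv ℂ f (p.1, p.2, 0) (0, 1, 0) := by
  have hd : HasFDerivAt (fun p : Param k × ℂ => (p.1, p.2, (0 : ℂ)))
      ((ContinuousLinearMap.fst ℂ (Param k) ℂ).prod
        ((ContinuousLinearMap.snd ℂ (Param k) ℂ).prod 0)) p :=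
    hasFDerivAt_fst.prodMk (hasFDerivAt_snd.prodMk (hasFDerivAt_const _ _))
  have := HasFDerivAt.comp p (g := f) hf.hasFDerivAt hd
  rw [show (fun p : Param k × ℂ => f (p.1, p.2, 0)) = f ∘ fun p => (p.1, p.2, 0) from rfl,
    this.fderiv]
  simp

/-- The cohomological equation along the normal form has no nonzero solution with values in the
section. -/
theorem eq_zero_of_cohomological {τ : ℕ} (hk : 1 ≤ k) {μ : Param k → ℂ} (hμ : AnalyticAt ℂ μ 0)
    (hslit : μ 0 + ((k : ℂ) + 1) * (τ : ℂ) ∈ Complex.slitPlane) {r E f D : Space k → ℂ}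
    (hr : AnalyticAt ℂ r 0) (hE : AnalyticAt ℂ E 0) (hf : AnalyticAt ℂ f 0)
    (hE0 : ∀ᶠ q in 𝓝 (0 : Space k), E (q.1, q.2.1, 0) = 0)
    (hf0 : ∀ᶠ q in 𝓝 (0 : Space k), f (q.1, q.2.1, 0) = 0) (hD : IsSection τ D)
    (h : ∀ᶠ q in 𝓝 (0 : Space k), fderiv ℂ f q
      (0, P q.1 q.2.1, q.2.2 * (1 + μ q.1 * q.2.1 ^ k + q.2.2 * r q)) = E q * f q + D q) :
    (∀ᶠ q in 𝓝 0, f q = 0) ∧ ∀ᶠ q in 𝓝 0, D q = 0 := by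
  obtain ⟨g, hg, hgD⟩ := hD
  have hvt : Tendsto (fun q : Space k => (q.1, (0 : ℂ), twist τ q)) (𝓝 0) (𝓝 0) :=
    tendsto_of_analyticAt
      (by have := analyticAt_twist τ (0 : Space k); fun_prop) (by simp [twist_zero])
  have hst : Tendsto (fun q : Space k => (q.1, q.2.1, (0 : ℂ))) (𝓝 0) (𝓝 0) :=
    tendsto_of_analyticAt (by fun_prop) (by simp)
  have hot : Tendsto (fun q : Space k => (q.1, (0 : ℂ), q.2.2)) (𝓝 0) (𝓝 0) :=
    tendsto_of_analyticAt (by fun_prop) (by simp)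
  have hpt : Tendsto (fun p : Param k × ℂ => (p.1, p.2, (0 : ℂ))) (𝓝 0) (𝓝 0) :=
    tendsto_of_analyticAt (by fun_prop) (by simp)
  have hg' (j : Fin k) : AnalyticAt ℂ (fun q : Space k => q.2.2 * g j (q.1, q.2.2)) 0 := by
    have : AnalyticAt ℂ (fun q : Space k => g j (q.1, q.2.2)) 0 :=
      (hg j).fun_comp_of_eq (f := fun q : Space k => (q.1, q.2.2)) (by fun_prop) (by simp)
    fun_prop
  -- The solution and the coefficients of the section are factored by a common power `y ^ m`. The
  -- coefficients are taken at `(ε, y)` rather than `(ε, v)`, and the identity is later evaluated at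
  -- `y = v`, where `v ^ m = P ^ (τ m) y ^ m`.
  have hall := isCoord_y.eventually_eq_zero_of_step (a := (0 : Space k)) (F := ℂ × (Fin k → ℂ))
    (f := fun q => (f q, fun j => q.2.2 * g j (q.1, q.2.2))) rfl
    (hf.prod (AnalyticAt.pi hg')) (fun m G hG hfG => ?_)
  · have h1 : ∀ᶠ q in 𝓝 (0 : Space k), f q = 0 := hall.mono fun q hq => congrArg Prod.fst hq
    refine ⟨h1, ?_⟩
    filter_upwards [hgD, hvt.eventually hall] with q h2 h3
    rw [h2, Finset.mul_sum]
    refine Finset.sum_eq_zero fun j _ => ?_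
    have h4 : twist τ q * g j (q.1, twist τ q) = 0 := congrFun (congrArg Prod.snd h3) j
    rw [← mul_assoc, h4, zero_mul]
  -- For `m = 0` there is nothing to solve: both components vanish on `y = 0`.
  rcases Nat.eq_zero_or_pos m with rfl | hm
  · filter_upwards [(isCoord_y.tendsto_slice rfl).eventually hfG, hf0] with q h1 h2
    rw [slice_y] at h1 ⊢
    simp only [pow_zero, one_smul, h2, zero_mul] at h1
    rw [← h1]; rfl
  have hG1 : AnalyticAt ℂ (fun q => (G q).1) 0 := by fun_prop
  have hG2 (j : Fin k) : AnalyticAt ℂ (fun q => (G q).2 j) 0 :=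
    (analyticAt_eval j _).fun_comp (f := fun q => (G q).2) (by fun_prop)
  have hG3 (j : Fin k) : AnalyticAt ℂ (fun q : Space k => (G (q.1, 0, q.2.2)).2 j) 0 :=
    (hG2 j).fun_comp_of_eq (f := fun q : Space k => (q.1, (0 : ℂ), q.2.2)) (by fun_prop) (by simp)
  have hG4 (j : Fin k) : AnalyticAt ℂ (fun q : Space k => (G (q.1, 0, twist τ q)).2 j) 0 := by
    have := analyticAt_twist τ (0 : Space k)
    exact (hG2 j).fun_comp_of_eq (f := fun q : Space k => (q.1, (0 : ℂ), twist τ q)) (by fun_prop)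
      (by simp [twist_zero])
  have hcoef : ∀ᶠ q in 𝓝 (0 : Space k), ∀ j, (G q).2 j = (G (q.1, 0, q.2.2)).2 j := by
    rw [eventually_all]
    refine fun j => isCoord_y.eventually_eq (hG2 j) (hG3 j) ?_
    filter_upwards [hfG, hot.eventually hfG] with q h1 h2 hq
    have h3 : q.2.2 * g j (q.1, q.2.2) = q.2.2 ^ m * (G q).2 j :=
      congrFun (congrArg Prod.snd h1) j
    have h4 : q.2.2 * g j (q.1, q.2.2) = q.2.2 ^ m * (G (q.1, 0, q.2.2)).2 j :=
      congrFun (congrArg Prod.snd h2) j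
    exact mul_left_cancel₀ (pow_ne_zero m hq) (h3.symm.trans h4)
  have hEq : ∀ᶠ q in 𝓝 (0 : Space k), P q.1 q.2.1 * fderiv ℂ (fun q => (G q).1) q (0, 1, 0)
      + (1 + μ q.1 * q.2.1 ^ k + q.2.2 * r q) * (m * (G q).1
        + q.2.2 * fderiv ℂ (fun q => (G q).1) q (0, 0, 1))
      = E q * (G q).1 + ∑ j : Fin k, P q.1 q.2.1 ^ (τ * m) * q.2.1 ^ ((j : ℕ) + 1)
        * (G (q.1, 0, twist τ q)).2 j := by
    have hd (v : Space k) : AnalyticAt ℂ (fun q => fderiv ℂ (fun q => (G q).1) q v) 0 :=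
      analyticAt_fderiv_apply hG1 analyticAt_const
    have hd1 := hd (0, 1, 0)
    have hd2 := hd (0, 0, 1)
    have hμ' : AnalyticAt ℂ (fun q : Space k => μ q.1) 0 :=
      hμ.fun_comp_of_eq (by fun_prop) (by simp)
    refine isCoord_y.eventually_eq (by fun_prop) ((hE.mul hG1).add
      (Finset.analyticAt_fun_sum _ fun j _ => AnalyticAt.fun_mul (by fun_prop) (hG4 j))) ?_
    filter_upwards [h, eventually_eventually_nhds.2 hfG, hG1.eventually_analyticAt, hgD,
      hvt.eventually hfG] with q h1 h2 h3 h4 h5 hq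
    have h2' : f =ᶠ[𝓝 q] fun q => q.2.2 ^ m • (G q).1 :=
      h2.mono fun q hq => congrArg Prod.fst hq
    rw [h2'.fderiv_eq, h2'.eq_of_nhds, h4, fderiv_pow_smul_apply
      (c := fun q : Space k => q.2.2) (isCoord_y.analytic q).differentiableAt h3.differentiableAt]
      at h1
    have h6 : fderiv ℂ (fun q : Space k => q.2.2) q
        (0, P q.1 q.2.1, q.2.2 * (1 + μ q.1 * q.2.1 ^ k + q.2.2 * r q))
        = q.2.2 * (1 + μ q.1 * q.2.1 ^ k + q.2.2 * r q) := by
      have : HasFDerivAt (fun q : Space k => q.2.2) ((ContinuousLinearMap.snd ℂ ℂ ℂ).comp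
        (ContinuousLinearMap.snd ℂ (Param k) (ℂ × ℂ))) q :=
        hasFDerivAt_snd.comp q hasFDerivAt_snd
      rw [this.fderiv]; simp
    rw [h6, fderiv_space_apply] at h1
    have h7 (j : Fin k) : twist τ q * g j (q.1, twist τ q)
        = twist τ q ^ m * (G (q.1, 0, twist τ q)).2 j := congrFun (congrArg Prod.snd h5) j
    have h8 : twist τ q * ∑ j : Fin k, g j (q.1, twist τ q) * q.2.1 ^ ((j : ℕ) + 1)
        = q.2.2 ^ m * ∑ j : Fin k, P q.1 q.2.1 ^ (τ * m) * q.2.1 ^ ((j : ℕ) + 1)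
          * (G (q.1, 0, twist τ q)).2 j := by
      rw [Finset.mul_sum, Finset.mul_sum]
      refine Finset.sum_congr rfl fun j _ => ?_
      rw [← mul_assoc, h7]
      have : twist τ q ^ m = P q.1 q.2.1 ^ (τ * m) * q.2.2 ^ m := by
        rw [twist, mul_pow, pow_mul]
      rw [this]; ring
    rw [h8] at h1
    refine mul_left_cancel₀ (pow_ne_zero m hq) ?_
    obtain ⟨l, rfl⟩ : ∃ l, m = l + 1 := ⟨m - 1, by omega⟩
    simp only [smul_eq_mul, Nat.add_sub_cancel] at h1
    linear_combination h1
  have hμ'' : AnalyticAt ℂ (fun p : Param k × ℂ => μ p.1) 0 :=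
    hμ.fun_comp_of_eq (by fun_prop) (by simp)
  -- On `y = 0` the terms with `r`, `E` and `∂/∂y` disappear from `hEq`. What remains is the
  -- saddle-node equation of weight `m` with coefficients depending on `ε`.
  obtain ⟨h1, h2⟩ := eventually_eq_zero_of_linear (ι := Fin k)
    (A := fun p => P p.1 p.2) (B := fun p => m * (1 + μ p.1 * p.2 ^ k))
    (c := fun j p => P p.1 p.2 ^ (τ * m) * p.2 ^ ((j : ℕ) + 1))
    (f := fun p : Param k × ℂ => (G (p.1, p.2, 0)).1) (a := fun j ε => (G (ε, 0, 0)).2 j)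
    (analyticAt_P _) (by fun_prop) (fun j => by fun_prop)
    (hG1.fun_comp_of_eq (f := fun p : Param k × ℂ => (p.1, p.2, (0 : ℂ))) (by fun_prop) (by simp))
    (fun j => (hG2 j).fun_comp_of_eq (f := fun ε : Param k => (ε, (0 : ℂ), (0 : ℂ)))
      (by fun_prop) (by simp))
    (by
      filter_upwards [hpt.eventually hEq, hpt.eventually hG1.eventually_analyticAt,
        hpt.eventually hE0] with p h3 h4 h5
      have h6 := fderiv_restrict (f := fun q => (G q).1) h4.differentiableAt
      simp only [twist, mul_zero, zero_mul, add_zero, h5, zero_add] at h3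
      rw [h6, ← h3]; ring)
    (by
      intro u b hu hub
      refine eq_zero_of_saddleNode_equation hk hm hslit hu b ?_
      simpa [P_zero_left] using hub)
  have h1' : ∀ᶠ q in 𝓝 (0 : Space k), (G (q.1, q.2.1, 0)).1 = 0 := by
    have ht : Tendsto (fun q : Space k => (q.1, q.2.1)) (𝓝 0) (𝓝 0) :=
      tendsto_of_analyticAt (by fun_prop) (by simp)
    exact ht.eventually h1
  have h2' : ∀ᶠ q in 𝓝 (0 : Space k), ∀ j, (G (q.1, 0, 0)).2 j = 0 := by
    rw [eventually_all]
    exact fun j => (continuous_fst.tendsto (0 : Space k)).eventually (h2 j)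
  filter_upwards [h1', h2', hst.eventually hcoef] with q h3 h4 h5
  rw [slice_y]
  ext j
  · exact h3
  · rw [h5]; exact h4 j

end Space

/-! ### Divided differences of `P_ε` and an implicit function theorem -/

section DividedDifference

variable {k : ℕ}

/-- The divided difference of `P_ε`. -/
noncomputable def divP (ε : Param k) (a b : ℂ) : ℂ :=
  ∑ i ∈ Finset.range (k + 1), b ^ i * a ^ (k + 1 - 1 - i)
    + ∑ j : Fin k, ε j * ∑ i ∈ Finset.range (j : ℕ), b ^ i * a ^ ((j : ℕ) - 1 - i)

theorem P_sub_P (ε : Param k) (a b : ℂ) : P ε b - P ε a = (b - a) * divP ε a b := by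
  have h1 := (Commute.all b a).geom_sum₂_mul (k + 1)
  have h2 (j : Fin k) := (Commute.all b a).geom_sum₂_mul (j : ℕ)
  simp only [P, divP, mul_add, Finset.mul_sum (s := (Finset.univ : Finset (Fin k)))]
  rw [add_sub_add_comm, ← h1, ← Finset.sum_sub_distrib, mul_comm]
  congr 1
  refine Finset.sum_congr rfl fun j _ => ?_
  rw [← mul_sub, ← h2]; ring

theorem analyticAt_divP_comp {E : Type*} [NormedAddCommGroup E] [NormedSpace ℂ E] {ε : E → Param k}
    {x y : E → ℂ} {a : E} (hε : AnalyticAt ℂ ε a) (hx : AnalyticAt ℂ x a) (hy : AnalyticAt ℂ y a) :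
    AnalyticAt ℂ (fun q => divP (ε q) (x q) (y q)) a := by
  have h1 : ∀ j : Fin k, AnalyticAt ℂ (fun q => ε q j) a := fun j =>
    (analyticAt_eval j _).fun_comp hε
  unfold divP
  refine AnalyticAt.fun_add ?_ (Finset.analyticAt_fun_sum _ fun j _ => (h1 j).fun_mul ?_)
  · exact Finset.analyticAt_fun_sum _ fun i _ => (hy.fun_pow _).fun_mul (hx.fun_pow _)
  · exact Finset.analyticAt_fun_sum _ fun i _ => (hy.fun_pow _).fun_mul (hx.fun_pow _)

attribute [fun_prop] analyticAt_divP_comp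

theorem divP_zero_left (a b : ℂ) :
    divP (0 : Param k) a b = ∑ i ∈ Finset.range (k + 1), b ^ i * a ^ (k + 1 - 1 - i) := by
  simp [divP]

theorem divP_zero (hk : 1 ≤ k) : divP (0 : Param k) 0 0 = 0 := by
  rw [divP_zero_left]
  refine Finset.sum_eq_zero fun i hi => ?_
  rcases Nat.eq_zero_or_pos i with rfl | h
  · rw [zero_pow (by omega : k + 1 - 1 - 0 ≠ 0), mul_zero]
  · rw [zero_pow (by omega), zero_mul]

theorem hasDerivAt_P (ε : Param k) (x : ℂ) : HasDerivAt (fun z => P ε z) (divP ε x x) x := by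
  have h1 : (fun z => P ε z) = fun z => P ε x + (z - x) * divP ε x z := by
    funext z; rw [← P_sub_P]; ring
  have h2 : DifferentiableAt ℂ (fun z => divP ε x z) x :=
    (analyticAt_divP_comp (by fun_prop) (by fun_prop) (by fun_prop)).differentiableAt
  rw [h1]
  have h3 := (((hasDerivAt_id x).sub_const x).mul h2.hasDerivAt).const_add (P ε x)
  simpa using h3

end DividedDifference

/-- Implicit function theorem for analytic germs with a scalar unknown. -/
theorem exists_implicit {E : Type*} [NormedAddCommGroup E] [NormedSpace ℂ E] [CompleteSpace E]
    {f : ℂ × E → ℂ} {s₀ : ℂ} (hf : AnalyticAt ℂ f (s₀, 0)) (h0 : f (s₀, 0) = 0)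
    (hd : fderiv ℂ f (s₀, 0) (1, 0) ≠ 0) :
    ∃ g : E → ℂ, AnalyticAt ℂ g 0 ∧ g 0 = s₀ ∧ ∀ᶠ q in 𝓝 0, f (g q, q) = 0 := by
  let F : E × ℂ → ℂ := fun v => f (v.2, v.1)
  have hF : AnalyticAt ℂ F (0, s₀) :=
    hf.fun_comp_of_eq (f := fun v : E × ℂ => (v.2, v.1)) (by fun_prop) rfl
  have hinv : (fderiv ℂ F (0, s₀) ∘L .inr ℂ E ℂ).IsInvertible := by
    have h1 : HasFDerivAt (fun v : E × ℂ => (v.2, v.1))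
        ((ContinuousLinearMap.snd ℂ E ℂ).prod (ContinuousLinearMap.fst ℂ E ℂ)) (0, s₀) :=
      hasFDerivAt_snd.prodMk hasFDerivAt_fst
    have h2 := HasFDerivAt.comp (g := f) ((0 : E), s₀) hf.differentiableAt.hasFDerivAt h1
    have h3 : fderiv ℂ F (0, s₀) ∘L .inr ℂ E ℂ
        = (ContinuousLinearEquiv.unitsEquivAut ℂ (Units.mk0 _ hd) : ℂ →L[ℂ] ℂ) := by
      rw [show F = f ∘ fun v : E × ℂ => (v.2, v.1) from rfl, h2.fderiv]
      ext
      simp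
    rw [h3]
    exact ⟨_, rfl⟩
  have hFc := hF.contDiffAt (n := ⊤)
  have hne : (⊤ : WithTop ℕ∞) ≠ 0 := by simp
  refine ⟨hFc.implicitFunction hne hinv, (hFc.contDiffAt_implicitFunction hne hinv).analyticAt,
    hFc.implicitFunction_apply_self hne hinv, ?_⟩
  have := hFc.eventually_apply_implicitFunction hne hinv
  exact this.mono fun q hq => hq.trans h0

/-! ### Motion of the `x`-coordinate under the flow -/

section FlowX

variable {k : ℕ}

/-- The vector field on the space of all variables defined by a family of vector fields. -/
def lift (Z : Space k → ℂ × ℂ) (q : Space k) : Space k := (0, Z q)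

theorem analyticAt_lift {Z : Space k → ℂ × ℂ} (hZ : AnalyticAt ℂ Z 0) :
    AnalyticAt ℂ (lift Z) 0 := by
  unfold lift; fun_prop

/-- A flow that respects the parameters. -/
structure IsParamFlow (Z : Space k → ℂ × ℂ) (Φ : ℂ × Space k → Space k) : Prop where
  isFlowOn : IsFlowOn (lift Z) Φ Set.univ
  fst_eq : ∀ t, ∀ᶠ p in 𝓝 (t, (0 : Space k)), (Φ p).1 = p.2.1

theorem IsLocalFlow.isParamFlow {Z : Space k → ℂ × ℂ} {Φ : ℂ → Space k → ℂ × ℂ}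
    (h : IsLocalFlow Z Φ) : IsParamFlow Z (fun p => (p.2.1, Φ p.1 p.2)) := by
  have ha (t : ℂ) : AnalyticAt ℂ (fun p : ℂ × Space k => (p.2.1, Φ p.1 p.2)) (t, 0) :=
    AnalyticAt.prod (by fun_prop) (h.2 t).1
  refine ⟨⟨fun t _ => ha t, ?_, fun t _ => ?_⟩, fun t => Eventually.of_forall fun p => rfl⟩
  · filter_upwards [h.1] with q hq
    simp [hq]
  · filter_upwards [(h.2 t).2, (ha t).eventually_analyticAt] with p h1 h2
    have h3 := hasDerivAt_fst_of_analyticAt h2.differentiableAt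
    exact h3.unique ((hasDerivAt_const p.1 p.2.1).prodMk h1)

/-- The lifted field has no component along the parameters, so they stay constant near time `0`, and
the identity theorem extends this to all times. -/
theorem IsFlowOn.isParamFlow {Z : Space k → ℂ × ℂ} {Φ : ℂ × Space k → Space k}
    (h : IsFlowOn (lift Z) Φ Set.univ) : IsParamFlow Z Φ := by
  refine ⟨h, fun t => ?_⟩
  have hu (z : ℂ) := Set.mem_univ z
  have ha (t : ℂ) : AnalyticAt ℂ (fun p : ℂ × Space k => (Φ p).1) (t, 0) :=
    analyticAt_fst.fun_comp (h.analytic t (hu t))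
  have h1 := isCoord_fst.eventually_eq_slice (a := ((0 : ℂ), (0 : Space k))) rfl (ha 0) (by
    filter_upwards [h.ode 0 (hu 0), (h.analytic 0 (hu 0)).eventually_analyticAt] with p h1 h2
    have h3 : HasFDerivAt (fun p : ℂ × Space k => (Φ p).1) _ p :=
      h2.differentiableAt.hasFDerivAt.fst
    rw [h3.fderiv, ContinuousLinearMap.comp_apply, h1]
    rfl)
  have h2 := eventually_eq_zero_of_isPreconnected (f := fun p : ℂ × Space k => (Φ p).1 - p.2.1)
    isPreconnected_univ (fun t _ => (ha t).sub (by fun_prop)) (hu 0) (by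
      have hs : Tendsto (fun p : ℂ × Space k => p.2) (𝓝 (0, 0)) (𝓝 0) :=
        continuous_snd.tendsto ((0 : ℂ), (0 : Space k))
      filter_upwards [h1, hs.eventually h.init] with p h3 h4
      rw [h3, slice_fst, h4, sub_self]) t (hu t)
  exact h2.mono fun p hp => sub_eq_zero.1 hp

theorem IsParamFlow.isLocalFlow {Z : Space k → ℂ × ℂ} {Φ : ℂ × Space k → Space k}
    (h : IsParamFlow Z Φ) : IsLocalFlow Z (fun t q => (Φ (t, q)).2) := by
  have hu (z : ℂ) := Set.mem_univ z
  refine ⟨h.isFlowOn.init.mono fun q hq => congrArg Prod.snd hq, fun t => ⟨?_, ?_⟩⟩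
  · exact analyticAt_snd.fun_comp (h.isFlowOn.analytic t (hu t))
  · filter_upwards [h.isFlowOn.ode t (hu t), h.fst_eq t,
      (h.isFlowOn.analytic t (hu t)).eventually_analyticAt] with p h1 h2 h3
    have h4 := (hasDerivAt_fst_of_analyticAt h3.differentiableAt).snd
    rw [h1] at h4
    rw [← h2]
    exact h4

/-- A family of vector fields with first component `w P_ε(x)`. -/
structure IsModel (Z : Space k → ℂ × ℂ) (w : Space k → ℂ) : Prop where
  analytic : AnalyticAt ℂ Z 0
  zero : Z 0 = 0
  analytic_w : AnalyticAt ℂ w 0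
  fst_eq : ∀ᶠ q in 𝓝 0, (Z q).1 = w q * P q.1 q.2.1

theorem IsModel.lift_zero {Z : Space k → ℂ × ℂ} {w : Space k → ℂ} (hZ : IsModel Z w) :
    lift Z 0 = 0 := by
  simp [lift, hZ.zero]

namespace IsParamFlow

variable {Z : Space k → ℂ × ℂ} {w : Space k → ℂ} {Φ : ℂ × Space k → Space k}

theorem analyticAt (h : IsParamFlow Z Φ) (t : ℂ) : AnalyticAt ℂ Φ (t, 0) :=
  h.isFlowOn.analytic t (Set.mem_univ _)

theorem time_zero (h : IsParamFlow Z Φ) (hZ : IsModel Z w) (t : ℂ) : Φ (t, 0) = 0 :=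
  h.isFlowOn.time_zero (analyticAt_lift hZ.analytic) hZ.lift_zero t

theorem tendsto (h : IsParamFlow Z Φ) (hZ : IsModel Z w) (t : ℂ) :
    Tendsto Φ (𝓝 (t, 0)) (𝓝 0) := tendsto_of_analyticAt (h.analyticAt t) (h.time_zero hZ t)

theorem fderiv_x (h : IsParamFlow Z Φ) (hZ : IsModel Z w) (t : ℂ) :
    ∀ᶠ p in 𝓝 (t, (0 : Space k)), fderiv ℂ (fun p => (Φ p).2.1) p (1, 0)
      = w (Φ p) * P p.2.1 (Φ p).2.1 := by
  filter_upwards [h.isFlowOn.ode t (Set.mem_univ _), h.fst_eq t,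
    (h.tendsto hZ t).eventually hZ.fst_eq, (h.analyticAt t).eventually_analyticAt] with p h1 h2 h3 h4
  have h5 : HasFDerivAt (fun p => (Φ p).2.1) _ p := h4.differentiableAt.hasFDerivAt.snd.fst
  rw [h5.fderiv]
  simp only [ContinuousLinearMap.comp_apply, h1]
  rw [← h2, ← h3]
  rfl

theorem isCoord_P_snd (hk : 1 ≤ k) : IsCoord (fun p : ℂ × Space k => P p.2.1 p.2.2.1)
    (0, e₀ hk, 0, 0) where
  analytic q := by fun_prop
  add_smul q s := by simp [P_add_smul]

/-- The lines `x = x₀` with `P_ε(x₀) = 0` are invariant under the flow. -/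
theorem x_slice (h : IsParamFlow Z Φ) (hZ : IsModel Z w) (hk : 1 ≤ k) (t : ℂ) :
    ∀ᶠ p in 𝓝 (t, (0 : Space k)),
      (Φ (slice (fun p : ℂ × Space k => P p.2.1 p.2.2.1) (0, e₀ hk, 0, 0) p)).2.1 = p.2.2.1 := by
  set c : ℂ × Space k → ℂ := fun p => P p.2.1 p.2.2.1 with hcdef
  set e : ℂ × Space k := (0, e₀ hk, 0, 0) with hedef
  have hc : IsCoord c e := isCoord_P_snd hk
  have hca (t : ℂ) : c (t, 0) = 0 := by simp [c, P_zero_zero]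
  have hu (z : ℂ) := Set.mem_univ z
  have hsl (t : ℂ) : slice c e (t, 0) = (t, 0) := hc.slice_eq_self (hca t)
  have hξ (t : ℂ) : AnalyticAt ℂ (fun p => (Φ p).2.1) (t, 0) := by
    have := h.analyticAt t; fun_prop
  have hξs (t : ℂ) : AnalyticAt ℂ (fun p => (Φ (slice c e p)).2.1) (t, 0) :=
    (hξ t).fun_comp_of_eq (hc.analyticAt_slice _) (hsl t)
  have hst (t : ℂ) : Tendsto (slice c e) (𝓝 (t, 0)) (𝓝 (t, 0)) := hc.tendsto_slice (hca t)
  have hεs : AnalyticAt ℂ (fun p => (slice c e p).2.1) ((0 : ℂ), (0 : Space k)) := by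
    have := hc.analyticAt_slice ((0 : ℂ), (0 : Space k)); fun_prop
  have hline (p : ℂ × Space k) (s : ℂ) : slice c e (s, p.2) = (s, (slice c e p).2) := by
    simp [slice, c, e]
  -- time derivative along the slice
  have hder : ∀ᶠ p in 𝓝 ((0 : ℂ), (0 : Space k)),
      HasDerivAt (fun s => (Φ (slice c e (s, p.2))).2.1)
        (w (Φ (slice c e p)) * P (slice c e p).2.1 (Φ (slice c e p)).2.1) p.1 := by
    filter_upwards [(hst 0).eventually (h.fderiv_x hZ 0),
      (hst 0).eventually (hξ 0).eventually_analyticAt] with p h1 h2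
    have h3 := hasDerivAt_fst_of_analyticAt h2.differentiableAt
    rw [h1] at h3
    have h4 := h3.congr_of_eventuallyEq (f₁ := fun s => (Φ (slice c e (s, p.2))).2.1)
      (Eventually.of_forall fun s => congrArg (fun v => (Φ v).2.1) (hline p s))
    rwa [show (slice c e p).1 = p.1 from (congrArg Prod.fst (hline p p.1) :)] at h4
  have hinit : ∀ᶠ p in 𝓝 ((0 : ℂ), (0 : Space k)), (Φ (slice c e (0, p.2))).2.1 = p.2.2.1 := by
    have ht : Tendsto (fun p : ℂ × Space k => (slice c e p).2) (𝓝 (0, 0)) (𝓝 0) :=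
      (continuous_snd.tendsto _).comp (hst 0)
    filter_upwards [ht.eventually h.isFlowOn.init] with p hp
    rw [hline, hp]
    simp [slice, e]
  have hδ : ∀ᶠ p in 𝓝 ((0 : ℂ), (0 : Space k)),
      P (slice c e p).2.1 (Φ (slice c e p)).2.1 = 0 := by
    have hsmall : ∀ᶠ p in 𝓝 ((0 : ℂ), (0 : Space k)), ‖p.1 * (divP (slice c e p).2.1
        (Φ (slice c e p)).2.1 (Φ (slice c e p)).2.1 * w (Φ (slice c e p)))‖ < 1 / 2 := by
      have h1 : AnalyticAt ℂ (fun p => w (Φ (slice c e p))) ((0 : ℂ), (0 : Space k)) := by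
        have h2 : AnalyticAt ℂ (fun p => Φ (slice c e p)) ((0 : ℂ), (0 : Space k)) :=
          (h.analyticAt 0).fun_comp_of_eq (hc.analyticAt_slice _) (hsl 0)
        exact hZ.analytic_w.fun_comp_of_eq h2 (by rw [hsl, h.time_zero hZ])
      have h3 : AnalyticAt ℂ (fun p : ℂ × Space k => p.1 * (divP (slice c e p).2.1
        (Φ (slice c e p)).2.1 (Φ (slice c e p)).2.1 * w (Φ (slice c e p)))) (0, 0) :=
        analyticAt_fst.mul ((analyticAt_divP_comp hεs (hξs 0) (hξs 0)).mul h1)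
      refine h3.continuousAt.norm.eventually_lt continuousAt_const ?_
      simp
    -- Along the slice `δ = P_ε(x(t))` starts at `0` and satisfies `δ' = P_ε'(x) w δ`, which is a
    -- Fuchsian inequality after multiplication by the small time `t`. Once `δ = 0`, the coordinate
    -- `x` has zero velocity.
    refine isCoord_fst.eventually_eq_zero_of_fuchs (a := ((0 : ℂ), (0 : Space k))) rfl
      (analyticAt_P_comp hεs (hξs 0)) ?_ ?_
    · filter_upwards [hinit] with p hp
      rw [slice_fst, hp]
      have := hc.coord_slice (0, p.2)
      simpa [slice, c, e] using this
    · filter_upwards [hder, hsmall, (analyticAt_P_comp hεs (hξs 0)).eventually_analyticAt]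
        with p h1 h2 h3
      have h4 := hasDerivAt_fst_of_analyticAt h3.differentiableAt
      have h5 := (hasDerivAt_P (slice c e p).2.1 (Φ (slice c e p)).2.1).comp p.1 h1
      have h6 := h4.unique (h5.congr_of_eventuallyEq (Eventually.of_forall fun s => by
        have h7 := hline p s
        show P (slice c e (s, p.2)).2.1 (Φ (slice c e (s, p.2))).2.1
          = P (slice c e p).2.1 (Φ (slice c e (s, p.2))).2.1
        rw [show (slice c e (s, p.2)).2.1 = (slice c e p).2.1 from
          (congrArg (fun v : ℂ × Space k => v.2.1) h7 :)]))
      rw [h6, smul_eq_mul]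
      calc _ = ‖p.1 * (divP (slice c e p).2.1 (Φ (slice c e p)).2.1 (Φ (slice c e p)).2.1
            * w (Φ (slice c e p)))‖ * ‖P (slice c e p).2.1 (Φ (slice c e p)).2.1‖ := by
            rw [← norm_mul]; congr 1; ring
        _ ≤ _ := by gcongr
  have h0 : ∀ᶠ p in 𝓝 ((0 : ℂ), (0 : Space k)), (Φ (slice c e p)).2.1 - p.2.2.1 = 0 := by
    have h1 := isCoord_fst.eventually_eq_slice (a := ((0 : ℂ), (0 : Space k))) rfl (hξs 0) (by
      filter_upwards [hδ, hder, (hξs 0).eventually_analyticAt] with p h2 h3 h4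
      rw [h2, mul_zero] at h3
      exact (hasDerivAt_fst_of_analyticAt h4.differentiableAt).unique h3)
    filter_upwards [h1, hinit] with p h2 h3
    rw [h2, slice_fst, h3, sub_self]
  have h1 := eventually_eq_zero_of_isPreconnected
    (f := fun p : ℂ × Space k => (Φ (slice c e p)).2.1 - p.2.2.1) isPreconnected_univ
    (fun t _ => (hξs t).sub (by fun_prop)) (hu 0) h0 t (hu t)
  exact h1.mono fun p hp => sub_eq_zero.1 hp

/-- The displacement of the `x`-coordinate under the flow is `P_ε(x) K`, and `K` is a measure of
time. -/
theorem exists_displacement (h : IsParamFlow Z Φ) (hZ : IsModel Z w) (hk : 1 ≤ k) (t₀ : ℂ) :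
    ∃ K : ℂ × Space k → ℂ, AnalyticAt ℂ K (t₀, 0) ∧
      (∀ᶠ p in 𝓝 (t₀, (0 : Space k)), (Φ p).2.1 = p.2.2.1 + P p.2.1 p.2.2.1 * K p) ∧
      K (t₀, 0) = w 0 * t₀ ∧ fderiv ℂ K (t₀, 0) (1, 0) = w 0 := by
  have hc := isCoord_P_snd hk
  have hca (t : ℂ) : P ((t, (0 : Space k)).2.1) ((t, (0 : Space k)).2.2.1) = 0 := by
    simp [P_zero_zero]
  have hξ (t : ℂ) : AnalyticAt ℂ (fun p => (Φ p).2.1) (t, 0) := by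
    have := h.analyticAt t; fun_prop
  have hloc (t₀ : ℂ) : ∃ K : ℂ × Space k → ℂ, AnalyticAt ℂ K (t₀, 0) ∧
      (∀ᶠ p in 𝓝 (t₀, (0 : Space k)), (Φ p).2.1 = p.2.2.1 + P p.2.1 p.2.2.1 * K p) ∧
      fderiv ℂ K (t₀, 0) (1, 0) = w 0 := by
    obtain ⟨K, hK, hK'⟩ := hc.exists_eq_smul (a := (t₀, (0 : Space k))) (hca t₀)
      (f := fun p : ℂ × Space k => (Φ p).2.1 - p.2.2.1) ((hξ t₀).sub (by fun_prop)) (by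
        filter_upwards [h.x_slice hZ hk t₀] with p hp
        rw [hp]
        simp [slice])
    have hK'' : ∀ᶠ p in 𝓝 (t₀, (0 : Space k)), (Φ p).2.1 = p.2.2.1 + P p.2.1 p.2.2.1 * K p := by
      filter_upwards [hK'] with p hp
      rw [smul_eq_mul] at hp
      rw [← hp]; ring
    refine ⟨K, hK, hK'', ?_⟩
    have hw : AnalyticAt ℂ (fun p => w (Φ p)) (t₀, 0) :=
      hZ.analytic_w.fun_comp_of_eq (h.analyticAt t₀) (h.time_zero hZ t₀)
    have hdivP : AnalyticAt ℂ (fun p : ℂ × Space k => divP p.2.1 p.2.2.1 (Φ p).2.1) (t₀, 0) :=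
      analyticAt_divP_comp (by fun_prop) (by fun_prop) (hξ t₀)
    -- With `x(t) = x + P K` one has `P(x(t)) = P (1 + K divP)`, so the equation `x' = w P(x(t))`
    -- may be divided by `P`. At the origin `divP` vanishes and the rate of `K` is exactly `w 0`.
    have hode : ∀ᶠ p in 𝓝 (t₀, (0 : Space k)), fderiv ℂ K p (1, 0)
        = w (Φ p) * (1 + K p * divP p.2.1 p.2.2.1 (Φ p).2.1) := by
      refine hc.eventually_eq (analyticAt_fderiv_apply hK analyticAt_const)
        (hw.mul (analyticAt_const.add (hK.mul hdivP))) ?_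
      filter_upwards [h.fderiv_x hZ t₀, eventually_eventually_nhds.2 hK'', hK.eventually_analyticAt]
        with p h1 h2 h3 hp
      have h2' : (fun p => (Φ p).2.1) =ᶠ[𝓝 p] fun p => p.2.2.1 + P p.2.1 p.2.2.1 * K p := h2
      have h4 : HasDerivAt (fun s : ℂ => p.2.2.1 + P p.2.1 p.2.2.1 * K (s, p.2))
          (P p.2.1 p.2.2.1 * fderiv ℂ K p (1, 0)) p.1 :=
        ((hasDerivAt_fst_of_analyticAt h3.differentiableAt).const_mul _).const_add _
      have h5 : DifferentiableAt ℂ (fun p : ℂ × Space k => p.2.2.1 + P p.2.1 p.2.2.1 * K p) p := by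
        have : AnalyticAt ℂ (fun p : ℂ × Space k => p.2.2.1 + P p.2.1 p.2.2.1 * K p) p := by
          fun_prop
        exact this.differentiableAt
      rw [h2'.fderiv_eq, (hasDerivAt_fst_of_analyticAt h5).unique h4] at h1
      have h6 := P_sub_P p.2.1 p.2.2.1 (Φ p).2.1
      have h7 : (Φ p).2.1 - p.2.2.1 = P p.2.1 p.2.2.1 * K p := by
        rw [h2'.eq_of_nhds]; ring
      rw [h7] at h6
      refine mul_left_cancel₀ hp ?_
      linear_combination h1 + w (Φ p) * h6
    rw [hode.self_of_nhds, h.time_zero hZ]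
    simp [divP_zero hk]
  obtain ⟨K, hK, hK', hKd⟩ := hloc t₀
  refine ⟨K, hK, hK', ?_, hKd⟩
  let v : ℂ × Space k := (0, e₀ hk, 0, 0)
  -- Each `K` is only a germ at one time. Its values on the axis are the `ε₀`-derivatives of the
  -- `x`-component of the flow, because `P` vanishes there with derivative `1` along `ε₀`. This
  -- gives one entire function, with `κ' = w 0` and `κ 0 = 0`.
  let κ : ℂ → ℂ := fun t => fderiv ℂ (fun p => (Φ p).2.1) (t, 0) v
  have hκ (t₀ : ℂ) (K : ℂ × Space k → ℂ) (hK : AnalyticAt ℂ K (t₀, 0))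
      (hK' : ∀ᶠ p in 𝓝 (t₀, (0 : Space k)), (Φ p).2.1 = p.2.2.1 + P p.2.1 p.2.2.1 * K p) :
      κ =ᶠ[𝓝 t₀] fun t => K (t, 0) := by
    have ht : Tendsto (fun t : ℂ => (t, (0 : Space k))) (𝓝 t₀) (𝓝 (t₀, 0)) :=
      tendsto_of_analyticAt (by fun_prop) rfl
    filter_upwards [ht.eventually (eventually_eventually_nhds.2 hK'),
      ht.eventually hK.eventually_analyticAt] with t h1 h2
    have h1' : (fun p => (Φ p).2.1) =ᶠ[𝓝 (t, 0)] fun p => p.2.2.1 + P p.2.1 p.2.2.1 * K p := h1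
    change fderiv ℂ (fun p => (Φ p).2.1) (t, 0) v = K (t, 0)
    have h3 : DifferentiableAt ℂ (fun p : ℂ × Space k => P p.2.1 p.2.2.1) (t, 0) :=
      (hc.analytic _).differentiableAt
    have h4 : HasFDerivAt (fun p : ℂ × Space k => p.2.2.1 + P p.2.1 p.2.2.1 * K p) _ (t, 0) :=
      (hasFDerivAt_snd.snd.fst).add (h3.hasFDerivAt.mul h2.differentiableAt.hasFDerivAt)
    rw [h1'.fderiv_eq, h4.fderiv]
    have h5 := hc.fderiv_apply (t, (0 : Space k))
    simp only [add_apply, smul_apply, smul_eq_mul, ContinuousLinearMap.comp_apply]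
    rw [h5]
    simp [v, P_zero_zero]
  have hκ' (t : ℂ) : HasDerivAt κ (w 0) t := by
    obtain ⟨K, hK, hK', hKd⟩ := hloc t
    have h1 := hasDerivAt_fst_of_analyticAt hK.differentiableAt
    rw [hKd] at h1
    exact h1.congr_of_eventuallyEq (hκ t K hK hK')
  have hκ0 : κ 0 = 0 := by
    have h1 := (hξ 0).differentiableAt.hasFDerivAt
    have hd : HasDerivAt (fun s : ℂ => ((0 : ℂ), (s • e₀ hk, (0 : ℂ), (0 : ℂ)))) v 0 := by
      have h2 : HasDerivAt (fun s : ℂ => s • v) v 0 := by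
        simpa using (hasDerivAt_id (0 : ℂ)).smul_const v
      convert h2 using 2 with s
      simp [v]
    have h3 := HasFDerivAt.comp_hasDerivAt_of_eq (l := fun p => (Φ p).2.1)
      (f := fun s : ℂ => ((0 : ℂ), (s • e₀ hk, (0 : ℂ), (0 : ℂ)))) 0 h1 hd
      (by rw [zero_smul]; rfl)
    have ht : Tendsto (fun s : ℂ => (s • e₀ hk, (0 : ℂ), (0 : ℂ))) (𝓝 0) (𝓝 0) :=
      tendsto_of_analyticAt (by fun_prop) (by simp)
    have h4 : ((fun p => (Φ p).2.1) ∘ fun s : ℂ => ((0 : ℂ), (s • e₀ hk, (0 : ℂ), (0 : ℂ))))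
        =ᶠ[𝓝 0] fun _ => 0 := by
      filter_upwards [ht.eventually h.isFlowOn.init] with s hs
      simp [hs]
    have h5 := h3.unique ((hasDerivAt_const (0 : ℂ) (0 : ℂ)).congr_of_eventuallyEq h4)
    simpa [κ] using h5
  have hconst : κ t₀ - w 0 * t₀ = κ 0 - w 0 * 0 :=
    is_const_of_deriv_eq_zero (f := fun t => κ t - w 0 * t)
      (fun t => ((hκ' t).differentiableAt.sub (by fun_prop)))
      (fun t => by
        have : HasDerivAt (fun t => κ t - w 0 * t) (w 0 - w 0 * 1) t :=
          (hκ' t).sub ((hasDerivAt_id t).const_mul (w 0))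
        rw [this.deriv, mul_one, sub_self]) t₀ 0
  rw [hκ0, (hκ t₀ K hK hK').eq_of_nhds] at hconst
  linear_combination hconst

/-- A flow with nonconstant time that preserves the `x`-coordinate is the identity. -/
theorem time_eq_zero (h : IsParamFlow Z Φ) (hZ : IsModel Z w) (hw : w 0 ≠ 0) (hk : 1 ≤ k)
    {T : Space k → ℂ} (hT : AnalyticAt ℂ T 0) {g : Space k → Space k} (hg : AnalyticAt ℂ g 0)
    (hg0 : g 0 = 0) (hg1 : ∀ q, (g q).1 = q.1) (hg2 : ∀ q, (g q).2.1 = q.2.1)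
    (hfix : ∀ᶠ q in 𝓝 0, (Φ (T q, g q)).2.1 = q.2.1) : ∀ᶠ q in 𝓝 0, T q = 0 := by
  have hpair : AnalyticAt ℂ (fun q => (T q, g q)) 0 := by fun_prop
  have hpair0 : (fun q => (T q, g q)) 0 = (T 0, 0) := by simp [hg0]
  have hKz {K : ℂ × Space k → ℂ} (hK : AnalyticAt ℂ K (T 0, 0))
      (hK' : ∀ᶠ p in 𝓝 (T 0, (0 : Space k)), (Φ p).2.1 = p.2.2.1 + P p.2.1 p.2.2.1 * K p) :
      ∀ᶠ q in 𝓝 0, K (T q, g q) = 0 := by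
    refine (isCoord_P hk).eventually_eq_zero (hK.fun_comp_of_eq hpair hpair0) ?_
    filter_upwards [(tendsto_of_analyticAt hpair hpair0).eventually hK', hfix] with q h1 h2 hq
    rw [h2, hg1, hg2] at h1
    have : P q.1 q.2.1 * K (T q, g q) = 0 := by linear_combination -h1
    exact (mul_eq_zero.1 this).resolve_left hq
  -- Dividing the fixed-point equation by `P` leaves `K = 0`. At the origin this reads `w 0 * T 0 =
  -- 0`, which brings the argument to times near `0`; there `K` is `t` times a unit.
  have hT0 : T 0 = 0 := by
    obtain ⟨K, hK, hK', hK0, -⟩ := h.exists_displacement hZ hk (T 0)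
    have := (hKz hK hK').self_of_nhds
    rw [hg0, hK0] at this
    exact (mul_eq_zero.1 this).resolve_left hw
  obtain ⟨K, hK, hK', -, hKd⟩ := h.exists_displacement hZ hk 0
  have hK0 : ∀ᶠ q in 𝓝 (0 : Space k), K (0, q) = 0 := by
    have h1 : AnalyticAt ℂ (fun q : Space k => ((0 : ℂ), q)) 0 := by fun_prop
    refine (isCoord_P hk).eventually_eq_zero (hK.fun_comp_of_eq h1 rfl) ?_
    filter_upwards [(tendsto_of_analyticAt h1 rfl).eventually hK', h.isFlowOn.init] with q h2 h3 hq
    rw [h3] at h2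
    have : P q.1 q.2.1 * K (0, q) = 0 := by linear_combination -h2
    exact (mul_eq_zero.1 this).resolve_left hq
  obtain ⟨K₁, hK₁, hKK⟩ := isCoord_fst.exists_eq_smul (a := ((0 : ℂ), (0 : Space k))) rfl hK (by
    have hs : Tendsto (fun p : ℂ × Space k => p.2) (𝓝 (0, 0)) (𝓝 0) :=
      continuous_snd.tendsto ((0 : ℂ), (0 : Space k))
    filter_upwards [hs.eventually hK0] with p hp
    rw [slice_fst, hp])
  have hK₁0 : K₁ (0, 0) ≠ 0 := by
    have h1 : HasFDerivAt (fun p : ℂ × Space k => p.1 • K₁ p) _ (0, 0) :=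
      hasFDerivAt_fst.smul hK₁.differentiableAt.hasFDerivAt
    rw [hKK.fderiv_eq, h1.fderiv] at hKd
    have : K₁ (0, 0) = w 0 := by simpa using hKd
    rwa [this]
  rw [hT0] at hKz hpair0
  have hpt := tendsto_of_analyticAt hpair hpair0
  filter_upwards [hKz hK hK', hpt.eventually hKK,
    hpt.eventually (hK₁.continuousAt.eventually_ne hK₁0)] with q h1 h2 h3
  rw [h1] at h2
  exact (mul_eq_zero.1 h2.symm).resolve_right h3

end IsParamFlow

end FlowX

/-! ### Rescalings, sections and the factors of a normal form -/

variable {k : ℕ}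

/-- The linear change of variables `(ε, x, y) ↦ (ε, x, c_ε y)`. -/
def scale (c : Param k → ℂ) (q : Space k) : Space k := (q.1, q.2.1, c q.1 * q.2.2)

theorem analyticAt_scale {c : Param k → ℂ} (hc : AnalyticAt ℂ c 0) :
    AnalyticAt ℂ (scale c) 0 := by
  have : AnalyticAt ℂ (fun q : Space k => c q.1) 0 := hc.fun_comp_of_eq analyticAt_fst rfl
  unfold scale; fun_prop

theorem scale_zero (c : Param k → ℂ) : scale c 0 = 0 := by simp [scale]

theorem tendsto_scale {c : Param k → ℂ} (hc : AnalyticAt ℂ c 0) :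
    Tendsto (scale c) (𝓝 0) (𝓝 0) := tendsto_of_analyticAt (analyticAt_scale hc) (scale_zero c)

theorem IsUnitGerm.inv {c : Param k → ℂ} (hc : IsUnitGerm c) : IsUnitGerm (fun ε => (c ε)⁻¹) :=
  ⟨hc.1.inv hc.2, inv_ne_zero hc.2⟩

theorem tendsto_fst_space : Tendsto (fun q : Space k => q.1) (𝓝 0) (𝓝 0) :=
  continuous_fst.tendsto (0 : Space k)

theorem tendsto_xy : Tendsto (fun q : Space k => (q.1, q.2.1)) (𝓝 0) (𝓝 0) :=
  tendsto_of_analyticAt (by fun_prop) rfl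

theorem tendsto_section : Tendsto (fun p : Param k × ℂ => ((p.1, p.2, 0) : Space k)) (𝓝 0) (𝓝 0) :=
  tendsto_of_analyticAt (by fun_prop) rfl

theorem tendsto_slice_y : Tendsto (fun q : Space k => ((q.1, q.2.1, 0) : Space k)) (𝓝 0) (𝓝 0) :=
  tendsto_of_analyticAt (by fun_prop) rfl

theorem IsUnitGerm.eventually_ne {c : Param k → ℂ} (hc : IsUnitGerm c) :
    ∀ᶠ q : Space k in 𝓝 0, c q.1 ≠ 0 :=
  tendsto_fst_space.eventually (hc.1.continuousAt.eventually_ne hc.2)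

theorem IsUnitGerm.scale_inv {c : Param k → ℂ} (hc : IsUnitGerm c) :
    ∀ᶠ q : Space k in 𝓝 0, scale c (scale (fun ε => (c ε)⁻¹) q) = q := by
  filter_upwards [hc.eventually_ne] with q hq
  simp [scale, hq]

theorem IsUnitGerm.inv_scale {c : Param k → ℂ} (hc : IsUnitGerm c) :
    ∀ᶠ q : Space k in 𝓝 0, scale (fun ε => (c ε)⁻¹) (scale c q) = q := by
  filter_upwards [hc.eventually_ne] with q hq
  simp [scale, hq]

/-- Two germs that agree after a linear change of variables agree. -/
theorem IsUnitGerm.eventually_of_scale {c : Param k → ℂ} (hc : IsUnitGerm c) {p : Space k → Prop}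
    (h : ∀ᶠ q in 𝓝 0, p (scale c q)) : ∀ᶠ q in 𝓝 0, p q := by
  filter_upwards [(tendsto_scale hc.inv.1).eventually h, hc.scale_inv] with q h1 h2
  rwa [h2] at h1

section Sections

variable {τ : ℕ} {f g : Space k → ℂ}

theorem IsSection.exists_eq_mul (hf : IsSection τ f) :
    ∃ r, AnalyticAt ℂ r 0 ∧ f =ᶠ[𝓝 0] fun q => q.2.2 * r q := by
  obtain ⟨g, hg, hfg⟩ := hf
  have h1 (j : Fin k) : AnalyticAt ℂ (fun q : Space k => g j (q.1, twist τ q)) 0 :=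
    (hg j).fun_comp_of_eq (f := fun q : Space k => (q.1, twist τ q))
      (analyticAt_fst.prod (analyticAt_twist τ 0)) (by simp [twist_zero])
  refine ⟨fun q => P q.1 q.2.1 ^ τ * ∑ j, g j (q.1, twist τ q) * q.2.1 ^ ((j : ℕ) + 1), ?_, ?_⟩
  · have h2 : AnalyticAt ℂ (fun q : Space k => ∑ j, g j (q.1, twist τ q) * q.2.1 ^ ((j : ℕ) + 1)) 0 :=
      Finset.analyticAt_fun_sum _ fun j _ => (h1 j).fun_mul (by fun_prop)
    fun_prop
  · filter_upwards [hfg] with q hq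
    rw [hq, twist]; ring

theorem IsSection.analyticAt (hf : IsSection τ f) : AnalyticAt ℂ f 0 := by
  obtain ⟨r, hr, hfr⟩ := hf.exists_eq_mul
  have : AnalyticAt ℂ (fun q : Space k => q.2.2 * r q) 0 := by fun_prop
  exact this.congr hfr.symm

theorem IsSection.eventually_eq_zero (hf : IsSection τ f) :
    ∀ᶠ q : Space k in 𝓝 0, f (q.1, q.2.1, 0) = 0 := by
  obtain ⟨r, -, hfr⟩ := hf.exists_eq_mul
  filter_upwards [tendsto_slice_y.eventually hfr] with q hq
  simpa using hq

theorem IsSection.zero (hf : IsSection τ f) : f 0 = 0 := hf.eventually_eq_zero.self_of_nhds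

theorem IsSection.sub (hf : IsSection τ f) (hg : IsSection τ g) :
    IsSection τ (fun q => f q - g q) := by
  obtain ⟨a, ha, hfa⟩ := hf
  obtain ⟨b, hb, hgb⟩ := hg
  refine ⟨fun j p => a j p - b j p, fun j => (ha j).sub (hb j), ?_⟩
  filter_upwards [hfa, hgb] with q h1 h2
  rw [h1, h2, ← mul_sub, ← Finset.sum_sub_distrib]
  simp only [sub_mul]

theorem IsSection.rescale (hf : IsSection τ f) {c : Param k → ℂ} (hc : AnalyticAt ℂ c 0) :
    IsSection τ (rescale c f) := by
  obtain ⟨g, hg, hfg⟩ := hf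
  have hc' : AnalyticAt ℂ (fun p : Param k × ℂ => c p.1) 0 := hc.fun_comp_of_eq analyticAt_fst rfl
  refine ⟨fun j p => c p.1 * g j (p.1, c p.1 * p.2), fun j => hc'.fun_mul ?_, ?_⟩
  · exact (hg j).fun_comp_of_eq (f := fun p : Param k × ℂ => (p.1, c p.1 * p.2))
      (by fun_prop) (by simp)
  · filter_upwards [(tendsto_scale hc).eventually hfg] with q hq
    change f (scale c q) = _
    have h1 : twist τ (scale c q) = c q.1 * twist τ q := by simp only [twist, scale]; ring
    rw [hq, h1, mul_assoc, Finset.mul_sum, Finset.mul_sum, Finset.mul_sum]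
    refine Finset.sum_congr rfl fun j _ => ?_
    simp only [scale]
    ring

end Sections

theorem IsPolyUnit.analyticAt {u : Param k × ℂ → ℂ} (hu : IsPolyUnit u) : AnalyticAt ℂ u 0 := by
  obtain ⟨⟨a, ha, hua⟩, -⟩ := hu
  refine AnalyticAt.congr ?_ hua.symm
  exact Finset.analyticAt_fun_sum _ fun j _ =>
    ((ha j).fun_comp_of_eq analyticAt_fst rfl).fun_mul (by fun_prop)

namespace Invariant

/-- The coefficient `1 + μ x^k + R` of the orbital normal form. -/
def speed (n : Invariant k) (q : Space k) : ℂ := 1 + n.μ q.1 * q.2.1 ^ k + n.R q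

/-- The quotient `u / (1 + u Q)` of a normal form by its orbital normal form. -/
noncomputable def factor (n : Invariant k) (q : Space k) : ℂ :=
  n.u (q.1, q.2.1) / (1 + n.u (q.1, q.2.1) * n.Q q)

theorem orbitalForm_eq (n : Invariant k) (q : Space k) :
    n.orbitalForm q = (P q.1 q.2.1, q.2.2 * n.speed q) := by
  simp only [orbitalForm, speed]
  congr 1; ring

theorem form_eq (n : Invariant k) (q : Space k) : n.form q = n.factor q • n.orbitalForm q := rfl

namespace IsNormal

variable {n : Invariant k} {τ : ℕ}

theorem analyticAt_speed (hn : n.IsNormal τ) : AnalyticAt ℂ n.speed 0 := by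
  have h1 : AnalyticAt ℂ (fun q : Space k => n.μ q.1) 0 :=
    hn.analytic_μ.fun_comp_of_eq analyticAt_fst rfl
  have h2 := hn.section_R.analyticAt
  unfold speed; fun_prop

theorem speed_zero (hn : n.IsNormal τ) (hk : 1 ≤ k) : n.speed 0 = 1 := by
  have : k ≠ 0 := by omega
  simp [speed, hn.section_R.zero, this]

theorem analyticAt_orbitalForm (hn : n.IsNormal τ) : AnalyticAt ℂ n.orbitalForm 0 := by
  have h := hn.analyticAt_speed
  rw [funext n.orbitalForm_eq]
  fun_prop

theorem orbitalForm_zero : n.orbitalForm 0 = 0 := by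
  simp [orbitalForm, P_zero_zero]

theorem analyticAt_u (hn : n.IsNormal τ) : AnalyticAt ℂ (fun q : Space k => n.u (q.1, q.2.1)) 0 :=
  hn.poly_u.analyticAt.fun_comp_of_eq (f := fun q : Space k => (q.1, q.2.1)) (by fun_prop) rfl

theorem eventually_u_ne (hn : n.IsNormal τ) : ∀ᶠ q : Space k in 𝓝 0, n.u (q.1, q.2.1) ≠ 0 :=
  hn.analyticAt_u.continuousAt.eventually_ne hn.poly_u.2

theorem eventually_denom_ne (hn : n.IsNormal τ) :
    ∀ᶠ q : Space k in 𝓝 0, 1 + n.u (q.1, q.2.1) * n.Q q ≠ 0 := by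
  have h1 := hn.analyticAt_u
  have h2 := hn.section_Q.analyticAt
  have h3 : AnalyticAt ℂ (fun q : Space k => 1 + n.u (q.1, q.2.1) * n.Q q) 0 := by fun_prop
  exact h3.continuousAt.eventually_ne (by simp [hn.section_Q.zero])

theorem analyticAt_factor (hn : n.IsNormal τ) : AnalyticAt ℂ n.factor 0 := by
  have h1 := hn.analyticAt_u
  have h2 := hn.section_Q.analyticAt
  exact h1.div (by fun_prop) hn.eventually_denom_ne.self_of_nhds

theorem eventually_factor_ne (hn : n.IsNormal τ) : ∀ᶠ q : Space k in 𝓝 0, n.factor q ≠ 0 := by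
  filter_upwards [hn.eventually_u_ne, hn.eventually_denom_ne] with q h1 h2
  exact div_ne_zero h1 h2

theorem factor_zero_ne (hn : n.IsNormal τ) : n.factor 0 ≠ 0 :=
  hn.eventually_factor_ne.self_of_nhds

theorem isModel (hn : n.IsNormal τ) : IsModel n.form n.factor where
  analytic := hn.analyticAt_factor.fun_smul hn.analyticAt_orbitalForm
  zero := by rw [form_eq, orbitalForm_zero, smul_zero]
  analytic_w := hn.analyticAt_factor
  fst_eq := Eventually.of_forall fun q => rfl

theorem exists_isParamFlow (hn : n.IsNormal τ) : ∃ Φ, IsParamFlow n.form Φ := by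
  obtain ⟨Φ, hΦ⟩ := exists_isFlowOn_univ (analyticAt_lift hn.isModel.analytic) hn.isModel.lift_zero
  exact ⟨Φ, hΦ.isParamFlow⟩

end IsNormal

end Invariant

/-- The ring of germs of analytic functions is an integral domain. -/
theorem eventually_eq_zero_of_mul {E : Type*} [NormedAddCommGroup E] [NormedSpace ℂ E]
    {f d : E → ℂ} {a : E} (hf : AnalyticAt ℂ f a) (h : ∀ᶠ q in 𝓝 a, f q * d q = 0)
    (hd : ∀ᶠ q in 𝓝 a, ContinuousAt d q) (hne : ∃ᶠ q in 𝓝 a, d q ≠ 0) :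
    ∀ᶠ q in 𝓝 a, f q = 0 := by
  obtain ⟨r, hr, hr'⟩ := Metric.eventually_nhds_iff_ball.1
    (hf.eventually_analyticAt.and (hd.and (eventually_eventually_nhds.2 h)))
  obtain ⟨p, hp, hpr⟩ := (hne.and_eventually (Metric.ball_mem_nhds a hr)).exists
  have h1 : f =ᶠ[𝓝 p] 0 := by
    filter_upwards [(hr' p hpr).2.1.eventually_ne hp, (hr' p hpr).2.2] with q h2 h3
    exact (mul_eq_zero.1 h3).resolve_right h2
  have h2 := AnalyticOnNhd.eqOn_zero_of_preconnected_of_eventuallyEq_zero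
    (fun q hq => (hr' q hq).1) (convex_ball a r).isPreconnected hpr h1
  exact eventually_of_mem (Metric.ball_mem_nhds a hr) h2

/-! ### The linear part of an orbital conjugacy -/

section Derivatives

variable {k : ℕ} {E : Type*} [NormedAddCommGroup E] [NormedSpace ℂ E]

theorem P_apply_zero (hk : 1 ≤ k) (ε : Param k) : P ε 0 = ε ⟨0, hk⟩ := by
  simp only [P, ne_eq, Nat.add_eq_zero_iff, one_ne_zero, and_false, not_false_eq_true, zero_pow,
    zero_add]
  rw [Finset.sum_eq_single ⟨0, hk⟩]
  · simp
  · intro j _ hj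
    have : (j : ℕ) ≠ 0 := fun h => hj (Fin.ext h)
    simp [this]
  · simp

/-- In `P ε x = ε₀ + x * divP ε 0 x` the product vanishes to second order at the origin, so only
`ε₀` contributes to the differential. -/
theorem fderiv_P_comp (hk : 1 ≤ k) {ε : E → Param k} {x : E → ℂ} {a : E} (hε : AnalyticAt ℂ ε a)
    (hx : AnalyticAt ℂ x a) (hε0 : ε a = 0) (hx0 : x a = 0) (v : E) :
    fderiv ℂ (fun q => P (ε q) (x q)) a v = fderiv ℂ ε a v ⟨0, hk⟩ := by
  have h1 : (fun q => P (ε q) (x q)) = fun q => ε q ⟨0, hk⟩ + x q * divP (ε q) 0 (x q) := by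
    funext q
    have := P_sub_P (ε q) 0 (x q)
    rw [P_apply_zero hk] at this
    linear_combination this
  have h2 : AnalyticAt ℂ (fun q => divP (ε q) 0 (x q)) a :=
    analyticAt_divP_comp hε analyticAt_const hx
  have h3 : HasFDerivAt (fun q => ε q ⟨0, hk⟩ + x q * divP (ε q) 0 (x q)) _ a :=
    (hasFDerivAt_pi'.1 hε.differentiableAt.hasFDerivAt ⟨0, hk⟩).add
      (hx.differentiableAt.hasFDerivAt.mul h2.differentiableAt.hasFDerivAt)
  rw [h1, h3.fderiv]
  simp [hε0, hx0, divP_zero hk]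

theorem fderiv_P_comp_fst (hk : 1 ≤ k) {x : Space k → ℂ} (hx : AnalyticAt ℂ x 0) (hx0 : x 0 = 0)
    (v : Space k) : fderiv ℂ (fun q : Space k => P q.1 (x q)) 0 v = v.1 ⟨0, hk⟩ := by
  rw [fderiv_P_comp hk analyticAt_fst hx rfl hx0,
    (hasFDerivAt_fst (𝕜 := ℂ) (p := (0 : Space k)) :
      HasFDerivAt (fun q : Space k => q.1) _ 0).fderiv]
  rfl

theorem fderiv_mul_of_eq_zero {f g : E → ℂ} {a : E} (hf : DifferentiableAt ℂ f a)
    (hg : DifferentiableAt ℂ g a) (h0 : g a = 0) (v : E) :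
    fderiv ℂ (fun q => f q * g q) a v = f a * fderiv ℂ g a v := by
  have : HasFDerivAt (fun q => f q * g q) _ a := hf.hasFDerivAt.mul hg.hasFDerivAt
  rw [this.fderiv]
  simp [h0]

end Derivatives

section ChangeOfVariables

variable {k τ : ℕ} {n n' : Invariant k} {Ψ : Space k → ℂ × ℂ} {V : Space k → ℂ}

/-- The map `(ε, x, y) ↦ (ε, Ψ_ε(x, y))`. -/
def withParam (Ψ : Space k → ℂ × ℂ) (q : Space k) : Space k := (q.1, Ψ q)

theorem analyticAt_withParam (hΨ : AnalyticAt ℂ Ψ 0) : AnalyticAt ℂ (withParam Ψ) 0 := by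
  unfold withParam; fun_prop

theorem withParam_zero (h0 : Ψ 0 = 0) : withParam Ψ 0 = 0 := by simp [withParam, h0]

theorem hasFDerivAt_fibre {q : Space k} {F : Type*} [NormedAddCommGroup F] [NormedSpace ℂ F]
    {Ψ : Space k → F} (h : DifferentiableAt ℂ Ψ q) :
    HasFDerivAt (fun p : ℂ × ℂ => Ψ (q.1, p))
      ((fderiv ℂ Ψ q).comp ((0 : ℂ × ℂ →L[ℂ] Param k).prod (ContinuousLinearMap.id ℂ _))) q.2 :=
  HasFDerivAt.comp (g := Ψ) q.2 h.hasFDerivAt ((hasFDerivAt_const _ _).prodMk (hasFDerivAt_id _))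

theorem fderiv_fibre {q : Space k} {F : Type*} [NormedAddCommGroup F] [NormedSpace ℂ F]
    {Ψ : Space k → F} (h : DifferentiableAt ℂ Ψ q) (v : ℂ × ℂ) :
    fderiv ℂ (fun p : ℂ × ℂ => Ψ (q.1, p)) q.2 v = fderiv ℂ Ψ q (0, v) := by
  rw [(hasFDerivAt_fibre h).fderiv]; rfl

/-- `Ψ` is an orbital equivalence of orbital normal forms: `DΨ(X') = V X ∘ Ψ`. -/
structure IsOrbitalConjugacy (n n' : Invariant k) (Ψ : Space k → ℂ × ℂ) (V : Space k → ℂ) :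
    Prop where
  analytic : AnalyticAt ℂ Ψ 0
  zero : Ψ 0 = 0
  analytic_V : AnalyticAt ℂ V 0
  V_ne : V 0 ≠ 0
  fderiv_ne : ∀ v : ℂ × ℂ, fderiv ℂ Ψ 0 (0, v) = 0 → v = 0
  eq : ∀ᶠ q in 𝓝 0, fderiv ℂ Ψ q (0, n'.orbitalForm q) = V q • n.orbitalForm (q.1, Ψ q)

namespace IsOrbitalConjugacy

theorem eq_fst (h : IsOrbitalConjugacy n n' Ψ V) : ∀ᶠ q in 𝓝 0,
    P q.1 q.2.1 * fderiv ℂ (fun q => (Ψ q).1) q (0, 1, 0)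
      + q.2.2 * n'.speed q * fderiv ℂ (fun q => (Ψ q).1) q (0, 0, 1) = V q * P q.1 (Ψ q).1 := by
  filter_upwards [h.eq, h.analytic.eventually_analyticAt] with q h1 h2
  have h3 : HasFDerivAt (fun q => (Ψ q).1) _ q := h2.differentiableAt.hasFDerivAt.fst
  rw [← fderiv_space_apply, ← n'.orbitalForm_eq, h3.fderiv, ContinuousLinearMap.comp_apply, h1]
  rfl

theorem eq_snd (h : IsOrbitalConjugacy n n' Ψ V) : ∀ᶠ q in 𝓝 0,
    P q.1 q.2.1 * fderiv ℂ (fun q => (Ψ q).2) q (0, 1, 0)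
      + q.2.2 * n'.speed q * fderiv ℂ (fun q => (Ψ q).2) q (0, 0, 1)
      = V q * n.speed (withParam Ψ q) * (Ψ q).2 := by
  filter_upwards [h.eq, h.analytic.eventually_analyticAt] with q h1 h2
  have h3 : HasFDerivAt (fun q => (Ψ q).2) _ q := h2.differentiableAt.hasFDerivAt.snd
  rw [← fderiv_space_apply, ← n'.orbitalForm_eq, h3.fderiv, ContinuousLinearMap.comp_apply, h1,
    n.orbitalForm_eq]
  simp only [ContinuousLinearMap.coe_snd', Prod.smul_snd, smul_eq_mul, withParam]
  ring

theorem analyticAt_fst (h : IsOrbitalConjugacy n n' Ψ V) : AnalyticAt ℂ (fun q => (Ψ q).1) 0 := by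
  have := h.analytic; fun_prop

theorem analyticAt_snd (h : IsOrbitalConjugacy n n' Ψ V) : AnalyticAt ℂ (fun q => (Ψ q).2) 0 := by
  have := h.analytic; fun_prop

/-- Both components `P` and `y * speed` vanish at the origin with differentials `dε₀` and `dy`, so
only first derivatives of `f` survive. -/
theorem fderiv_lhs (hn' : n'.IsNormal τ) (hk : 1 ≤ k) {f : Space k → ℂ} (hf : AnalyticAt ℂ f 0)
    (v : Space k) :
    fderiv ℂ (fun q : Space k => P q.1 q.2.1 * fderiv ℂ f q (0, 1, 0)
      + q.2.2 * n'.speed q * fderiv ℂ f q (0, 0, 1)) 0 v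
      = v.1 ⟨0, hk⟩ * fderiv ℂ f 0 (0, 1, 0) + v.2.2 * fderiv ℂ f 0 (0, 0, 1) := by
  have hs := hn'.analyticAt_speed
  have h1 : AnalyticAt ℂ (fun q : Space k => fderiv ℂ f q (0, 1, 0)) 0 := by fun_prop
  have h2 : AnalyticAt ℂ (fun q : Space k => n'.speed q * fderiv ℂ f q (0, 0, 1)) 0 := by fun_prop
  have h3 : AnalyticAt ℂ (fun q : Space k => P q.1 q.2.1) 0 := by fun_prop
  have h4 : AnalyticAt ℂ (fun q : Space k => q.2.2) 0 := by fun_prop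
  have e : (fun q : Space k => P q.1 q.2.1 * fderiv ℂ f q (0, 1, 0)
      + q.2.2 * n'.speed q * fderiv ℂ f q (0, 0, 1)) = fun q => fderiv ℂ f q (0, 1, 0) * P q.1 q.2.1
        + n'.speed q * fderiv ℂ f q (0, 0, 1) * q.2.2 := by
    funext q; ring
  have hadd : HasFDerivAt (fun q : Space k => fderiv ℂ f q (0, 1, 0) * P q.1 q.2.1
        + n'.speed q * fderiv ℂ f q (0, 0, 1) * q.2.2) _ 0 := (h1.fun_mul h3).differentiableAt.hasFDerivAt.add
    (h2.fun_mul h4).differentiableAt.hasFDerivAt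
  rw [e, hadd.fderiv, add_apply,
    fderiv_mul_of_eq_zero h1.differentiableAt h3.differentiableAt (by simp [P_zero_zero]),
    fderiv_mul_of_eq_zero h2.differentiableAt h4.differentiableAt (by simp),
    fderiv_P_comp_fst hk (by fun_prop) rfl, hn'.speed_zero hk]
  have h5 : HasFDerivAt (𝕜 := ℂ) (fun q : Space k => q.2.2) _ 0 := hasFDerivAt_snd.snd
  rw [h5.fderiv]
  simp
  ring

theorem fderiv_fst (h : IsOrbitalConjugacy n n' Ψ V) (hn' : n'.IsNormal τ) (hk : 1 ≤ k)
    (v : Space k) : v.1 ⟨0, hk⟩ * fderiv ℂ (fun q => (Ψ q).1) 0 (0, 1, 0)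
      + v.2.2 * fderiv ℂ (fun q => (Ψ q).1) 0 (0, 0, 1) = V 0 * v.1 ⟨0, hk⟩ := by
  have h1 : AnalyticAt ℂ (fun q : Space k => P q.1 (Ψ q).1) 0 :=
    analyticAt_P_comp (by fun_prop) h.analyticAt_fst
  have h2 := EventuallyEq.fderiv_eq (𝕜 := ℂ) h.eq_fst
  rw [← fderiv_lhs hn' hk h.analyticAt_fst, h2,
    fderiv_mul_of_eq_zero h.analytic_V.differentiableAt h1.differentiableAt
      (by simp [h.zero, P_zero_zero]),
    fderiv_P_comp_fst hk h.analyticAt_fst (by simp [h.zero])]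

theorem fderiv_snd (h : IsOrbitalConjugacy n n' Ψ V) (hn : n.IsNormal τ) (hn' : n'.IsNormal τ)
    (hk : 1 ≤ k) (v : Space k) : v.1 ⟨0, hk⟩ * fderiv ℂ (fun q => (Ψ q).2) 0 (0, 1, 0)
      + v.2.2 * fderiv ℂ (fun q => (Ψ q).2) 0 (0, 0, 1)
      = V 0 * fderiv ℂ (fun q => (Ψ q).2) 0 v := by
  have h1 : AnalyticAt ℂ (fun q : Space k => V q * n.speed (withParam Ψ q)) 0 :=
    h.analytic_V.fun_mul (hn.analyticAt_speed.fun_comp_of_eq (analyticAt_withParam h.analytic)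
      (withParam_zero h.zero))
  have h2 := EventuallyEq.fderiv_eq (𝕜 := ℂ) h.eq_snd
  rw [← fderiv_lhs hn' hk h.analyticAt_snd, h2,
    fderiv_mul_of_eq_zero h1.differentiableAt h.analyticAt_snd.differentiableAt (by simp [h.zero]),
    withParam_zero h.zero, hn.speed_zero hk, mul_one]

theorem fderiv_fst_y (h : IsOrbitalConjugacy n n' Ψ V) (hn' : n'.IsNormal τ) (hk : 1 ≤ k) :
    fderiv ℂ (fun q => (Ψ q).1) 0 (0, 0, 1) = 0 := by
  simpa using h.fderiv_fst hn' hk (0, 0, 1)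

/-- The first component has no `y`-derivative at the origin, so invertibility of the linear part
rests on the second component. -/
theorem fderiv_snd_y_ne (h : IsOrbitalConjugacy n n' Ψ V) (hn' : n'.IsNormal τ) (hk : 1 ≤ k) :
    fderiv ℂ (fun q => (Ψ q).2) 0 (0, 0, 1) ≠ 0 := by
  intro h0
  have h1 := h.analytic.differentiableAt.hasFDerivAt
  have h2 : fderiv ℂ Ψ 0 (0, 0, 1) = 0 := by
    refine Prod.ext ?_ ?_
    · have h3 := h.fderiv_fst_y hn' hk
      rw [(show HasFDerivAt (fun q => (Ψ q).1) _ 0 from h1.fst).fderiv] at h3; exact h3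
    · rw [(show HasFDerivAt (fun q => (Ψ q).2) _ 0 from h1.snd).fderiv] at h0; exact h0
  simpa using h.fderiv_ne _ h2

/-- Both orbital fields have eigenvalue `1` in the direction `y`. The `dy` terms of the second
component give `∂Ψ₂/∂y = V 0 * ∂Ψ₂/∂y` with a nonzero factor. -/
theorem V_zero (h : IsOrbitalConjugacy n n' Ψ V) (hn : n.IsNormal τ) (hn' : n'.IsNormal τ)
    (hk : 1 ≤ k) : V 0 = 1 := by
  have := h.fderiv_snd hn hn' hk (0, 0, 1)
  simpa [h.fderiv_snd_y_ne hn' hk] using this.symm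

/-- In the first component the `dε₀` terms read `∂Ψ₁/∂x = V 0`. This excludes, for instance,
rotations of `x` by `k`-th roots of unity. -/
theorem fderiv_fst_x (h : IsOrbitalConjugacy n n' Ψ V) (hn : n.IsNormal τ) (hn' : n'.IsNormal τ)
    (hk : 1 ≤ k) : fderiv ℂ (fun q => (Ψ q).1) 0 (0, 1, 0) = 1 := by
  simpa [h.V_zero hn hn' hk, e₀] using h.fderiv_fst hn' hk (e₀ hk, 0, 0)

end IsOrbitalConjugacy

end ChangeOfVariables

/-! ### Reduction of an orbital conjugacy to a fibered one -/

variable {k τ : ℕ} {n n' : Invariant k} {Ψ : Space k → ℂ × ℂ} {V : Space k → ℂ}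

theorem divP_smul (hk : 1 ≤ k) (s a b : ℂ) : divP (s • e₀ hk) a b
    = ∑ i ∈ Finset.range (k + 1), b ^ i * a ^ (k + 1 - 1 - i) := by
  rw [divP, add_eq_left]
  refine Finset.sum_eq_zero fun j _ => ?_
  by_cases hj : j = ⟨0, hk⟩
  · simp [hj]
  · simp [e₀, hj]

/-- The retraction of the space of variables onto `{P_ε(x) = 0}` along `ε₀`. -/
noncomputable def retract (hk : 1 ≤ k) : Space k → Space k :=
  slice (fun q : Space k => P q.1 q.2.1) (e₀ hk, 0, 0)

theorem retract_eq (hk : 1 ≤ k) (q : Space k) :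
    retract hk q = (q.1 - P q.1 q.2.1 • e₀ hk, q.2.1, q.2.2) := by
  ext <;> simp [retract, slice]

theorem analyticAt_retract (hk : 1 ≤ k) (q : Space k) : AnalyticAt ℂ (retract hk) q :=
  (isCoord_P hk).analyticAt_slice q

theorem retract_zero (hk : 1 ≤ k) : retract hk 0 = 0 := by simp [retract_eq, P_zero_zero]

theorem tendsto_retract (hk : 1 ≤ k) : Tendsto (retract hk) (𝓝 0) (𝓝 0) :=
  tendsto_of_analyticAt (analyticAt_retract hk 0) (retract_zero hk)

theorem P_retract (hk : 1 ≤ k) (q : Space k) : P (retract hk q).1 q.2.1 = 0 := by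
  have h := (isCoord_P hk).coord_slice q
  simpa [slice, retract_eq] using h

/-- A germ `ξ` tangent to `x` to first order that maps into `{P = 0}` over `{P = 0}` equals `x`
there. -/
theorem eq_x_of_P_eq_zero (hk : 1 ≤ k) {ξ : Space k → ℂ} (hξ : AnalyticAt ℂ ξ 0) (h0 : ξ 0 = 0)
    (hd : fderiv ℂ ξ 0 (0, 1, 0) = 1)
    (h : ∀ᶠ q in 𝓝 0, P (retract hk q).1 (ξ (retract hk q)) = 0) :
    ∀ᶠ q in 𝓝 0, ξ (retract hk q) = q.2.1 := by
  have hρ := analyticAt_retract hk 0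
  have hξρ : AnalyticAt ℂ (fun q => ξ (retract hk q)) 0 := hξ.fun_comp_of_eq hρ (retract_zero hk)
  have hdiv : AnalyticAt ℂ (fun q => divP (retract hk q).1 q.2.1 (ξ (retract hk q))) 0 :=
    analyticAt_divP_comp (by fun_prop) (by fun_prop) hξρ
  -- On `{P = 0}` the product `(ξ - x) * divP ε x ξ` vanishes. Germs form an integral domain, so it
  -- suffices that the second factor is not the zero germ.
  refine (eventually_eq_zero_of_mul (d := fun q => divP (retract hk q).1 q.2.1 (ξ (retract hk q)))
    (f := fun q => ξ (retract hk q) - q.2.1) (hξρ.sub (by fun_prop)) ?_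
    (eventually_continuousAt_of_analyticAt hdiv) ?_).mono fun q hq => sub_eq_zero.1 hq
  · filter_upwards [h] with q hq
    rw [← P_sub_P, hq, P_retract, sub_zero]
  intro hcon
  push Not at hcon
  -- On this curve in `{P = 0}` only `ε₀ = -x ^ (k + 1)` is nonzero. There `ξ = x g` with `g 0 = 1`,
  -- and `divP` is `x ^ k` times a sum whose value at `0` is `k + 1`.
  let γ : ℂ → Space k := fun x => retract hk (0, x, 0)
  have hγ (x : ℂ) : γ x = ((-x ^ (k + 1)) • e₀ hk, x, 0) := by simp [γ, retract_eq, P_zero_left]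
  have hγ0 : γ 0 = 0 := by simp [hγ]
  have hγd : HasDerivAt γ (0, 1, 0) 0 := by
    rw [funext hγ]
    have h1 := ((hasDerivAt_id (0 : ℂ)).pow (k + 1)).neg.smul_const (e₀ hk)
    have h2 := h1.prodMk ((hasDerivAt_id (0 : ℂ)).prodMk (hasDerivAt_const (0 : ℂ) (0 : ℂ)))
    have hk' : k ≠ 0 := by omega
    refine h2.congr_deriv ?_
    simp [hk']
  have hι : AnalyticAt ℂ (fun x : ℂ => ((0, x, 0) : Space k)) 0 := by fun_prop
  have hm : AnalyticAt ℂ (fun x => ξ (γ x)) 0 :=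
    hξ.fun_comp_of_eq ((analyticAt_retract hk _).fun_comp hι) hγ0
  have hmd : HasDerivAt (fun x => ξ (γ x)) 1 0 := by
    have := hξ.differentiableAt.hasFDerivAt.comp_hasDerivAt_of_eq 0 hγd hγ0.symm
    rwa [hd] at this
  obtain ⟨g, hg, hmg⟩ := isCoord_id.exists_eq_smul rfl hm
    (Eventually.of_forall fun x => by simp [slice, hγ0, h0])
  have hg0 : g 0 = 1 := by
    have h1 := (hasDerivAt_id (0 : ℂ)).smul hg.differentiableAt.hasDerivAt
    have h2 := hmd.unique (h1.congr_of_eventuallyEq hmg)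
    simpa using h2.symm
  have hsum : ∀ᶠ x in 𝓝 (0 : ℂ), ∑ i ∈ Finset.range (k + 1), g x ^ i = 0 := by
    refine isCoord_id.eventually_eq_zero
      (Finset.analyticAt_fun_sum _ fun i _ => by fun_prop) ?_
    filter_upwards [hmg, (tendsto_of_analyticAt hι rfl).eventually hcon] with x h1 h2 hx
    change divP (γ x).1 x (ξ (γ x)) = 0 at h2
    rw [h1, hγ, divP_smul] at h2
    have h3 : ∑ i ∈ Finset.range (k + 1), (x • g x) ^ i * x ^ (k + 1 - 1 - i)
        = x ^ k * ∑ i ∈ Finset.range (k + 1), g x ^ i := by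
      rw [Finset.mul_sum]
      refine Finset.sum_congr rfl fun i hi => ?_
      have hi' : i ≤ k := by simpa [Nat.lt_succ_iff] using hi
      rw [smul_eq_mul, mul_pow, mul_right_comm, ← pow_add,
        show i + (k + 1 - 1 - i) = k by omega]
    rw [h3] at h2
    exact (mul_eq_zero.1 h2).resolve_left (pow_ne_zero _ hx)
  have h4 := hsum.self_of_nhds
  simp only [hg0, one_pow, Finset.sum_const, Finset.card_range, nsmul_eq_mul, mul_one] at h4
  exact absurd h4 (by exact_mod_cast Nat.succ_ne_zero k)

namespace IsOrbitalConjugacy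

/-- Over `{P = 0}` the field `X'` is vertical, and the equation becomes `y * speed' * ∂Ψ₁/∂y = V *
P(Ψ₁)`. At `y = 0` the unit `V` forces `P(Ψ₁) = 0`. Off `y = 0` the same equation is Fuchsian for
`P(Ψ₁)` in the variable `y`, with small coefficient since `divP` vanishes at the origin. -/
theorem P_fst_retract (h : IsOrbitalConjugacy n n' Ψ V) (hn' : n'.IsNormal τ) (hk : 1 ≤ k) :
    ∀ᶠ q in 𝓝 0, P (retract hk q).1 (Ψ (retract hk q)).1 = 0 := by
  have hρ := analyticAt_retract hk 0
  have hρt := tendsto_retract hk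
  have hρ0 := retract_zero hk
  have hξ : AnalyticAt ℂ (fun q => (Ψ (retract hk q)).1) 0 :=
    h.analyticAt_fst.fun_comp_of_eq hρ hρ0
  have hf : AnalyticAt ℂ (fun q => P (retract hk q).1 (Ψ (retract hk q)).1) 0 :=
    analyticAt_P_comp (by fun_prop) hξ
  have hs : AnalyticAt ℂ (fun q => n'.speed (retract hk q)) 0 :=
    hn'.analyticAt_speed.fun_comp_of_eq hρ hρ0
  have hs0 : n'.speed (retract hk 0) ≠ 0 := by rw [hρ0, hn'.speed_zero hk]; exact one_ne_zero
  have hV : AnalyticAt ℂ (fun q => V (retract hk q)) 0 := h.analytic_V.fun_comp_of_eq hρ hρ0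
  have hκ : AnalyticAt ℂ (fun q => divP (retract hk q).1 (Ψ (retract hk q)).1
      (Ψ (retract hk q)).1 * V (retract hk q) / n'.speed (retract hk q)) 0 :=
    ((analyticAt_divP_comp (by fun_prop) hξ hξ).fun_mul hV).fun_div hs hs0
  have hκs : ∀ᶠ q in 𝓝 0, ‖divP (retract hk q).1 (Ψ (retract hk q)).1
      (Ψ (retract hk q)).1 * V (retract hk q) / n'.speed (retract hk q)‖ < 1 / 2 :=
    hκ.continuousAt.norm.eventually_lt continuousAt_const
      (by simp [hρ0, h.zero, divP_zero hk])
  have heq : ∀ᶠ q in 𝓝 0, q.2.2 * n'.speed (retract hk q) *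
      fderiv ℂ (fun q => (Ψ q).1) (retract hk q) (0, 0, 1)
      = V (retract hk q) * P (retract hk q).1 (Ψ (retract hk q)).1 := by
    filter_upwards [hρt.eventually h.eq_fst] with q hq
    rw [← hq]
    have h1 := P_retract hk q
    rw [retract_eq] at h1 ⊢
    simp only at h1 ⊢
    rw [h1]; ring
  refine isCoord_y.eventually_eq_zero_of_fuchs rfl hf ?_ ?_
  · have hst : Tendsto (slice (fun q : Space k => q.2.2) (0, 0, 1)) (𝓝 0) (𝓝 0) :=
      isCoord_y.tendsto_slice rfl
    filter_upwards [hst.eventually heq, hst.eventually (hV.continuousAt.eventually_ne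
      (by rw [hρ0]; exact h.V_ne))] with q h1 h2
    rw [slice_y] at h1 h2 ⊢
    simp only [zero_mul] at h1
    exact (mul_eq_zero.1 h1.symm).resolve_left h2
  · filter_upwards [heq, hκs, hs.continuousAt.eventually_ne hs0, hf.eventually_analyticAt,
      hρt.eventually h.analyticAt_fst.eventually_analyticAt] with q h1 h2 h3 h4 h5
    have hline (s : ℂ) : retract hk (q + s • (0, 0, 1)) = retract hk q + s • (0, 0, 1) := by
      ext <;> simp [retract_eq]
    have h6 := (hasDerivAt_P (retract hk q).1 (Ψ (retract hk q)).1).comp_of_eq (0 : ℂ)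
      (h5.differentiableAt.hasFDerivAt.hasLineDerivAt (0, 0, 1)) (by simp)
    have h7 : fderiv ℂ (fun q => P (retract hk q).1 (Ψ (retract hk q)).1) q (0, 0, 1)
        = divP (retract hk q).1 (Ψ (retract hk q)).1 (Ψ (retract hk q)).1
          * fderiv ℂ (fun q => (Ψ q).1) (retract hk q) (0, 0, 1) :=
      HasDerivAt.unique (h4.differentiableAt.hasFDerivAt.hasLineDerivAt (0, 0, 1))
        (h6.congr_of_eventuallyEq (Eventually.of_forall fun s => by
          simp only [hline, Function.comp_apply]
          simp))
    have h8 : q.2.2 * fderiv ℂ (fun q => (Ψ q).1) (retract hk q) (0, 0, 1)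
        = V (retract hk q) / n'.speed (retract hk q)
          * P (retract hk q).1 (Ψ (retract hk q)).1 := by
      rw [div_mul_eq_mul_div, eq_div_iff h3, ← h1]; ring
    rw [h7, smul_eq_mul, mul_left_comm, h8, ← mul_assoc, ← mul_div_assoc, norm_mul]
    gcongr

/-- The `x`-component of an orbital conjugacy is `x` modulo `P_ε(x)`. -/
theorem exists_fst_eq (h : IsOrbitalConjugacy n n' Ψ V) (hn : n.IsNormal τ)
    (hn' : n'.IsNormal τ) (hk : 1 ≤ k) :
    ∃ A : Space k → ℂ, AnalyticAt ℂ A 0 ∧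
      ∀ᶠ q in 𝓝 0, (Ψ q).1 = q.2.1 + P q.1 q.2.1 * A q := by
  obtain ⟨A, hA, hA'⟩ := (isCoord_P hk).exists_eq_smul (a := 0) (f := fun q => (Ψ q).1 - q.2.1)
    (by simp [P_zero_zero]) (h.analyticAt_fst.sub (by fun_prop)) (by
      filter_upwards [eq_x_of_P_eq_zero hk h.analyticAt_fst (by simp [h.zero])
        (h.fderiv_fst_x hn hn' hk) (h.P_fst_retract hn' hk)] with q hq
      change (Ψ (retract hk q)).1 - (retract hk q).2.1 = 0
      rw [hq, retract_eq, sub_self])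
  refine ⟨A, hA, ?_⟩
  filter_upwards [hA'] with q hq
  rw [← smul_eq_mul, ← hq]; ring

end IsOrbitalConjugacy

/-- A suitable time of the flow brings the `x`-component back to `x`. -/
theorem exists_straightening {Z : Space k → ℂ × ℂ} {w : Space k → ℂ} {Φ : ℂ × Space k → Space k}
    (h : IsParamFlow Z Φ) (hZ : IsModel Z w) (hw : w 0 ≠ 0) (hk : 1 ≤ k)
    (hΨ : AnalyticAt ℂ Ψ 0) (hΨ0 : Ψ 0 = 0) {A : Space k → ℂ} (hA : AnalyticAt ℂ A 0)
    (hΨA : ∀ᶠ q in 𝓝 0, (Ψ q).1 = q.2.1 + P q.1 q.2.1 * A q) :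
    ∃ G : Space k → ℂ, AnalyticAt ℂ G 0 ∧
      ∀ᶠ q in 𝓝 0, (Φ (G q, withParam Ψ q)).2.1 = q.2.1 := by
  -- Since `P(Ψ₁) = P(x) B` with `B = 1 + A * divP`, the `x`-component after time `s` is `x + P(x)
  -- (A + B K)`. The equation `A + B K = 0` has at the origin the root `s₀`, because there `B = 1`
  -- and `K = w 0 * s`.
  set s₀ : ℂ := -A 0 / w 0 with hs₀
  obtain ⟨K, hK, hK', hK0, hKd⟩ := h.exists_displacement hZ hk s₀
  let B : Space k → ℂ := fun q => 1 + A q * divP q.1 q.2.1 (Ψ q).1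
  have hB : AnalyticAt ℂ B 0 := analyticAt_const.add
    (hA.mul (analyticAt_divP_comp (by fun_prop) (by fun_prop) (by fun_prop)))
  have hB0 : B 0 = 1 := by simp [B, hΨ0, divP_zero hk]
  let f : ℂ × Space k → ℂ := fun p => A p.2 + B p.2 * K (p.1, withParam Ψ p.2)
  have hwp := analyticAt_withParam hΨ
  have hpair : AnalyticAt ℂ (fun p : ℂ × Space k => (p.1, withParam Ψ p.2)) (s₀, 0) :=
    analyticAt_fst.prod (hwp.fun_comp_of_eq analyticAt_snd rfl)
  have hpair0 : (s₀, withParam Ψ 0) = (s₀, 0) := by rw [withParam_zero hΨ0]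
  have hKc : AnalyticAt ℂ (fun p : ℂ × Space k => K (p.1, withParam Ψ p.2)) (s₀, 0) :=
    hK.fun_comp_of_eq hpair hpair0
  have hf : AnalyticAt ℂ f (s₀, 0) :=
    (hA.fun_comp_of_eq analyticAt_snd rfl).fun_add
      ((hB.fun_comp_of_eq analyticAt_snd rfl).fun_mul hKc)
  obtain ⟨G, hG, hG0, hGf⟩ := exists_implicit hf
    (by simp only [f]; rw [withParam_zero hΨ0, hK0, hB0, hs₀]; field_simp; ring) (by
      have h1 := hasDerivAt_fst_of_analyticAt hK.differentiableAt
      have h2 := (h1.const_mul (B 0)).const_add (A 0)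
      have h3 := hasDerivAt_fst_of_analyticAt hf.differentiableAt
      simp only [f, withParam_zero hΨ0] at h3
      rw [h3.unique h2, hKd, hB0, one_mul]
      exact hw)
  refine ⟨G, hG, ?_⟩
  have ht : Tendsto (fun q => (G q, withParam Ψ q)) (𝓝 0) (𝓝 (s₀, 0)) :=
    tendsto_of_analyticAt (by fun_prop) (by rw [hG0, withParam_zero hΨ0])
  filter_upwards [hGf, hΨA, ht.eventually hK'] with q h1 h2 h3
  have h4 := P_sub_P q.1 q.2.1 (Ψ q).1
  simp only [f, B] at h1
  rw [h3]
  simp only [withParam] at h1 ⊢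
  have h5 : P q.1 (Ψ q).1 = P q.1 q.2.1 + P q.1 q.2.1 * A q * divP q.1 q.2.1 (Ψ q).1 := by
    have : (Ψ q).1 - q.2.1 = P q.1 q.2.1 * A q := by rw [h2]; ring
    rw [this] at h4
    linear_combination h4
  rw [h5]
  linear_combination h2 + P q.1 q.2.1 * h1

variable {k τ : ℕ} {n n' : Invariant k} {Ψ : Space k → ℂ × ℂ} {V : Space k → ℂ}

theorem lift_form (n : Invariant k) (q : Space k) :
    lift n.form q = n.factor q • ((0, n.orbitalForm q) : Space k) := by
  simp [lift, n.form_eq]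

/-- An orbital conjugacy is a fibered one followed by a flow. -/
theorem IsOrbitalConjugacy.exists_fibered (h : IsOrbitalConjugacy n n' Ψ V) (hn : n.IsNormal τ)
    (hn' : n'.IsNormal τ) (hk : 1 ≤ k) {Φ : ℂ × Space k → Space k} (hΦ : IsParamFlow n.form Φ) :
    ∃ G η : Space k → ℂ, AnalyticAt ℂ G 0 ∧ AnalyticAt ℂ η 0 ∧ η 0 = 0 ∧
      fderiv ℂ η 0 (0, 0, 1) ≠ 0 ∧ (∀ᶠ q in 𝓝 0, withParam Ψ q = Φ (G q, (q.1, q.2.1, η q))) ∧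
      ∀ᶠ q in 𝓝 0, fderiv ℂ η q (0, n'.orbitalForm q) = η q * n.speed (q.1, q.2.1, η q) := by
  have hZ := hn.isModel
  obtain ⟨A, hA, hΨA⟩ := h.exists_fst_eq hn hn' hk
  obtain ⟨G, hG, hGx⟩ := exists_straightening hΦ hZ hn.factor_zero_ne hk h.analytic h.zero hA hΨA
  have hwp := analyticAt_withParam h.analytic
  have hwp0 := withParam_zero h.zero
  have hpair : AnalyticAt ℂ (fun q => (G q, withParam Ψ q)) 0 := by fun_prop
  have hpair0 : (G 0, withParam Ψ 0) = (G 0, 0) := by rw [hwp0]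
  have hpt := tendsto_of_analyticAt hpair hpair0
  have hwpt := tendsto_of_analyticAt hwp hwp0
  let Θ : Space k → Space k := fun q => Φ (G q, withParam Ψ q)
  have hΘ : AnalyticAt ℂ Θ 0 := (hΦ.analyticAt (G 0)).fun_comp_of_eq hpair hpair0
  have hΘ0 : Θ 0 = 0 := by simp only [Θ]; rw [hwp0, hΦ.time_zero hZ]
  have hΘt := tendsto_of_analyticAt hΘ hΘ0
  let η : Space k → ℂ := fun q => (Θ q).2.2
  have hη : AnalyticAt ℂ η 0 := by fun_prop
  have hη0 : η 0 = 0 := by simp [η, hΘ0]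
  have hΘη : ∀ᶠ q in 𝓝 0, Θ q = (q.1, q.2.1, η q) := by
    filter_upwards [hGx, hpt.eventually (hΦ.fst_eq (G 0))] with q h1 h2
    exact Prod.ext h2 (Prod.ext h1 rfl)
  have hback : ∀ᶠ q in 𝓝 0, withParam Ψ q = Φ (-G q, (q.1, q.2.1, η q)) := by
    have ht : Tendsto (fun q => ((-G q, G q), withParam Ψ q)) (𝓝 0) (𝓝 ((-G 0, G 0), 0)) :=
      tendsto_of_analyticAt (by fun_prop) (by rw [hwp0])
    filter_upwards [ht.eventually (hΦ.isFlowOn.comp (analyticAt_lift hZ.analytic) hZ.lift_zero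
      (-G 0) (G 0)), hΘη, hwpt.eventually hΦ.isFlowOn.init] with q h1 h2 h3
    rw [← h2]
    simpa [h3] using h1.symm
  let X' : Space k → Space k := fun q => (0, n'.orbitalForm q)
  have hX' : AnalyticAt ℂ X' 0 := by
    have := hn'.analyticAt_orbitalForm; fun_prop
  -- The map `Θ` carries `X'` to a multiple of `X`: the multiplier collects the change of the time
  -- `G` along `X'` and the multiplier of `Ψ`, both measured in units of the normal form.
  let lam : Space k → ℂ := fun q =>
    (fderiv ℂ G q (X' q) + V q / n.factor (withParam Ψ q)) * n.factor (Θ q)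
  have hlam : AnalyticAt ℂ lam 0 := by
    have h1 : AnalyticAt ℂ (fun q => n.factor (withParam Ψ q)) 0 :=
      hn.analyticAt_factor.fun_comp_of_eq hwp hwp0
    have h2 : AnalyticAt ℂ (fun q => n.factor (Θ q)) 0 :=
      hn.analyticAt_factor.fun_comp_of_eq hΘ hΘ0
    exact ((analyticAt_fderiv_apply hG hX').add (h.analytic_V.fun_div h1
      (by rw [hwp0]; exact hn.factor_zero_ne))).fun_mul h2
  have hΘd : ∀ᶠ q in 𝓝 0, HasFDerivAt Θ (fderiv ℂ Θ q) q ∧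
      fderiv ℂ Θ q (X' q) = lam q • ((0, n.orbitalForm (Θ q)) : Space k) := by
    filter_upwards [h.eq, h.analytic.eventually_analyticAt, hG.eventually_analyticAt,
      hpt.eventually (hΦ.analyticAt (G 0)).eventually_analyticAt,
      hpt.eventually (hΦ.isFlowOn.ode (G 0) (Set.mem_univ _)),
      hpt.eventually (hΦ.isFlowOn.fderiv_apply_field (analyticAt_lift hZ.analytic) hZ.lift_zero
        (G 0)), hwpt.eventually hn.eventually_factor_ne] with q h1 h2 h3 h4 h5 h6 h7
    have h8 : HasFDerivAt (withParam Ψ) ((ContinuousLinearMap.fst ℂ _ _).prod (fderiv ℂ Ψ q)) q :=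
      hasFDerivAt_fst.prodMk h2.differentiableAt.hasFDerivAt
    have h9 : HasFDerivAt Θ _ q := HasFDerivAt.comp (g := Φ) q h4.differentiableAt.hasFDerivAt
      (h3.differentiableAt.hasFDerivAt.prodMk h8)
    refine ⟨h9.differentiableAt.hasFDerivAt, ?_⟩
    rw [h9.fderiv]
    set Y : Space k := (0, n.orbitalForm (withParam Ψ q)) with hY
    have h10 : lift n.form (withParam Ψ q) = n.factor (withParam Ψ q) • Y := lift_form n _
    have h11 : (((fderiv ℂ G q).prod ((ContinuousLinearMap.fst ℂ (Param k) (ℂ × ℂ)).prod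
        (fderiv ℂ Ψ q))) (X' q) : ℂ × Space k) = fderiv ℂ G q (X' q) • ((1, 0) : ℂ × Space k)
          + (V q / n.factor (withParam Ψ q)) • (0, lift n.form (withParam Ψ q)) := by
      have h12 : (V q / n.factor (withParam Ψ q)) •
          ((0, n.factor (withParam Ψ q) • Y) : ℂ × Space k) = (0, V q • Y) := by
        rw [Prod.smul_mk, smul_zero, smul_smul, div_mul_cancel₀ _ h7]
      rw [h10, h12, hY]
      have : fderiv ℂ Ψ q (X' q) = V q • n.orbitalForm (withParam Ψ q) := h1
      simp [this, X']
    rw [ContinuousLinearMap.comp_apply, h11, map_add, map_smul, map_smul, h5, h6, ← add_smul]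
    change _ • lift n.form (Θ q) = _
    rw [lift_form, smul_smul]
  -- The map `Θ` preserves `x`, and both orbital fields have first component `P`, so `lam * P = P`.
  have hlam1 : ∀ᶠ q in 𝓝 0, lam q = 1 := by
    refine (isCoord_P hk).eventually_eq hlam analyticAt_const ?_
    filter_upwards [hΘd, eventually_eventually_nhds.2 hΘη] with q ⟨h1, h2⟩ h3 hq
    have h4 : HasFDerivAt (fun q : Space k => q.2.1) _ q :=
      h1.snd.fst.congr_of_eventuallyEq (h3.mono fun z hz => (congrArg (fun v : Space k => v.2.1) hz.symm :))
    have h5 := congrArg (fun L => L (X' q)) (h4.unique hasFDerivAt_snd.fst)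
    simp only [ContinuousLinearMap.comp_apply, h2, h3.self_of_nhds] at h5
    have h6 : lam q * P q.1 q.2.1 = P q.1 q.2.1 := h5
    exact mul_right_cancel₀ hq (h6.trans (one_mul _).symm)
  refine ⟨fun q => -G q, η, hG.fun_neg, hη, hη0, ?_, hback, ?_⟩
  -- At the fixed origin the flow has zero time derivative, so `∂η/∂y = 0` would give `∂Ψ/∂y = 0`,
  -- against the invertibility of the linear part of `Ψ`.
  · intro h0
    have h1 : HasFDerivAt (fun q : Space k => (-G q, (q.1, q.2.1, η q))) _ 0 :=
      hG.differentiableAt.hasFDerivAt.neg.prodMk (hasFDerivAt_fst.prodMk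
        (hasFDerivAt_snd.fst.prodMk hη.differentiableAt.hasFDerivAt))
    have h2 := HasFDerivAt.comp (g := Φ) (g' := fderiv ℂ Φ (-G 0, 0)) (0 : Space k)
      (by rw [hη0]; exact (hΦ.analyticAt (-G 0)).differentiableAt.hasFDerivAt) h1
    have h3 : HasFDerivAt (withParam Ψ)
        ((ContinuousLinearMap.fst ℂ _ _).prod (fderiv ℂ Ψ 0)) 0 :=
      hasFDerivAt_fst.prodMk h.analytic.differentiableAt.hasFDerivAt
    have h4 := congrArg (fun L => (L (0, 0, 1)).2)
      (h3.unique (h2.congr_of_eventuallyEq hback))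
    have h5 := (hΦ.isFlowOn.ode (-G 0) (Set.mem_univ _)).self_of_nhds
    rw [hΦ.time_zero hZ, hZ.lift_zero] at h5
    have h6 (a : ℂ) : fderiv ℂ Φ (-G 0, 0) (a, 0) = 0 := by
      have : ((a, 0) : ℂ × Space k) = a • (1, 0) := by simp
      rw [this, map_smul, h5, smul_zero]
    have h7 : fderiv ℂ Ψ 0 (0, 0, 1) = 0 := by
      refine h4.trans ?_
      simp only [ContinuousLinearMap.comp_apply]
      have h8 : ((((-fderiv ℂ G 0).prod ((ContinuousLinearMap.fst ℂ (Param k) (ℂ × ℂ)).prod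
        (((ContinuousLinearMap.fst ℂ ℂ ℂ).comp (ContinuousLinearMap.snd ℂ (Param k) (ℂ × ℂ))).prod
          (fderiv ℂ η 0)))) ((0, 0, 1) : Space k)) : ℂ × Space k)
          = (-fderiv ℂ G 0 (0, 0, 1), 0) := by
        simp [h0]
      rw [h8, h6]; rfl
    simpa using h.fderiv_ne _ h7
  · filter_upwards [hΘd, hlam1, hΘη] with q ⟨h1, h2⟩ h3 h4
    have h5 : HasFDerivAt η _ q := h1.snd.snd
    rw [h5.fderiv]
    change (fderiv ℂ Θ q (X' q)).2.2 = _
    rw [h2, h3, one_smul, h4, n.orbitalForm_eq]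

/-! ### Fibered conjugacies are linear -/

variable {k τ : ℕ} {n n' : Invariant k}

theorem isCoord_snd : IsCoord (fun p : Param k × ℂ => p.2) (0, 1) where
  analytic p := analyticAt_snd
  add_smul p s := by simp

theorem slice_snd (p : Param k × ℂ) :
    slice (fun p : Param k × ℂ => p.2) (0, 1) p = (p.1, 0) := by
  ext <;> simp [slice]

/-- Uniqueness of division by `P_ε(x)` with remainder of degree at most `k` in `x`. -/
theorem eventually_eq_zero_of_P_mul_eq {f : Param k × ℂ → ℂ} (hf : AnalyticAt ℂ f 0)
    {a : Fin (k + 1) → Param k → ℂ} (ha : ∀ j, AnalyticAt ℂ (a j) 0)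
    (h : ∀ᶠ p in 𝓝 (0 : Param k × ℂ), P p.1 p.2 * f p = ∑ j : Fin (k + 1), p.2 ^ (j : ℕ) * a j p.1) :
    (∀ᶠ p in 𝓝 0, f p = 0) ∧ ∀ j, ∀ᶠ ε in 𝓝 0, a j ε = 0 := by
  refine eventually_eq_zero_of_linear (A := fun _ => 0) (B := fun p => P p.1 p.2)
    (c := fun (j : Fin (k + 1)) p => p.2 ^ (j : ℕ)) analyticAt_const (by fun_prop)
    (fun j => by fun_prop) hf ha (h.mono fun p hp => by rw [← hp]; ring) fun g b hg hb => ?_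
  refine eq_zero_of_pow_mul_eq_polynomial hg b (hb.mono fun x hx => ?_)
  rw [← hx, P_zero_left]; ring

theorem IsSection.mul_param {f : Space k → ℂ} (hf : IsSection τ f) {c : Param k → ℂ}
    (hc : AnalyticAt ℂ c 0) : IsSection τ (fun q => c q.1 * f q) := by
  obtain ⟨g, hg, hfg⟩ := hf
  have hc' : AnalyticAt ℂ (fun p : Param k × ℂ => c p.1) 0 := hc.fun_comp_of_eq analyticAt_fst rfl
  refine ⟨fun j p => c p.1 * g j p, fun j => hc'.fun_mul (hg j), ?_⟩
  filter_upwards [hfg] with q hq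
  rw [hq, mul_left_comm, Finset.mul_sum]
  simp only [mul_assoc]

theorem Invariant.IsNormal.exists_orbitalForm_eq (hn : n.IsNormal τ) :
    ∃ r : Space k → ℂ, AnalyticAt ℂ r 0 ∧ (n.R =ᶠ[𝓝 0] fun q => q.2.2 * r q) ∧
      ∀ᶠ q in 𝓝 0, n.orbitalForm q
        = (P q.1 q.2.1, q.2.2 * (1 + n.μ q.1 * q.2.1 ^ k + q.2.2 * r q)) := by
  obtain ⟨r, hr, hR⟩ := hn.section_R.exists_eq_mul
  refine ⟨r, hr, hR, ?_⟩
  filter_upwards [hR] with q hq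
  rw [n.orbitalForm_eq, Invariant.speed, hq]

/-- A fibered conjugacy preserves `{y = 0}`. -/
theorem eventually_eq_zero_of_fibered (hn : n.IsNormal τ) (hk : 1 ≤ k) {η : Space k → ℂ}
    (hη : AnalyticAt ℂ η 0) (hη0 : η 0 = 0)
    (h : ∀ᶠ q in 𝓝 0, fderiv ℂ η q (0, n'.orbitalForm q) = η q * n.speed (q.1, q.2.1, η q)) :
    ∀ᶠ q : Space k in 𝓝 0, η (q.1, q.2.1, 0) = 0 := by
  have hf : AnalyticAt ℂ (fun p : Param k × ℂ => η (p.1, p.2, 0)) 0 :=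
    hη.fun_comp_of_eq (f := fun p : Param k × ℂ => ((p.1, p.2, 0) : Space k)) (by fun_prop) rfl
  have hs : AnalyticAt ℂ (fun p : Param k × ℂ => n.speed (p.1, p.2, η (p.1, p.2, 0))) 0 :=
    hn.analyticAt_speed.fun_comp_of_eq
      (f := fun p : Param k × ℂ => ((p.1, p.2, η (p.1, p.2, 0)) : Space k)) (by fun_prop)
      (by change (_, _, η 0) = _; rw [hη0]; rfl)
  have hs0 : n.speed ((0 : Param k), (0 : ℂ), η (0, 0, 0)) = 1 := by
    have : η (0, 0, 0) = 0 := hη0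
    rw [this]; exact hn.speed_zero hk
  -- The nonlinear equation for `η` on `y = 0` is read as a linear one whose coefficient `speed` is
  -- frozen along `η` itself. It has no forcing, hence the empty index type.
  have h1 := (eventually_eq_zero_of_linear (ι := Fin 0) (A := fun p : Param k × ℂ => P p.1 p.2)
    (B := fun p => -n.speed (p.1, p.2, η (p.1, p.2, 0))) (c := fun _ _ => 0) (a := fun _ _ => 0)
    (by fun_prop) hs.fun_neg (fun j => j.elim0) hf (fun j => j.elim0) (by
      filter_upwards [tendsto_section.eventually h,
        tendsto_section.eventually hη.eventually_analyticAt] with p h1 h2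
      rw [n'.orbitalForm_eq, fderiv_space_apply] at h1
      rw [fderiv_restrict h2.differentiableAt]
      simp only [zero_mul, add_zero] at h1
      rw [h1]; simp; ring) fun g b hg hb => ⟨?_, fun j => j.elim0⟩).1
  · exact tendsto_xy.eventually h1
  · refine eq_zero_of_pow_mul_deriv_eq hk hg (h := fun x : ℂ => n.speed (0, x, η (0, x, 0)))
      (hs.fun_comp_of_eq (f := fun x : ℂ => ((0, x) : Param k × ℂ)) (by fun_prop) rfl)
      (by rw [hs0]; exact one_ne_zero) (hb.mono fun x hx => ?_)
    rw [P_zero_left] at hx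
    simp only [Finset.univ_eq_empty, Finset.sum_empty] at hx
    linear_combination hx

/-- Invariance of `{y = 0}` allows the division by `y`. The derivative of the factor `y` along `X'`
contributes `speed'`, which turns the equation for `η` into a logarithmic one for `W`. -/
theorem exists_eq_mul_of_fibered (hn : n.IsNormal τ) (hn' : n'.IsNormal τ) (hk : 1 ≤ k)
    {η : Space k → ℂ} (hη : AnalyticAt ℂ η 0) (hη0 : η 0 = 0) (hηy : fderiv ℂ η 0 (0, 0, 1) ≠ 0)
    (h : ∀ᶠ q in 𝓝 0, fderiv ℂ η q (0, n'.orbitalForm q) = η q * n.speed (q.1, q.2.1, η q)) :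
    ∃ W : Space k → ℂ, AnalyticAt ℂ W 0 ∧ W 0 ≠ 0 ∧ (∀ᶠ q in 𝓝 0, η q = q.2.2 * W q) ∧
      ∀ᶠ q in 𝓝 0, fderiv ℂ W q (0, n'.orbitalForm q)
        = W q * (n.speed (q.1, q.2.1, q.2.2 * W q) - n'.speed q) := by
  obtain ⟨W, hW, hηW⟩ := isCoord_y.exists_eq_smul (a := 0) rfl hη (by
    filter_upwards [eventually_eq_zero_of_fibered hn hk hη hη0 h] with q hq
    rw [slice_y, hq])
  have hyW {q : Space k} (hq : AnalyticAt ℂ W q) (v : Space k) :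
      fderiv ℂ (fun q : Space k => q.2.2 • W q) q v = q.2.2 * fderiv ℂ W q v + v.2.2 * W q := by
    have : HasFDerivAt (fun q : Space k => q.2.2 • W q) _ q :=
      (hasFDerivAt_snd.snd : HasFDerivAt (fun q : Space k => q.2.2) _ q).fun_smul hq.differentiableAt.hasFDerivAt
    rw [this.fderiv]
    simp
  refine ⟨W, hW, ?_, hηW, isCoord_y.eventually_eq ?_ ?_ ?_⟩
  · rw [hηW.fderiv_eq, hyW hW] at hηy
    simpa using hηy
  · have := hn'.analyticAt_orbitalForm
    exact analyticAt_fderiv_apply hW (by fun_prop)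
  · have h1 : AnalyticAt ℂ (fun q : Space k => n.speed (q.1, q.2.1, q.2.2 * W q)) 0 :=
      hn.analyticAt_speed.fun_comp_of_eq
        (f := fun q : Space k => ((q.1, q.2.1, q.2.2 * W q) : Space k)) (by fun_prop) (by simp)
    have h2 := hn'.analyticAt_speed
    fun_prop
  · filter_upwards [h, eventually_eventually_nhds.2 hηW, hW.eventually_analyticAt]
      with q h1 h2 h3 hq
    have h2' : η =ᶠ[𝓝 q] fun q => q.2.2 • W q := h2
    rw [h2'.fderiv_eq, hyW h3, h2'.eq_of_nhds, n'.orbitalForm_eq] at h1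
    rw [n'.orbitalForm_eq]
    refine mul_left_cancel₀ hq ?_
    simp only [smul_eq_mul] at h1
    linear_combination h1

/-- A fibered conjugacy of orbital normal forms is linear. -/
theorem eq_linear_of_fibered (hn : n.IsNormal τ) (hn' : n'.IsNormal τ) (hk : 1 ≤ k)
    {η : Space k → ℂ} (hη : AnalyticAt ℂ η 0) (hη0 : η 0 = 0) (hηy : fderiv ℂ η 0 (0, 0, 1) ≠ 0)
    (h : ∀ᶠ q in 𝓝 0, fderiv ℂ η q (0, n'.orbitalForm q) = η q * n.speed (q.1, q.2.1, η q)) :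
    ∃ c, IsUnitGerm c ∧ OrbitalInvariantsMatch c n n' ∧
      ∀ᶠ q in 𝓝 0, η q = c q.1 * q.2.2 := by
  obtain ⟨W, hW, hW0, hηW, hWeq⟩ := exists_eq_mul_of_fibered hn hn' hk hη hη0 hηy h
  obtain ⟨r, hr, hR, -⟩ := hn.exists_orbitalForm_eq
  obtain ⟨r', hr', -, hX'⟩ := hn'.exists_orbitalForm_eq
  have hW₀ : AnalyticAt ℂ (fun p : Param k × ℂ => W (p.1, p.2, 0)) 0 :=
    hW.fun_comp_of_eq (f := fun p : Param k × ℂ => ((p.1, p.2, 0) : Space k)) (by fun_prop) rfl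
  have hdW₀ : AnalyticAt ℂ (fun p : Param k × ℂ => fderiv ℂ W (p.1, p.2, 0) (0, 1, 0)) 0 := by
    have : AnalyticAt ℂ (fun q => fderiv ℂ W q (0, 1, 0)) 0 := by fun_prop
    exact this.fun_comp_of_eq (f := fun p : Param k × ℂ => ((p.1, p.2, 0) : Space k))
      (by fun_prop) rfl
  have hW₀ne : ∀ᶠ p in 𝓝 (0 : Param k × ℂ), W (p.1, p.2, 0) ≠ 0 :=
    hW₀.continuousAt.eventually_ne hW0
  -- restriction to `y = 0`
  obtain ⟨h1, h2⟩ := eventually_eq_zero_of_P_mul_eq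
    (f := fun p : Param k × ℂ => fderiv ℂ W (p.1, p.2, 0) (0, 1, 0) / W (p.1, p.2, 0))
    -- Here `P ∂ₓW / W = (μ - μ') xᵏ`: the remainder has the single monomial of degree `k`, and
    -- uniqueness of division annihilates both the quotient and the remainder.
    (a := fun j ε => if j = Fin.last k then n.μ ε - n'.μ ε else 0)
    (hdW₀.fun_div hW₀ hW0) (fun j => by
      split_ifs
      · exact hn.analytic_μ.sub hn'.analytic_μ
      · exact analyticAt_const) (by
      filter_upwards [tendsto_section.eventually hWeq, hW₀ne,
        tendsto_section.eventually hn.section_R.eventually_eq_zero,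
        tendsto_section.eventually hn'.section_R.eventually_eq_zero] with p h1 h2 h3 h4
      simp only [zero_mul, Invariant.speed] at h1 h3 h4
      rw [h3, h4, n'.orbitalForm_eq, fderiv_space_apply] at h1
      simp only [zero_mul, add_zero] at h1
      simp only [mul_ite, mul_zero, Finset.sum_ite_eq', Finset.mem_univ, if_true, Fin.val_last]
      rw [mul_div_assoc', div_eq_iff h2]
      linear_combination h1)
  have hμ : n.μ =ᶠ[𝓝 0] n'.μ := by
    filter_upwards [h2 (Fin.last k)] with ε hε
    simpa [sub_eq_zero] using hε
  have hWx : ∀ᶠ p in 𝓝 (0 : Param k × ℂ), W (p.1, p.2, 0) = W (p.1, 0, 0) := by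
    have h3 := isCoord_snd.eventually_eq_slice (a := (0 : Param k × ℂ)) rfl hW₀ (by
      filter_upwards [h1, hW₀ne, tendsto_section.eventually hW.eventually_analyticAt]
        with p h3 h4 h5
      rw [fderiv_restrict h5.differentiableAt]
      exact (div_eq_zero_iff.1 h3).resolve_right h4)
    simpa only [slice_snd] using h3
  let c : Param k → ℂ := fun ε => W (ε, 0, 0)
  have hc : AnalyticAt ℂ c 0 :=
    hW.fun_comp_of_eq (f := fun ε : Param k => ((ε, 0, 0) : Space k)) (by fun_prop) rfl
  have hcu : IsUnitGerm c := ⟨hc, hW0⟩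
  have hcs : AnalyticAt ℂ (fun q : Space k => c q.1) 0 := hc.fun_comp_of_eq analyticAt_fst rfl
  let N : Space k → ℂ := fun q => W q - c q.1
  have hN : AnalyticAt ℂ N 0 := hW.sub hcs
  have hN0 : ∀ᶠ q : Space k in 𝓝 0, N (q.1, q.2.1, 0) = 0 := by
    filter_upwards [tendsto_xy.eventually hWx] with q hq
    exact sub_eq_zero.2 hq
  -- With `R = y r` and `W = c + N`, the difference `W r(W y) - c r(c y)` is divisible by `N`, with
  -- quotient `H`. The equation becomes `X' N = (W y H + D) N + c D`, linear in `N`, with a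
  -- coefficient that vanishes on `y = 0`.
  let rc : ℂ × Space k → ℂ := fun p => r (p.2.1, p.2.2.1, (c p.2.1 + p.1) * p.2.2.2)
  have hcs2 : AnalyticAt ℂ (fun p : ℂ × Space k => c p.2.1) 0 :=
    hc.fun_comp_of_eq (f := fun p : ℂ × Space k => p.2.1) (by fun_prop) rfl
  have hrc : AnalyticAt ℂ rc 0 := hr.fun_comp_of_eq
    (f := fun p : ℂ × Space k => ((p.2.1, p.2.2.1, (c p.2.1 + p.1) * p.2.2.2) : Space k))
    (by fun_prop) (by simp)
  have hrc0 : AnalyticAt ℂ (fun p : ℂ × Space k => rc (0, p.2)) 0 :=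
    hrc.fun_comp_of_eq (f := fun p : ℂ × Space k => ((0 : ℂ), p.2)) (by fun_prop) rfl
  obtain ⟨H, hH, hHeq⟩ := isCoord_fst.exists_eq_smul (a := (0 : ℂ × Space k)) rfl
    (f := fun p : ℂ × Space k => (c p.2.1 + p.1) * rc p - c p.2.1 * rc (0, p.2)) (by fun_prop)
    (Eventually.of_forall fun p => by rw [slice_fst]; simp)
  let D : Space k → ℂ := fun q => rescale c n.R q - n'.R q
  have hD : IsSection τ D := (hn.section_R.rescale hc).sub hn'.section_R
  have hpairN : AnalyticAt ℂ (fun q => (N q, q)) 0 := by fun_prop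
  have hN00 : N 0 = 0 := sub_self _
  have hpairN0 : (N 0, (0 : Space k)) = 0 := by rw [hN00]; rfl
  have hE : AnalyticAt ℂ (fun q => W q * (q.2.2 * H (N q, q)) + D q) 0 := by
    have h1 : AnalyticAt ℂ (fun q => H (N q, q)) 0 := hH.fun_comp_of_eq hpairN hpairN0
    have h2 : AnalyticAt ℂ (fun q : Space k => q.2.2) 0 := by fun_prop
    exact (hW.fun_mul (h2.fun_mul h1)).fun_add hD.analyticAt
  have hscale : Tendsto (fun q : Space k => ((q.1, q.2.1, q.2.2 * W q) : Space k)) (𝓝 0) (𝓝 0) :=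
    tendsto_of_analyticAt (by fun_prop) (by simp)
  obtain ⟨h3, h4⟩ := eq_zero_of_cohomological hk hn'.analytic_μ hn'.slit hr' hE hN (by
      filter_upwards [hD.eventually_eq_zero] with q hq
      simp [hq]) hN0 (hD.mul_param hc) (by
    filter_upwards [hWeq, hX', tendsto_fst_space.eventually hμ, hscale.eventually hR,
      (tendsto_scale hc).eventually hR,
      (tendsto_of_analyticAt hpairN hpairN0).eventually hHeq, hW.eventually_analyticAt,
      hcs.eventually_analyticAt,
      tendsto_fst_space.eventually hc.eventually_analyticAt] with q e1 e2 e3 e4 e5 e6 e7 e8 e9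
    have hcd : fderiv ℂ (fun q : Space k => c q.1) q (0, n'.orbitalForm q) = 0 := by
      have : HasFDerivAt (fun q : Space k => c q.1) _ q :=
        e9.differentiableAt.hasFDerivAt.comp q hasFDerivAt_fst
      rw [this.fderiv]
      simp
    have hNd : HasFDerivAt N _ q :=
      e7.differentiableAt.hasFDerivAt.sub e8.differentiableAt.hasFDerivAt
    rw [← e2, hNd.fderiv, sub_apply, hcd, e1]
    simp only [Invariant.speed, smul_eq_mul] at e4 e6 ⊢
    rw [e4, e3]
    have e7 : c q.1 + N q = W q := by simp only [N]; ring
    have e8 : rc (N q, q) = r (q.1, q.2.1, q.2.2 * W q) := by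
      simp only [rc, e7, mul_comm]
    have e9 : rc (0, q) = r (scale c q) := by simp only [rc, add_zero, scale]
    have e10 : rescale c n.R q = c q.1 * q.2.2 * r (scale c q) := e5
    rw [e7, e8, e9] at e6
    have e11 : D q = c q.1 * q.2.2 * r (scale c q) - n'.R q := by simp only [D, e10]
    have e12 : N q * D q = W q * D q - c q.1 * D q := by simp only [N]; ring
    linear_combination W q * q.2.2 * e6 + W q * e11.symm - e12)
  refine ⟨c, hcu, ⟨hμ, ?_⟩, ?_⟩
  · filter_upwards [h4, hcu.eventually_ne] with q h5 h6
    exact sub_eq_zero.1 ((mul_eq_zero.1 h5).resolve_left h6)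
  · filter_upwards [h3, hηW] with q h5 h6
    rw [h6, sub_eq_zero.1 h5, mul_comm]

/-! ### The time of an equivalence -/

variable {k τ : ℕ} {n n' : Invariant k} {Ψ : Space k → ℂ × ℂ} {V : Space k → ℂ}

section Time

variable {Z : Space k → ℂ × ℂ} {w : Space k → ℂ} {Φ : ℂ × Space k → Space k} {c : Param k → ℂ}
  {F : Space k → ℂ}

theorem analyticAt_comp_scale (hc : AnalyticAt ℂ c 0) (hF : AnalyticAt ℂ F 0) :
    AnalyticAt ℂ (fun q => F (scale c q)) 0 :=
  hF.fun_comp_of_eq (analyticAt_scale hc) (scale_zero c)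

theorem tendsto_time_scale (hc : AnalyticAt ℂ c 0) (hF : AnalyticAt ℂ F 0) :
    Tendsto (fun q => (F (scale c q), scale c q)) (𝓝 0) (𝓝 (F 0, 0)) :=
  tendsto_of_analyticAt ((analyticAt_comp_scale hc hF).prod (analyticAt_scale hc))
    (by simp only [scale_zero])

/-- Any two local flows agree as germs along `ℂ × {0}`, so the existential over flows may be tested
on one fixed flow. -/
theorem isRescaledFlow_iff (h : IsParamFlow Z Φ) (hZ : IsModel Z w) (hc : AnalyticAt ℂ c 0)
    (hF : AnalyticAt ℂ F 0) : IsRescaledFlow Z c F Ψ ↔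
      ∀ᶠ q in 𝓝 0, withParam Ψ q = Φ (F (scale c q), scale c q) := by
  have ht := tendsto_time_scale hc hF
  constructor
  · rintro ⟨Φ', hΦ', hΨ⟩
    have h1 := h.isFlowOn.eventually_eq hΦ'.isParamFlow.isFlowOn (analyticAt_lift hZ.analytic)
      isPreconnected_univ (Set.mem_univ _) (F 0) (Set.mem_univ _)
    filter_upwards [ht.eventually h1, hΨ] with q h2 h3
    rw [h2, withParam, h3]
    rfl
  · intro h1
    refine ⟨_, h.isLocalFlow, ?_⟩
    filter_upwards [h1] with q h2
    change (withParam Ψ q).2 = (Φ (F (scale c q), scale c q)).2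
    rw [h2]

/-- Undoing the first flow leaves a flow with time `F'(c' y) - F(c y)` that carries `scale c'` to
`scale c`. It preserves `x`, so its time is zero; then the two rescalings agree and the times can be
compared at the same point. -/
theorem eventually_eq_of_rescaledFlow (h : IsParamFlow Z Φ) (hZ : IsModel Z w) (hw : w 0 ≠ 0)
    (hk : 1 ≤ k) (hc : IsUnitGerm c) (hF : AnalyticAt ℂ F 0) {c' : Param k → ℂ} {F' : Space k → ℂ}
    (hc' : IsUnitGerm c') (hF' : AnalyticAt ℂ F' 0) (h1 : IsRescaledFlow Z c F Ψ)
    (h2 : IsRescaledFlow Z c' F' Ψ) : F' =ᶠ[𝓝 0] F := by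
  rw [isRescaledFlow_iff h hZ hc.1 hF] at h1
  rw [isRescaledFlow_iff h hZ hc'.1 hF'] at h2
  have hFc := analyticAt_comp_scale hc.1 hF
  have hFc' := analyticAt_comp_scale hc'.1 hF'
  have hs := analyticAt_scale hc.1
  have hs' := analyticAt_scale hc'.1
  have hcomp (s t : ℂ) :=
    h.isFlowOn.comp (analyticAt_lift hZ.analytic) hZ.lift_zero s t
  have ht1 : Tendsto (fun q => ((-F (scale c q), F (scale c q)), scale c q)) (𝓝 0)
      (𝓝 ((-F 0, F 0), 0)) :=
    tendsto_of_analyticAt ((hFc.fun_neg.prod hFc).prod hs) (by simp only [scale_zero])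
  have ht2 : Tendsto (fun q => ((-F (scale c q), F' (scale c' q)), scale c' q)) (𝓝 0)
      (𝓝 ((-F 0, F' 0), 0)) :=
    tendsto_of_analyticAt ((hFc.fun_neg.prod hFc').prod hs') (by simp only [scale_zero])
  have h3 : ∀ᶠ q in 𝓝 0, Φ (-F (scale c q) + F' (scale c' q), scale c' q) = scale c q := by
    filter_upwards [h1, h2, ht1.eventually (hcomp _ _), ht2.eventually (hcomp _ _),
      (tendsto_scale hc.1).eventually h.isFlowOn.init] with q e1 e2 e3 e4 e5
    rw [← e4, ← e2, e1, e3, neg_add_cancel, e5]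
  have h4 := h.time_eq_zero hZ hw hk (T := fun q => -F (scale c q) + F' (scale c' q))
    (hFc.fun_neg.fun_add hFc') hs' (scale_zero c') (fun q => rfl) (fun q => rfl)
    (h3.mono fun q hq => by rw [hq]; rfl)
  refine hc'.eventually_of_scale ?_
  filter_upwards [h3, h4, (tendsto_scale hc'.1).eventually h.isFlowOn.init] with q e1 e2 e3
  rw [e2, e3] at e1
  rw [e1]
  rw [e1] at e2
  linear_combination e2

/-- A rescaling does not touch `x`, so the question is whether the flow preserves `x`, and this
happens only for zero time. -/
theorem isFibered_iff (h : IsParamFlow Z Φ) (hZ : IsModel Z w) (hw : w 0 ≠ 0) (hk : 1 ≤ k)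
    (hc : IsUnitGerm c) (hF : AnalyticAt ℂ F 0) (h1 : IsRescaledFlow Z c F Ψ) :
    (IsFibered Ψ ↔ F =ᶠ[𝓝 0] 0) ∧ (IsFibered Ψ ↔ Ψ =ᶠ[𝓝 0] rescale c (fun q => q.2)) := by
  rw [isRescaledFlow_iff h hZ hc.1 hF] at h1
  have e1 : IsFibered Ψ → F =ᶠ[𝓝 0] 0 := fun hf =>
    hc.eventually_of_scale <| h.time_eq_zero hZ hw hk (analyticAt_comp_scale hc.1 hF)
      (analyticAt_scale hc.1) (scale_zero c) (fun q => rfl) (fun q => rfl) (by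
        filter_upwards [h1, hf] with q h2 h3
        rw [← h2, ← h3]; rfl)
  have e2 : F =ᶠ[𝓝 0] 0 → Ψ =ᶠ[𝓝 0] rescale c (fun q => q.2) := fun hF0 => by
    filter_upwards [h1, (tendsto_scale hc.1).eventually hF0,
      (tendsto_scale hc.1).eventually h.isFlowOn.init] with q h2 h3 h4
    rw [h3, Pi.zero_apply, h4] at h2
    exact congrArg Prod.snd h2
  have e3 : Ψ =ᶠ[𝓝 0] rescale c (fun q => q.2) → IsFibered Ψ := fun h2 => by
    filter_upwards [h2] with q h3
    rw [h3]; rfl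
  exact ⟨⟨e1, e3 ∘ e2⟩, e2 ∘ e1, e3⟩

end Time

/-- Dividing by the unit factors of the normal forms reduces the problem to the orbital forms; the
unit `U` and both factors are absorbed in `V`. -/
theorem IsOrbitalEquivalence.exists_isOrbitalConjugacy (hn : n.IsNormal τ) (hn' : n'.IsNormal τ)
    (h : IsOrbitalEquivalence n.form n'.form Ψ) : ∃ V, IsOrbitalConjugacy n n' Ψ V := by
  obtain ⟨U, hU, hU0, ⟨hΨ, h0, hb⟩, h⟩ := h
  have hwp := analyticAt_withParam hΨ
  have hwp0 := withParam_zero h0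
  refine ⟨fun q => U (withParam Ψ q) * n.factor (withParam Ψ q) / n'.factor q, hΨ, h0,
    ((hU.fun_comp_of_eq hwp hwp0).fun_mul (hn.analyticAt_factor.fun_comp_of_eq hwp hwp0)).fun_div
      hn'.analyticAt_factor hn'.factor_zero_ne, ?_, fun v hv => ?_, ?_⟩
  · rw [hwp0]
    exact div_ne_zero (mul_ne_zero hU0 hn.factor_zero_ne) hn'.factor_zero_ne
  · have h1 := fderiv_fibre (q := 0) hΨ.differentiableAt v
    exact hb.1 ((h1.trans hv).trans (map_zero _).symm)
  · filter_upwards [h, hΨ.eventually_analyticAt, hn'.eventually_factor_ne] with q h1 h2 h3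
    rw [fderiv_fibre h2.differentiableAt, n'.form_eq, n.form_eq, smul_smul] at h1
    have h4 : ((0, n'.factor q • n'.orbitalForm q) : Space k)
        = n'.factor q • (0, n'.orbitalForm q) := by simp
    rw [h4, map_smul] at h1
    rw [div_eq_inv_mul, mul_smul, eq_inv_smul_iff₀ h3]
    exact h1

theorem IsConjugacy.isOrbitalEquivalence {Z Z' : Space k → ℂ × ℂ} (h : IsConjugacy Z Z' Ψ) :
    IsOrbitalEquivalence Z Z' Ψ :=
  ⟨fun _ => 1, analyticAt_const, one_ne_zero, by simpa only [one_smul] using h⟩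

/-- An orbital conjugacy is a linear one followed by a flow. -/
theorem IsOrbitalConjugacy.exists_eq_flow (h : IsOrbitalConjugacy n n' Ψ V) (hn : n.IsNormal τ)
    (hn' : n'.IsNormal τ) (hk : 1 ≤ k) {Φ : ℂ × Space k → Space k} (hΦ : IsParamFlow n.form Φ) :
    ∃ c G, IsUnitGerm c ∧ OrbitalInvariantsMatch c n n' ∧ AnalyticAt ℂ G 0 ∧
      ∀ᶠ q in 𝓝 0, withParam Ψ q = Φ (G q, scale c q) := by
  obtain ⟨G, η, hG, hη, hη0, hηy, h1, h2⟩ := h.exists_fibered hn hn' hk hΦ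
  obtain ⟨c, hc, hm, h3⟩ := eq_linear_of_fibered hn hn' hk hη hη0 hηy h2
  refine ⟨c, G, hc, hm, hG, ?_⟩
  filter_upwards [h1, h3] with q h4 h5
  rw [h4, h5]; rfl

section Linear

variable {c : Param k → ℂ}

theorem hasFDerivAt_rescale (c : Param k → ℂ) (q : Space k) :
    HasFDerivAt (fun p : ℂ × ℂ => rescale c (fun q : Space k => q.2) (q.1, p))
      ((ContinuousLinearMap.fst ℂ ℂ ℂ).prod (c q.1 • ContinuousLinearMap.snd ℂ ℂ ℂ)) q.2 :=
  hasFDerivAt_fst.prodMk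
    ((hasFDerivAt_snd : HasFDerivAt (fun p : ℂ × ℂ => p.2) _ q.2).const_mul (c q.1))

theorem isCoordChange_rescale (hc : IsUnitGerm c) :
    IsCoordChange (rescale c (fun q : Space k => q.2)) := by
  refine ⟨analyticAt_snd.fun_comp (analyticAt_scale hc.1), by simp [rescale], ?_⟩
  have h := (hasFDerivAt_rescale c 0).fderiv
  change fderiv ℂ (fun p : ℂ × ℂ => rescale c (fun q : Space k => q.2) (0, p)) 0 = _ at h
  rw [h]
  refine ⟨fun v w hvw => ?_, fun v => ⟨(v.1, (c 0)⁻¹ * v.2), ?_⟩⟩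
  · have h1 := congrArg Prod.fst hvw
    have h2 := congrArg Prod.snd hvw
    simp only [ContinuousLinearMap.prod_apply, ContinuousLinearMap.coe_fst', smul_apply,
      ContinuousLinearMap.coe_snd', smul_eq_mul, Prod.fst_zero] at h1 h2
    exact Prod.ext h1 (mul_left_cancel₀ hc.2 h2)
  · simp [hc.2]

theorem speed_scale (hm : OrbitalInvariantsMatch c n n') :
    ∀ᶠ q in 𝓝 0, n.speed (scale c q) = n'.speed q := by
  filter_upwards [tendsto_fst_space.eventually hm.1, hm.2] with q h1 h2
  simp only [Invariant.speed]
  rw [← h2, ← h1]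
  rfl

theorem fderiv_rescale_orbitalForm (hm : OrbitalInvariantsMatch c n n') :
    ∀ᶠ q in 𝓝 0, fderiv ℂ (fun p : ℂ × ℂ => rescale c (fun q : Space k => q.2) (q.1, p)) q.2
      (n'.orbitalForm q) = n.orbitalForm (scale c q) := by
  filter_upwards [speed_scale hm] with q h
  rw [(hasFDerivAt_rescale c q).fderiv, n.orbitalForm_eq, n'.orbitalForm_eq, h]
  simp [scale, mul_assoc]

theorem isOrbitalEquivalence_rescale (hn : n.IsNormal τ) (hn' : n'.IsNormal τ) (hc : IsUnitGerm c)
    (hm : OrbitalInvariantsMatch c n n') :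
    IsOrbitalEquivalence n.form n'.form (rescale c (fun q : Space k => q.2)) := by
  -- The rescaling already conjugates the orbital forms. The unit only has to replace one factor by
  -- the other, expressed in the target variable by undoing the rescaling.
  refine ⟨fun q => n'.factor (scale (fun ε => (c ε)⁻¹) q) / n.factor q,
    (analyticAt_comp_scale hc.inv.1 hn'.analyticAt_factor).fun_div hn.analyticAt_factor
      hn.factor_zero_ne, ?_, isCoordChange_rescale hc, ?_⟩
  · simp only [scale_zero]
    exact div_ne_zero hn'.factor_zero_ne hn.factor_zero_ne
  · filter_upwards [fderiv_rescale_orbitalForm hm, hc.inv_scale,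
      (tendsto_scale hc.1).eventually hn.eventually_factor_ne] with q h1 h2 h3
    change _ = (n'.factor (scale (fun ε => (c ε)⁻¹) (scale c q)) / n.factor (scale c q))
      • n.form (scale c q)
    rw [h2, n.form_eq, n'.form_eq, map_smul, h1, smul_smul, div_mul_cancel₀ _ h3]

theorem factor_scale (hm : InvariantsMatch c n n') :
    ∀ᶠ q in 𝓝 0, n.factor (scale c q) = n'.factor q := by
  filter_upwards [tendsto_xy.eventually hm.2.1, hm.2.2.2] with q h1 h2
  simp only [Invariant.factor]
  rw [← h1, ← h2]
  rfl

theorem isConjugacy_rescale (hc : IsUnitGerm c) (hm : InvariantsMatch c n n') :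
    IsConjugacy n.form n'.form (rescale c (fun q : Space k => q.2)) := by
  refine ⟨isCoordChange_rescale hc, ?_⟩
  filter_upwards [fderiv_rescale_orbitalForm ⟨hm.1, hm.2.2.1⟩, factor_scale hm] with q h1 h2
  change _ = n.form (scale c q)
  rw [n.form_eq, n'.form_eq, map_smul, h1, h2]

end Linear

/-- The cohomological equation satisfied by the time of a conjugacy. -/
theorem IsConjugacy.fderiv_time (h : IsConjugacy n.form n'.form Ψ) (hn : n.IsNormal τ)
    (hn' : n'.IsNormal τ) (hk : 1 ≤ k) {Φ : ℂ × Space k → Space k} (hΦ : IsParamFlow n.form Φ)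
    {c : Param k → ℂ} (hc : IsUnitGerm c) (hm : OrbitalInvariantsMatch c n n') {G : Space k → ℂ}
    (hG : AnalyticAt ℂ G 0) (hΨ : ∀ᶠ q in 𝓝 0, withParam Ψ q = Φ (G q, scale c q)) :
    ∀ᶠ q in 𝓝 0, fderiv ℂ G q (0, n'.orbitalForm q)
      = (n'.factor q)⁻¹ - (n.factor (scale c q))⁻¹ := by
  obtain ⟨V, hV⟩ := h.isOrbitalEquivalence.exists_isOrbitalConjugacy hn hn'
  obtain ⟨A, hA, hΨA⟩ := hV.exists_fst_eq hn hn' hk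
  have hZ := hn.isModel
  have hs := analyticAt_scale hc.1
  have hX' := hn'.analyticAt_orbitalForm
  have hwp := analyticAt_withParam h.1.1
  have hwp0 := withParam_zero h.1.2.1
  have hwpt := tendsto_of_analyticAt hwp hwp0
  have hfs : AnalyticAt ℂ (fun q => n.factor (scale c q)) 0 :=
    analyticAt_comp_scale hc.1 hn.analyticAt_factor
  have hpt : Tendsto (fun q => (G q, scale c q)) (𝓝 0) (𝓝 (G 0, 0)) :=
    tendsto_of_analyticAt (by fun_prop) (by rw [scale_zero])
  have hB : AnalyticAt ℂ (fun q => 1 + A q * divP q.1 q.2.1 (Ψ q).1) 0 :=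
    analyticAt_const.fun_add (hA.fun_mul (analyticAt_divP_comp (by fun_prop) (by fun_prop)
      hV.analyticAt_fst))
  have hB0 : ∀ᶠ q in 𝓝 0, 1 + A q * divP q.1 q.2.1 (Ψ q).1 ≠ 0 :=
    hB.continuousAt.eventually_ne (by simp [h.1.2.1, divP_zero hk])
  -- Off `{P = 0}` the normal form at `Ψ` has nonzero first component, as `P(Ψ₁)` is `P` times a
  -- unit. Two multiples of it can then be compared by their coefficients.
  refine (isCoord_P hk).eventually_eq (by fun_prop)
    ((hn'.analyticAt_factor.fun_inv hn'.factor_zero_ne).fun_sub (hfs.fun_inv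
      (by rw [scale_zero]; exact hn.factor_zero_ne))) ?_
  filter_upwards [h.2, h.1.1.eventually_analyticAt, hG.eventually_analyticAt,
    eventually_eventually_nhds.2 hΨ, hs.eventually_analyticAt,
    hpt.eventually (hΦ.analyticAt (G 0)).eventually_analyticAt,
    hpt.eventually (hΦ.isFlowOn.ode (G 0) (Set.mem_univ _)),
    hpt.eventually (hΦ.isFlowOn.fderiv_apply_field (analyticAt_lift hZ.analytic) hZ.lift_zero
      (G 0)), (tendsto_scale hc.1).eventually hn.eventually_factor_ne, hn'.eventually_factor_ne,
    fderiv_rescale_orbitalForm hm, hwpt.eventually hn.eventually_factor_ne, hB0, hΨA]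
    with q h1 h2 h3 h4 h5 h6 h7 h8 h9 h10 h11 h12 h13 h14 hq
  have e0 : ((0, n'.form q) : Space k) = n'.factor q • (0, n'.orbitalForm q) := by
    simp [n'.form_eq]
  have e1 : HasFDerivAt (withParam Ψ) ((ContinuousLinearMap.fst ℂ _ _).prod (fderiv ℂ Ψ q)) q :=
    hasFDerivAt_fst.prodMk h2.differentiableAt.hasFDerivAt
  have e2 : HasFDerivAt (fun q => Φ (G q, scale c q)) _ q :=
    HasFDerivAt.comp (g := Φ) q h6.differentiableAt.hasFDerivAt
      (h3.differentiableAt.hasFDerivAt.prodMk h5.differentiableAt.hasFDerivAt)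
  have e3 := congrArg (fun L => L (0, n'.form q)) (e1.unique (e2.congr_of_eventuallyEq h4))
  have e4 : fderiv ℂ (scale c) q (0, n'.orbitalForm q) = (0, n.orbitalForm (scale c q)) := by
    have e5 : DifferentiableAt ℂ (rescale c (fun q : Space k => q.2)) q :=
      h5.differentiableAt.snd
    have e6 : HasFDerivAt (scale c)
        ((ContinuousLinearMap.fst ℂ _ _).prod (fderiv ℂ (rescale c (fun q : Space k => q.2)) q)) q :=
      hasFDerivAt_fst.prodMk e5.hasFDerivAt
    rw [e6.fderiv, ← h11, fderiv_fibre e5]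
    rfl
  have e7 : lift n.form (scale c q) = n.factor (scale c q) • ((0, n.orbitalForm (scale c q)) :
      Space k) := lift_form n _
  have e8 : (((fderiv ℂ G q).prod (fderiv ℂ (scale c) q)) (0, n'.form q) : ℂ × Space k)
      = (n'.factor q * fderiv ℂ G q (0, n'.orbitalForm q)) • ((1, 0) : ℂ × Space k)
        + (n'.factor q / n.factor (scale c q)) • (0, lift n.form (scale c q)) := by
    have e9 : (n'.factor q / n.factor (scale c q)) •
        ((0, lift n.form (scale c q)) : ℂ × Space k)
        = (0, n'.factor q • ((0, n.orbitalForm (scale c q)) : Space k)) := by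
      rw [e7, Prod.smul_mk, smul_zero, smul_smul, div_mul_cancel₀ _ h9]
    rw [e9, e0, map_smul, ContinuousLinearMap.prod_apply, e4]
    simp
  have e10 : fderiv ℂ Ψ q (0, n'.form q) = n.form (withParam Ψ q) := by
    rw [← fderiv_fibre h2.differentiableAt]; exact h1
  simp only [ContinuousLinearMap.comp_apply] at e3
  rw [e8, map_add, map_smul, map_smul, h7, h8, ← add_smul, ← h4.self_of_nhds] at e3
  have e11 := congrArg (fun v : Space k => v.2.1) e3
  simp only [ContinuousLinearMap.prod_apply, e10, lift, Prod.smul_snd, Prod.smul_fst,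
    smul_eq_mul] at e11
  have e12 : (n.form (withParam Ψ q)).1 ≠ 0 := by
    change n.factor (withParam Ψ q) * P q.1 (Ψ q).1 ≠ 0
    refine mul_ne_zero h12 ?_
    have e13 := P_sub_P q.1 q.2.1 (Ψ q).1
    have e14 : P q.1 (Ψ q).1 = P q.1 q.2.1 * (1 + A q * divP q.1 q.2.1 (Ψ q).1) := by
      have : (Ψ q).1 - q.2.1 = P q.1 q.2.1 * A q := by rw [h14]; ring
      rw [this] at e13
      linear_combination e13
    rw [e14]
    exact mul_ne_zero hq h13
  -- The flow preserves its field, so the image of the second normal form is the first one at `Ψ`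
  -- times this sum: one term from the variation of the time, one from the rescaling. Conjugacy
  -- requires the sum to be `1`.
  have e15 : n'.factor q * fderiv ℂ G q (0, n'.orbitalForm q)
      + n'.factor q / n.factor (scale c q) = 1 :=
    mul_right_cancel₀ e12 (e11.symm.trans (one_mul _).symm)
  field_simp at e15 ⊢
  linear_combination e15

variable {k τ : ℕ} {n n' : Invariant k} {Ψ : Space k → ℂ × ℂ}

/-- This identity is the reason for writing the factor as `u / (1 + u Q)`: its inverse splits into a
part independent of `y` and a section. -/
theorem inv_factor (hn : n.IsNormal τ) :
    ∀ᶠ q in 𝓝 0, (n.factor q)⁻¹ = (n.u (q.1, q.2.1))⁻¹ + n.Q q := by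
  filter_upwards [hn.eventually_u_ne] with q h1
  rw [Invariant.factor, inv_div, add_div, one_div, mul_div_cancel_left₀ _ h1]

/-- The time of a conjugacy depends on the parameter only. -/
theorem time_eq_of_cohomological (hn : n.IsNormal τ) (hn' : n'.IsNormal τ) (hk : 1 ≤ k)
    {c : Param k → ℂ} (hc : IsUnitGerm c) {G : Space k → ℂ} (hG : AnalyticAt ℂ G 0)
    (h : ∀ᶠ q in 𝓝 0, fderiv ℂ G q (0, n'.orbitalForm q)
      = (n'.factor q)⁻¹ - (n.factor (scale c q))⁻¹) :
    n.u =ᶠ[𝓝 0] n'.u ∧ rescale c n.Q =ᶠ[𝓝 0] n'.Q ∧ ∀ᶠ q in 𝓝 0, G q = G (q.1, 0, 0) := by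
  obtain ⟨⟨a, ha, hu⟩, -⟩ := hn.poly_u
  obtain ⟨⟨a', ha', hu'⟩, -⟩ := hn'.poly_u
  obtain ⟨r', hr', -, hX'⟩ := hn'.exists_orbitalForm_eq
  have hQc : IsSection τ (rescale c n.Q) := hn.section_Q.rescale hc.1
  have h1 : ∀ᶠ q in 𝓝 0, fderiv ℂ G q (0, n'.orbitalForm q)
      = (n'.u (q.1, q.2.1))⁻¹ - (n.u (q.1, q.2.1))⁻¹ + (n'.Q q - rescale c n.Q q) := by
    filter_upwards [h, inv_factor hn', (tendsto_scale hc.1).eventually (inv_factor hn)]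
      with q e1 e2 e3
    rw [e1, e2, e3]
    simp only [scale, rescale]
    ring
  have hG₀ : AnalyticAt ℂ (fun p : Param k × ℂ => G (p.1, p.2, 0)) 0 :=
    hG.fun_comp_of_eq (f := fun p : Param k × ℂ => ((p.1, p.2, 0) : Space k)) (by fun_prop) rfl
  have hdG₀ : AnalyticAt ℂ (fun p : Param k × ℂ => fderiv ℂ G (p.1, p.2, 0) (0, 1, 0)) 0 := by
    have : AnalyticAt ℂ (fun q => fderiv ℂ G q (0, 1, 0)) 0 := by fun_prop
    exact this.fun_comp_of_eq (f := fun p : Param k × ℂ => ((p.1, p.2, 0) : Space k))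
      (by fun_prop) rfl
  have hua := hn.poly_u.analyticAt
  have hua' := hn'.poly_u.analyticAt
  have hun := hua.continuousAt.eventually_ne hn.poly_u.2
  have hun' := hua'.continuousAt.eventually_ne hn'.poly_u.2
  -- On `y = 0` the equation is `P ∂ₓG = 1/u' - 1/u`. Multiplied by `u u'`, its right-hand side
  -- becomes `u - u'`, of degree at most `k`, hence a remainder.
  obtain ⟨h2, h3⟩ := eventually_eq_zero_of_P_mul_eq
    (f := fun p : Param k × ℂ => fderiv ℂ G (p.1, p.2, 0) (0, 1, 0) * (n.u p * n'.u p))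
    (a := fun j ε => a j ε - a' j ε) (hdG₀.fun_mul (hua.fun_mul hua'))
    (fun j => (ha j).fun_sub (ha' j)) (by
      filter_upwards [tendsto_section.eventually h1, hun, hun', hu, hu',
        tendsto_section.eventually hQc.eventually_eq_zero,
        tendsto_section.eventually hn'.section_Q.eventually_eq_zero] with p e1 e2 e3 e4 e5 e6 e7
      rw [e6, e7, n'.orbitalForm_eq, fderiv_space_apply] at e1
      simp only [zero_mul, add_zero, sub_zero] at e1
      have e8 : ∑ j : Fin (k + 1), p.2 ^ (j : ℕ) * (a j p.1 - a' j p.1) = n.u p - n'.u p := by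
        rw [e4, e5, ← Finset.sum_sub_distrib]
        exact Finset.sum_congr rfl fun j _ => by ring
      rw [e8, ← mul_assoc, e1]
      change ((n'.u p)⁻¹ - (n.u p)⁻¹) * _ = _
      field_simp)
  have huu : n.u =ᶠ[𝓝 0] n'.u := by
    have h4 : Tendsto (fun p : Param k × ℂ => p.1) (𝓝 0) (𝓝 0) :=
      continuous_fst.tendsto (0 : Param k × ℂ)
    filter_upwards [hu, hu', h4.eventually (eventually_all.2 h3)] with p e1 e2 e3
    rw [e1, e2]
    exact Finset.sum_congr rfl fun j _ => by rw [sub_eq_zero.1 (e3 j)]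
  have hGx : ∀ᶠ p in 𝓝 (0 : Param k × ℂ), G (p.1, p.2, 0) = G (p.1, 0, 0) := by
    have h3 := isCoord_snd.eventually_eq_slice (a := (0 : Param k × ℂ)) rfl hG₀ (by
      filter_upwards [h2, hun, hun', tendsto_section.eventually hG.eventually_analyticAt]
        with p e1 e2 e3 e4
      rw [fderiv_restrict e4.differentiableAt]
      exact (mul_eq_zero.1 e1).resolve_right (mul_ne_zero e2 e3))
    simpa only [slice_snd] using h3
  have ht : AnalyticAt ℂ (fun ε : Param k => G (ε, 0, 0)) 0 :=
    hG.fun_comp_of_eq (f := fun ε : Param k => ((ε, 0, 0) : Space k)) (by fun_prop) rfl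
  have hts : AnalyticAt ℂ (fun q : Space k => G (q.1, 0, 0)) 0 :=
    ht.fun_comp_of_eq analyticAt_fst rfl
  obtain ⟨h4, h5⟩ := eq_zero_of_cohomological hk hn'.analytic_μ hn'.slit hr'
    (E := fun _ => 0) (f := fun q => G q - G (q.1, 0, 0)) analyticAt_const (hG.fun_sub hts)
    (Eventually.of_forall fun _ => rfl)
    (by
      filter_upwards [tendsto_xy.eventually hGx] with q hq
      exact sub_eq_zero.2 hq)
    (hn'.section_Q.sub hQc) (by
      filter_upwards [h1, hX', tendsto_xy.eventually huu, hG.eventually_analyticAt,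
        tendsto_fst_space.eventually ht.eventually_analyticAt] with q e1 e2 e3 e4 e5
      have e6 : HasFDerivAt (fun q : Space k => G (q.1, 0, 0))
          ((fderiv ℂ (fun ε : Param k => G (ε, 0, 0)) q.1).comp
            (ContinuousLinearMap.fst ℂ (Param k) (ℂ × ℂ))) q :=
        HasFDerivAt.comp (g := fun ε : Param k => G (ε, 0, 0)) q
          e5.differentiableAt.hasFDerivAt hasFDerivAt_fst
      have e7 : HasFDerivAt (fun q : Space k => G q - G (q.1, 0, 0)) _ q :=
        e4.differentiableAt.hasFDerivAt.fun_sub e6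
      rw [← e2, e7.fderiv, sub_apply, e1, e3]
      simp)
  exact ⟨huu, h5.mono fun q hq => (sub_eq_zero.1 hq).symm, h4.mono fun q hq => sub_eq_zero.1 hq⟩

theorem IsOrbitalEquivalence.exists_time (hn : n.IsNormal τ) (hn' : n'.IsNormal τ) (hk : 1 ≤ k)
    (h : IsOrbitalEquivalence n.form n'.form Ψ) :
    ∃ c F, IsUnitGerm c ∧ OrbitalInvariantsMatch c n n' ∧ AnalyticAt ℂ F 0 ∧
      IsRescaledFlow n.form c F Ψ := by
  obtain ⟨Φ, hΦ⟩ := hn.exists_isParamFlow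
  obtain ⟨V, hV⟩ := h.exists_isOrbitalConjugacy hn hn'
  obtain ⟨c, G, hc, hm, hG, hΨ⟩ := hV.exists_eq_flow hn hn' hk hΦ
  -- The time `G` is a function of the point before rescaling, whereas `c^*` also acts on `F`; hence
  -- the composition with the inverse rescaling. A time depending on `ε` alone is unaffected by
  -- this.
  have hF := analyticAt_comp_scale hc.inv.1 hG
  refine ⟨c, _, hc, hm, hF, (isRescaledFlow_iff hΦ hn.isModel hc.1 hF).2 ?_⟩
  filter_upwards [hΨ, hc.inv_scale] with q h1 h2
  rw [h1, h2]

theorem IsConjugacy.exists_time (hn : n.IsNormal τ) (hn' : n'.IsNormal τ) (hk : 1 ≤ k)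
    (h : IsConjugacy n.form n'.form Ψ) :
    ∃ c t, IsUnitGerm c ∧ InvariantsMatch c n n' ∧ AnalyticAt ℂ t 0 ∧
      IsRescaledFlow n.form c (fun q => t q.1) Ψ := by
  obtain ⟨Φ, hΦ⟩ := hn.exists_isParamFlow
  obtain ⟨V, hV⟩ := h.isOrbitalEquivalence.exists_isOrbitalConjugacy hn hn'
  obtain ⟨c, G, hc, hm, hG, hΨ⟩ := hV.exists_eq_flow hn hn' hk hΦ
  obtain ⟨hu, hQ, hGt⟩ := time_eq_of_cohomological hn hn' hk hc hG
    (h.fderiv_time hn hn' hk hΦ hc hm hG hΨ)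
  have ht : AnalyticAt ℂ (fun ε : Param k => G (ε, 0, 0)) 0 :=
    hG.fun_comp_of_eq (f := fun ε : Param k => ((ε, 0, 0) : Space k)) (by fun_prop) rfl
  refine ⟨c, _, hc, ⟨hm.1, hu, hm.2, hQ⟩, ht, (isRescaledFlow_iff hΦ hn.isModel hc.1
    (ht.fun_comp_of_eq analyticAt_fst rfl)).2 ?_⟩
  filter_upwards [hΨ, hGt] with q h1 h2
  rw [h1, h2]
  rfl

/-- Equality of germs in the parameter can be tested on the space of all variables. -/
theorem eventuallyEq_param_iff {t t' : Param k → ℂ} :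
    ((fun q : Space k => t q.1) =ᶠ[𝓝 0] fun q => t' q.1) ↔ t =ᶠ[𝓝 0] t' := by
  refine ⟨fun h => ?_, fun h => tendsto_fst_space.eventually h⟩
  have h1 : Tendsto (fun ε : Param k => ((ε, 0, 0) : Space k)) (𝓝 0) (𝓝 0) :=
    tendsto_of_analyticAt (by fun_prop) rfl
  exact h1.eventually h

end SaddleNode

/-! ### Assembly of the two parts of the uniqueness theorem -/

theorem mainTheorem3 (k τ : ℕ) (hk : 1 ≤ k) (n n' : SaddleNode.Invariant k)
    (hn : n.IsNormal τ) (hn' : n'.IsNormal τ) :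
    -- conjugacy
    (((∃ Ψ, SaddleNode.IsConjugacy n.form n'.form Ψ) ↔
        ∃ c, SaddleNode.IsUnitGerm c ∧ SaddleNode.InvariantsMatch c n n') ∧
      ∀ Ψ, SaddleNode.IsConjugacy n.form n'.form Ψ →
        ∃ c t, SaddleNode.IsUnitGerm c ∧ SaddleNode.InvariantsMatch c n n' ∧
          AnalyticAt ℂ t 0 ∧ SaddleNode.IsRescaledFlow n.form c (fun q => t q.1) Ψ ∧
          (∀ c' t', SaddleNode.IsUnitGerm c' → AnalyticAt ℂ t' 0 →
            SaddleNode.IsRescaledFlow n.form c' (fun q => t' q.1) Ψ → t' =ᶠ[𝓝 0] t) ∧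
          (SaddleNode.IsFibered Ψ ↔ t =ᶠ[𝓝 0] 0) ∧
          (SaddleNode.IsFibered Ψ ↔ Ψ =ᶠ[𝓝 0] SaddleNode.rescale c (fun q => q.2))) ∧
    -- orbital equivalence
    (((∃ Ψ, SaddleNode.IsOrbitalEquivalence n.form n'.form Ψ) ↔
        ∃ c, SaddleNode.IsUnitGerm c ∧ SaddleNode.OrbitalInvariantsMatch c n n') ∧
      ∀ Ψ, SaddleNode.IsOrbitalEquivalence n.form n'.form Ψ →
        ∃ c F, SaddleNode.IsUnitGerm c ∧ SaddleNode.OrbitalInvariantsMatch c n n' ∧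
          AnalyticAt ℂ F 0 ∧ SaddleNode.IsRescaledFlow n.form c F Ψ ∧
          (∀ c' F', SaddleNode.IsUnitGerm c' → AnalyticAt ℂ F' 0 →
            SaddleNode.IsRescaledFlow n.form c' F' Ψ → F' =ᶠ[𝓝 0] F) ∧
          (SaddleNode.IsFibered Ψ ↔ F =ᶠ[𝓝 0] 0) ∧
          (SaddleNode.IsFibered Ψ ↔ Ψ =ᶠ[𝓝 0] SaddleNode.rescale c (fun q => q.2))) := by
  obtain ⟨Φ, hΦ⟩ := hn.exists_isParamFlow
  have hw := hn.factor_zero_ne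
  refine ⟨⟨⟨?_, ?_⟩, fun Ψ h => ?_⟩, ⟨?_, ?_⟩, fun Ψ h => ?_⟩
  · rintro ⟨Ψ, h⟩
    obtain ⟨c, -, hc, hm, -⟩ := h.exists_time hn hn' hk
    exact ⟨c, hc, hm⟩
  · rintro ⟨c, hc, hm⟩
    exact ⟨_, SaddleNode.isConjugacy_rescale hc hm⟩
  · obtain ⟨c, t, hc, hm, ht, hΨ⟩ := h.exists_time hn hn' hk
    have hts {t : SaddleNode.Param k → ℂ} (ht : AnalyticAt ℂ t 0) :
        AnalyticAt ℂ (fun q : SaddleNode.Space k => t q.1) 0 :=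
      ht.fun_comp_of_eq analyticAt_fst rfl
    have hfib := SaddleNode.isFibered_iff hΦ hn.isModel hw hk hc (hts ht) hΨ
    refine ⟨c, t, hc, hm, ht, hΨ, fun c' t' hc' ht' hΨ' => ?_, hfib.1.trans ?_, hfib.2⟩
    · exact SaddleNode.eventuallyEq_param_iff.1 (SaddleNode.eventually_eq_of_rescaledFlow hΦ
        hn.isModel hw hk hc (hts ht) hc' (hts ht') hΨ hΨ')
    · exact SaddleNode.eventuallyEq_param_iff (t' := 0)
  · rintro ⟨Ψ, h⟩
    obtain ⟨c, -, hc, hm, -⟩ := h.exists_time hn hn' hk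
    exact ⟨c, hc, hm⟩
  · rintro ⟨c, hc, hm⟩
    exact ⟨_, SaddleNode.isOrbitalEquivalence_rescale hn hn' hc hm⟩
  · obtain ⟨c, F, hc, hm, hF, hΨ⟩ := h.exists_time hn hn' hk
    have hfib := SaddleNode.isFibered_iff hΦ hn.isModel hw hk hc hF hΨ
    exact ⟨c, F, hc, hm, hF, hΨ, fun c' F' hc' hF' hΨ' =>
      SaddleNode.eventually_eq_of_rescaledFlow hΦ hn.isModel hw hk hc hF hc' hF' hΨ hΨ',
      hfib.1, hfib.2⟩
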